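/- For integers $n\ge 2$ and $\mathbf{k}=(k_1,\dots,k_n)$ with all $k_i\ge 2$, let $V(n,\mathbf{k})=\prod_{i=1}^n\{1,\dots,k_i\}$. A line in coordinate $i$ is a set of $k_i$ vertices of $V(n,\mathbf{k})$ that pairwise differ in exactly the $i$th coordinate. Let $\vec{L}(n,\mathbf{k})$ be the random directed graph on $V(n,\mathbf{k})$ obtained by choosing, independently for each line, a winner uniformly at random among the vertices of that line, and placing a directed edge $u\to v$ exactly when $u\ne v$ lie on a common line whose winner is $v$. A vertex is a sink if it has no outgoing edges, and $v$ can be reached from $u$ if there is a directed path from $u$ to $v$ (in particular, every vertex can be reached from itself). Theorem. For every integer $K\ge 2$ there exists $c_K>0$ such that for all integers $n\ge 2$ and all $\mathbf{k}\in\{2,\dots,K\}^n$, the following event fails with probability at most $e^{-c_K n}$: every vertex of $\vec{L}(n,\mathbf{k})$ can either be reached from at most $$\frac{\log K}{\log K-\log(K-1)}$$ vertices, or be reached from every non-sink. -/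

import Mathlib

open MeasureTheory ProbabilityTheory

namespace DirectedGrid

/-- The vertex set `∏ᵢ [kᵢ]` of the Hamming graph. -/
abbrev Vertex {n : ℕ} (k : Fin n → ℕ) : Type :=
  (i : Fin n) → Fin (k i)

/-- The lines of the grid: a line in coordinate `i` consists of the `kᵢ` vertices whose
coordinates other than `i` have prescribed values, so it is given by `i` and these values. -/
abbrev Line {n : ℕ} (k : Fin n → ℕ) : Type :=
  (i : Fin n) × ((j : {j : Fin n // j ≠ i}) → Fin (k j))

/-- The line in coordinate `i` through the vertex `u`. -/
def lineThrough {n : ℕ} {k : Fin n → ℕ} (u : Vertex k) (i : Fin n) : Line k :=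
  ⟨i, fun j => u j⟩

/-- A choice of one winner on each line. The winner of a line in coordinate `i` is recorded by
its `i`-th coordinate, its other coordinates being those of the line. -/
abbrev Winners {n : ℕ} (k : Fin n → ℕ) : Type :=
  (ℓ : Line k) → Fin (k ℓ.1)

/-- The law of the winners: independently on each line, uniform among the vertices of the line. -/
noncomputable def winnerLaw {n : ℕ} (k : Fin n → ℕ) : Measure (Winners k) :=
  Measure.pi fun ℓ => uniformOn (Set.univ : Set (Fin (k ℓ.1)))

/-- The edge relation of the graph `L(n, k)` with winners `ω`: there is an edge `u → v` when
`u` and `v` are distinct vertices of a common line and `v` is the winner of that line. -/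
def Edge {n : ℕ} {k : Fin n → ℕ} (ω : Winners k) (u v : Vertex k) : Prop :=
  ∃ i : Fin n, (∀ j, j ≠ i → v j = u j) ∧ v i ≠ u i ∧ v i = ω (lineThrough u i)

/-- `u` can reach `v` along a directed path (every vertex can reach itself). -/
def CanReach {n : ℕ} {k : Fin n → ℕ} (ω : Winners k) (u v : Vertex k) : Prop :=
  Relation.ReflTransGen (Edge ω) u v

/-- A sink is a vertex without outgoing edges. -/
def IsSink {n : ℕ} {k : Fin n → ℕ} (ω : Winners k) (u : Vertex k) : Prop :=
  ∀ v, ¬ Edge ω u v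

end DirectedGrid

namespace DirectedGrid

/-! ### Lines, winners, and reachability within a set of directions. -/

section Basics

variable {n : ℕ} {k : Fin n → ℕ}

/-! The proof explores forward from a non-sink and backward from a vertex with too many ancestors,
and then joins the two explorations. A set closed under an exploration is stuck: every line that
meets it without lying in it must have its winner inside (forward) or outside (backward). Write `N =
∏ kᵢ`.

Small sets. In all but at most `m²` directions a set of `m` vertices meets `m` distinct lines in one
point each, so in such a direction being stuck has chance `kᵢ^(-m)` forward and `(1 - 1/kᵢ)^m`
backward. There are at most `N (nK)^(2(m-1))` connected sets of size `m`, because each is traced by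
a walk of `2(m-1)` steps. The expected number of stuck ones is therefore exponentially small as soon
as `a · a^(-m) < 1`, respectively `a (1 - 1/a)^m < 1`, for all `2 ≤ a ≤ K`. This means `m ≥ 2`,
respectively `m > log K / (log K - log (K-1))`, and is the origin of the threshold
(`prob_stuck_small_le`, `exists_ratio`).

Large sets. An edge-isoperimetric inequality (`card_boundaryLines_ge`) gives a set of `m` vertices
with sections of density at most `e^(-εn)` of order `mn` boundary lines. For `m` above a constant
this beats the count of connected sets. Both explorations therefore grow to exponential size, up to
a factor `e^(-εn)` of a whole fibre (`exists_large_reachSet`).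

Joining. Two directions are held back while exploring. Two sets this dense have many far-apart
points of the first at distance at most `δn` from the second (`exists_close_pair`,
`exists_separated_close`). Detours through the two reserved directions give routes along lines not
yet revealed (`exists_route`). There are so many disjoint routes that the chance that all fail is
doubly exponentially small (`prob_not_reachIn_le`).

This covers large `n`. For the finitely many remaining `n` it is enough that the failure probability
is less than one, and an explicit good choice of winners shows this (`exists_winners_good`). -/

theorem lineThrough_eq_iff {u v : Vertex k} {i j : Fin n} :
    lineThrough u i = lineThrough v j ↔ i = j ∧ ∀ l, l ≠ i → u l = v l := by
  constructor
  · intro h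
    have h1 : i = j := congrArg Sigma.fst h
    subst h1
    refine ⟨rfl, fun l hl => ?_⟩
    have h2 := eq_of_heq (Sigma.mk.inj h).2
    exact congrFun h2 ⟨l, hl⟩
  · rintro ⟨rfl, h⟩
    unfold lineThrough
    congr 1
    funext l
    exact h l l.2

theorem lineThrough_update (u : Vertex k) (i : Fin n) (c : Fin (k i)) :
    lineThrough (Function.update u i c) i = lineThrough u i := by
  rw [lineThrough_eq_iff]
  exact ⟨rfl, fun l hl => by simp [hl]⟩

/-- The vertex of the line `ℓ` whose coordinate in the direction of `ℓ` is `c`. -/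
def pointOn (ℓ : Line k) (c : Fin (k ℓ.1)) : Vertex k :=
  fun j => if h : j = ℓ.1 then h ▸ c else ℓ.2 ⟨j, h⟩

theorem pointOn_lineThrough (u : Vertex k) (i : Fin n) (c : Fin (k i)) :
    pointOn (lineThrough u i) c = Function.update u i c := by
  funext j
  by_cases h : j = i
  · subst h
    simp [pointOn, lineThrough]
  · simp [pointOn, lineThrough, h]

/-- The coordinate recording the winner of the line in direction `i` through `u`. -/
def lineWinner (ω : Winners k) (u : Vertex k) (i : Fin n) : Fin (k i) :=
  ω (lineThrough u i)

/-- The winner of the line in direction `i` through `u`, as a vertex. -/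
def winner (ω : Winners k) (u : Vertex k) (i : Fin n) : Vertex k :=
  Function.update u i (lineWinner ω u i)

theorem winner_apply_self (ω : Winners k) (u : Vertex k) (i : Fin n) :
    winner ω u i i = lineWinner ω u i := by
  simp [winner]

theorem winner_apply_of_ne (ω : Winners k) (u : Vertex k) {i j : Fin n} (h : j ≠ i) :
    winner ω u i j = u j := by
  simp [winner, h]

theorem eq_winner_iff {ω : Winners k} {u v : Vertex k} {i : Fin n} :
    v = winner ω u i ↔ v i = lineWinner ω u i ∧ ∀ j, j ≠ i → v j = u j := by
  rw [winner, Function.eq_update_iff]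

theorem lineWinner_update (ω : Winners k) (u : Vertex k) (i : Fin n) (c : Fin (k i)) :
    lineWinner ω (Function.update u i c) i = lineWinner ω u i := by
  have h := lineThrough_update u i c
  unfold lineThrough at h
  unfold lineWinner lineThrough
  rw [Sigma.mk.injEq] at h
  rw [eq_of_heq h.2]

/-- The edges in the directions belonging to `s`. -/
def EdgeIn (s : Finset (Fin n)) (ω : Winners k) (u v : Vertex k) : Prop :=
  ∃ i ∈ s, v = winner ω u i ∧ v ≠ u

/-- Reachability along edges in the directions belonging to `s`. -/
def ReachIn (s : Finset (Fin n)) (ω : Winners k) (u v : Vertex k) : Prop :=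
  Relation.ReflTransGen (EdgeIn s ω) u v

theorem edge_iff_edgeIn_univ {ω : Winners k} {u v : Vertex k} :
    Edge ω u v ↔ EdgeIn Finset.univ ω u v := by
  constructor
  · rintro ⟨i, h1, h2, h3⟩
    refine ⟨i, Finset.mem_univ i, ?_, fun h => h2 (by rw [h])⟩
    exact eq_winner_iff.2 ⟨h3, h1⟩
  · rintro ⟨i, -, h, h2⟩
    rw [eq_winner_iff] at h
    refine ⟨i, h.2, fun h3 => h2 ?_, h.1⟩
    funext j
    by_cases hj : j = i
    · subst hj; exact h3
    · exact h.2 j hj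

theorem canReach_iff_reachIn_univ {ω : Winners k} {u v : Vertex k} :
    CanReach ω u v ↔ ReachIn Finset.univ ω u v := by
  have : Edge ω = EdgeIn Finset.univ ω := by
    funext u v; exact propext edge_iff_edgeIn_univ
  unfold CanReach ReachIn
  rw [this]

theorem ReachIn.refl {s : Finset (Fin n)} {ω : Winners k} (u : Vertex k) : ReachIn s ω u u :=
  Relation.ReflTransGen.refl

theorem ReachIn.trans {s : Finset (Fin n)} {ω : Winners k} {u v w : Vertex k}
    (h₁ : ReachIn s ω u v) (h₂ : ReachIn s ω v w) : ReachIn s ω u w :=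
  Relation.ReflTransGen.trans h₁ h₂

theorem reachIn_winner {s : Finset (Fin n)} (ω : Winners k) (u : Vertex k) {i : Fin n}
    (hi : i ∈ s) : ReachIn s ω u (winner ω u i) := by
  by_cases h : winner ω u i = u
  · rw [h]; exact ReachIn.refl u
  · exact Relation.ReflTransGen.single ⟨i, hi, rfl, h⟩

theorem ReachIn.mono {s t : Finset (Fin n)} (hst : s ⊆ t) {ω : Winners k} {u v : Vertex k}
    (h : ReachIn s ω u v) : ReachIn t ω u v := by
  induction h with
  | refl => exact ReachIn.refl u
  | tail _ h ih =>
    obtain ⟨i, hi, h⟩ := h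
    exact Relation.ReflTransGen.tail ih ⟨i, hst hi, h⟩

theorem EdgeIn.apply_eq {s : Finset (Fin n)} {ω : Winners k} {u v : Vertex k}
    (h : EdgeIn s ω u v) {j : Fin n} (hj : j ∉ s) : v j = u j := by
  obtain ⟨i, hi, rfl, -⟩ := h
  exact winner_apply_of_ne ω u fun h => hj (h ▸ hi)

theorem ReachIn.apply_eq {s : Finset (Fin n)} {ω : Winners k} {u v : Vertex k}
    (h : ReachIn s ω u v) {j : Fin n} (hj : j ∉ s) : v j = u j := by
  induction h with
  | refl => rfl
  | tail _ h ih => rw [h.apply_eq hj, ih]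

/-- Reachability inside a fibre depends only on the winners of the lines of that fibre. -/
theorem ReachIn.congr {s : Finset (Fin n)} {ω ω' : Winners k} {u v : Vertex k}
    (hω : ∀ w : Vertex k, (∀ j, j ∉ s → w j = u j) → ∀ i ∈ s,
      lineWinner ω w i = lineWinner ω' w i)
    (h : ReachIn s ω u v) : ReachIn s ω' u v := by
  induction h with
  | refl => exact ReachIn.refl u
  | @tail b c hb hc ih =>
    obtain ⟨i, hi, rfl, hne⟩ := hc
    have : winner ω b i = winner ω' b i := by
      unfold winner
      rw [hω b (fun j hj => ReachIn.apply_eq hb hj) i hi]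
    rw [this]
    exact ih.trans (reachIn_winner ω' b hi)

/-- A choice of winners is given by any function of vertices and directions which is constant
along lines. -/
theorem exists_winners [∀ i, NeZero (k i)] (f : Vertex k → (i : Fin n) → Fin (k i))
    (hf : ∀ u i c, f (Function.update u i c) i = f u i) :
    ∃ ω : Winners k, ∀ u i, lineWinner ω u i = f u i := by
  refine ⟨fun ℓ => f (pointOn ℓ 0) ℓ.1, fun u i => ?_⟩
  have : lineWinner (fun ℓ : Line k => f (pointOn ℓ 0) ℓ.1) u i
      = f (pointOn (lineThrough u i) 0) i := rfl
  rw [this]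
  exact (congrArg (fun w => f w i) (pointOn_lineThrough u i 0)).trans (hf u i 0)

end Basics

/-! ### The law of the winners as normalised counting measure. -/

section Probability

variable {n : ℕ} {k : Fin n → ℕ} [∀ i, NeZero (k i)]

instance lineFactor_isProbabilityMeasure (ℓ : Line k) :
    IsProbabilityMeasure (uniformOn (Set.univ : Set (Fin (k ℓ.1)))) :=
  isProbabilityMeasure_uniformOn Set.finite_univ ⟨0, trivial⟩

instance winnerLaw_isProbabilityMeasure : IsProbabilityMeasure (winnerLaw k) := by
  unfold winnerLaw; infer_instance

theorem winnerLaw_real_cylinder (Λ : Finset (Line k)) (F : (ℓ : Line k) → Finset (Fin (k ℓ.1))) :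
    (winnerLaw k).real {ω | ∀ ℓ ∈ Λ, ω ℓ ∈ F ℓ}
      = ∏ ℓ ∈ Λ, ((F ℓ).card : ℝ) / k ℓ.1 := by
  have h : {ω : Winners k | ∀ ℓ ∈ Λ, ω ℓ ∈ F ℓ}
      = (Λ : Set (Line k)).pi fun ℓ => (F ℓ : Set (Fin (k ℓ.1))) := by
    ext ω; simp [Set.mem_pi]
  rw [h, measureReal_def, winnerLaw, Measure.pi_pi_finset, ENNReal.toReal_prod]
  refine Finset.prod_congr rfl fun ℓ _ => ?_
  rw [uniformOn_univ, Measure.count_apply_finset, ENNReal.toReal_div]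
  simp

theorem winnerLaw_real_singleton (ω : Winners k) :
    (winnerLaw k).real {ω} = (Nat.card (Winners k) : ℝ)⁻¹ := by
  have h : ({ω} : Set (Winners k)) = {ω' | ∀ ℓ ∈ Finset.univ, ω' ℓ ∈ ({ω ℓ} : Finset _)} := by
    ext ω'; simp [funext_iff]
  rw [h, winnerLaw_real_cylinder]
  simp [Nat.card_eq_fintype_card]

theorem winnerLaw_real (S : Set (Winners k)) :
    (winnerLaw k).real S = (S.ncard : ℝ) / Nat.card (Winners k) := by
  classical
  have h : S = ((S.toFinite.toFinset : Finset (Winners k)) : Set (Winners k)) := by simp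
  conv_lhs => rw [h]
  rw [← sum_measureReal_singleton]
  simp only [winnerLaw_real_singleton, Finset.sum_const, nsmul_eq_mul]
  rw [Set.ncard_eq_toFinset_card S S.toFinite, div_eq_mul_inv]

/-- An event which does not depend on the winner of `ℓ` is independent of it. -/
theorem winnerLaw_real_inter_eq (S : Set (Winners k)) (ℓ : Line k) (t : Fin (k ℓ.1))
    (hS : ∀ ω c, ω ∈ S → Function.update ω ℓ c ∈ S) :
    (winnerLaw k).real {ω | ω ∈ S ∧ ω ℓ = t} = (winnerLaw k).real S / k ℓ.1 := by
  have hk : (k ℓ.1 : ℝ) ≠ 0 := by exact_mod_cast NeZero.ne (k ℓ.1)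
  have h : S.ncard = {ω | ω ∈ S ∧ ω ℓ = t}.ncard * k ℓ.1 := by
    rw [← Nat.card_coe_set_eq, ← Nat.card_coe_set_eq]
    have hc : Nat.card {ω | ω ∈ S ∧ ω ℓ = t} * k ℓ.1
        = Nat.card ({ω | ω ∈ S ∧ ω ℓ = t} × Fin (k ℓ.1)) := by
      rw [Nat.card_prod, Nat.card_fin]
    rw [hc]
    refine Nat.card_congr
      ⟨fun ω => (⟨Function.update ω.1 ℓ t, hS _ _ ω.2, by simp⟩, ω.1 ℓ),
        fun p => ⟨Function.update p.1.1 ℓ p.2, hS _ _ p.1.2.1⟩, fun ω => ?_, fun p => ?_⟩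
    · simp
    · obtain ⟨⟨ω, h1, h2⟩, c⟩ := p
      simp [← h2]
  rw [winnerLaw_real, winnerLaw_real, h]
  push_cast
  field_simp

end Probability

/-! ### A deterministic good configuration, for small dimensions. -/

section Existence

variable {n : ℕ} {k : Fin n → ℕ}

/-- In the inductive construction `Fin M` indexes the slabs and `E` holds the vertices labelling
them. `E` is taken as large as possible, so a slab can stay without a label only when `E` already
exhausts `F`. -/
theorem exists_level_labelling {α : Type*} [DecidableEq α] {F D : Finset α} {y₀ : α} {M : ℕ}
    [NeZero M] (hDF : D ⊆ F) (hy₀ : y₀ ∈ D) (hD : D.card ≤ M) :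
    ∃ E : Finset α, D ⊆ E ∧ E ⊆ F ∧ (E = F ∨ E.card = M) ∧
      ∃ l : α → Fin M, Set.InjOn l E ∧ l y₀ = 0 := by
  obtain ⟨E, hDE, hEF, hE⟩ := Finset.exists_subsuperset_card_eq hDF
    (le_min hD (Finset.card_le_card hDF)) (min_le_right M F.card)
  have hEM : E.card ≤ M := hE ▸ min_le_left _ _
  refine ⟨E, hDE, hEF, ?_, ?_⟩
  · rcases le_total M F.card with h | h
    · right; rw [hE, min_eq_left h]
    · left
      exact Finset.eq_of_subset_of_card_le hEF (by rw [hE, min_eq_right h])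
  · let g : E → Fin M := fun y => Fin.castLE hEM (E.equivFin y)
    have hg : Function.Injective g := (Fin.castLE_injective hEM).comp E.equivFin.injective
    let g' : E → Fin M := fun y => Equiv.swap (g ⟨y₀, hDE hy₀⟩) 0 (g y)
    have hg' : Function.Injective g' := (Equiv.injective _).comp hg
    refine ⟨fun y => if h : y ∈ E then g' ⟨y, h⟩ else 0, ?_, ?_⟩
    · intro a ha b hb hab
      have ha' : a ∈ E := ha
      have hb' : b ∈ E := hb
      simp only [ha', hb', dite_true] at hab
      exact congrArg Subtype.val (hg' hab)
    · simp only [hDE hy₀, dite_true]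
      simp [g']

/-- The inductive step: the slabs `x m = a` are connected up cyclically in direction `m`. -/
theorem exists_winners_insert [∀ i, NeZero (k i)] {K : ℕ} (hK : ∀ i, k i ≤ K)
    {s : Finset (Fin n)} {m d : Fin n} (hm : m ∉ s) (hd : d ∈ s) (hdm : k d ≤ k m)
    {W : Vertex k → Winners k}
    (hW : ∀ z x : Vertex k, (∀ j, j ∉ s → x j = z j) →
      ReachIn s (W z) x z ∧
      (¬ ReachIn s (W z) z x → {y | ReachIn s (W z) y x}.ncard ≤ K - 1) ∧
      ∃ c, ReachIn s (W (Function.update z d c)) (Function.update z d c) x)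
    (y₀ : Vertex k) (hy₀ : y₀ m = 0) :
    ∃ (lvl : Vertex k → Fin (k m)) (U : Fin (k m) → Winners k),
      ∀ c, ∀ x : Vertex k, (∀ j, j ∉ insert m s → x j = y₀ j) →
      ReachIn (insert m s) (U c) x (Function.update y₀ m c) ∧
      (¬ ReachIn (insert m s) (U c) (Function.update y₀ m c) x →
        {y | ReachIn (insert m s) (U c) y x}.ncard ≤ K - 1) ∧
      (x m = lvl (Function.update x m 0) + c →
        ReachIn (insert m s) (U c) (Function.update y₀ m c) x) := by
  classical
  have hdm' : d ≠ m := fun h => hm (h ▸ hd)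
  -- `F` is the fibre at level `0`, of which every slab is a copy. `D` is the line along which the
  -- last clause of `hW` moves the root.
  let F : Finset (Vertex k) := Finset.univ.filter fun y => ∀ j, j ∉ s → y j = y₀ j
  have hF : ∀ {y}, y ∈ F ↔ ∀ j, j ∉ s → y j = y₀ j := fun {y} => by simp [F]
  let D : Finset (Vertex k) := Finset.univ.image fun c => Function.update y₀ d c
  have hDF : D ⊆ F := by
    intro y hy
    obtain ⟨c, -, rfl⟩ := Finset.mem_image.1 hy
    refine hF.2 fun j hj => ?_
    have hjd : j ≠ d := fun h => hj (h ▸ hd)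
    rw [Function.update_of_ne hjd]
  have hyD : y₀ ∈ D := Finset.mem_image.2 ⟨y₀ d, Finset.mem_univ _, Function.update_eq_self d y₀⟩
  have hDc : D.card ≤ k m := (Finset.card_image_le.trans (by simp)).trans hdm
  obtain ⟨E, hDE, hEF, hE, l, hl, hl0⟩ := exists_level_labelling hDF hyD hDc
  -- The slab labelled by `p` will carry the winners rooted at `σ p`. All of it reaches `σ p`, whose
  -- line in direction `m` leads to the slab of `σ p`; iterating `σ` runs through all labelled
  -- slabs.
  obtain ⟨σ, hσ, -⟩ := E.exists_cycleOn
  have hσE : ∀ {p}, p ∈ E → σ p ∈ E := fun {p} hp => hσ.1.mapsTo hp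
  -- This is where `D ⊆ E` matters: some vertex of `D` reaches `y`, and it is the root of a labelled
  -- slab. Putting the winner of the `m`-line over `y` into that slab makes this winner reachable
  -- from the cycle.
  have key : ∀ y ∈ F, ∃ p ∈ E, ReachIn s (W (σ p)) (σ p) y := by
    intro y hy
    obtain ⟨c, hc⟩ := (hW y₀ y (hF.1 hy)).2.2
    have hq : Function.update y₀ d c ∈ E :=
      hDE (Finset.mem_image.2 ⟨c, Finset.mem_univ _, rfl⟩)
    obtain ⟨p, hp, hpq⟩ := hσ.1.surjOn hq
    exact ⟨p, hp, by rw [hpq]; exact hc⟩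
  choose! π hπE hπ using key
  let lvl : Vertex k → Fin (k m) := fun y => if y ∈ E then l y else l (π y)
  have lvlE : ∀ {p}, p ∈ E → lvl p = l p := fun {p} hp => if_pos hp
  have lvlF : ∀ {y}, y ∈ F → ∃ p ∈ E, lvl y = l p ∧ (y = p ∨ ReachIn s (W (σ p)) (σ p) y) := by
    intro y hy
    by_cases h : y ∈ E
    · exact ⟨y, h, if_pos h, Or.inl rfl⟩
    · exact ⟨π y, hπE y hy, if_neg h, Or.inr (hπ y hy)⟩
  let e : Fin (k m) → Vertex k := fun a => if h : ∃ p ∈ E, l p = a then h.choose else y₀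
  have he : ∀ {p}, p ∈ E → e (l p) = p := by
    intro p hp
    have h : ∃ q ∈ E, l q = l p := ⟨p, hp, rfl⟩
    have : e (l p) = h.choose := dif_pos h
    rw [this]
    exact hl h.choose_spec.1 hp h.choose_spec.2
  -- The parameter `c` rotates the whole configuration in direction `m`. Each vertex is the winner
  -- of its `m`-line for exactly one `c`, which yields the last clause with `m` in the role of `d`.
  have hU : ∀ c : Fin (k m), ∃ ω : Winners k, ∀ u i, lineWinner ω u i =
      if h : i = m then h ▸ (lvl (Function.update u m 0) + c)
      else lineWinner (W (σ (e (u m - c)))) (Function.update u m 0) i := by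
    intro c
    apply exists_winners
    intro u i b
    by_cases h : i = m
    · subst h; simp
    · simp only [h, dite_false]
      rw [Function.update_comm h, lineWinner_update, Function.update_of_ne (Ne.symm h)]
  choose U hU using hU
  refine ⟨lvl, U, fun c => ?_⟩
  set z := Function.update y₀ m c with hz
  have hUm : ∀ u, lineWinner (U c) u m = lvl (Function.update u m 0) + c := by
    intro u; rw [hU]; simp
  have hUs : ∀ u, ∀ i ∈ s, lineWinner (U c) u i
      = lineWinner (W (σ (e (u m - c)))) (Function.update u m 0) i := by
    intro u i hi
    have : i ≠ m := fun h => hm (h ▸ hi)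
    rw [hU, dif_neg this]
  -- lifting paths to a slab
  have lift : ∀ {p}, p ∈ E → ∀ {y y' : Vertex k}, y ∈ F → ReachIn s (W (σ p)) y y' →
      ReachIn (insert m s) (U c) (Function.update y m (l p + c))
        (Function.update y' m (l p + c)) := by
    intro p hp y y' hy h
    induction h with
    | refl => exact ReachIn.refl _
    | @tail b b' hb hb' ih =>
      obtain ⟨i, hi, rfl, -⟩ := hb'
      have him : i ≠ m := fun h => hm (h ▸ hi)
      have hbm : b m = 0 := by rw [ReachIn.apply_eq hb hm, hF.1 hy m hm, hy₀]
      have : Function.update (winner (W (σ p)) b i) m (l p + c)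
          = winner (U c) (Function.update b m (l p + c)) i := by
        unfold winner
        rw [hUs _ i hi, Function.update_comm him]
        simp only [Function.update_self, add_sub_cancel_right, Function.update_idem]
        rw [he hp]
        congr 2
        rw [← hbm, Function.update_eq_self]
      rw [this]
      exact ih.trans (reachIn_winner _ _ (Finset.mem_insert_of_mem hi))
  have toHat : ∀ x : Vertex k, ReachIn (insert m s) (U c) x
      (Function.update x m (lvl (Function.update x m 0) + c)) := by
    intro x
    have := reachIn_winner (U c) x (Finset.mem_insert_self m s)
    rwa [winner, hUm] at this
  have base : ∀ {x : Vertex k}, (∀ j, j ∉ insert m s → x j = y₀ j) →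
      Function.update x m 0 ∈ F := by
    intro x hx
    refine hF.2 fun j hj => ?_
    by_cases h : j = m
    · subst h; simp [hy₀]
    · rw [Function.update_of_ne h]
      exact hx j (by simp [h, hj])
  have hFm : ∀ {y}, y ∈ F → ∀ a : Fin (k m), Function.update (Function.update y m a) m 0 = y := by
    intro y hy a
    rw [Function.update_idem, ← hy₀, ← hF.1 hy m hm, Function.update_eq_self]
  have next : ∀ {p}, p ∈ E → ∀ {y}, y ∈ F → ReachIn (insert m s) (U c)
      (Function.update y m (l p + c)) (Function.update (σ p) m (l p + c)) := by
    intro p hp y hy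
    have hσF := hEF (hσE hp)
    exact lift hp hy (hW (σ p) y fun j hj => by rw [hF.1 hy j hj, hF.1 hσF j hj]).1
  have hat : ∀ {p}, p ∈ E → ∀ a : Fin (k m), ReachIn (insert m s) (U c)
      (Function.update p m a) (Function.update p m (l p + c)) := by
    intro p hp a
    have := toHat (Function.update p m a)
    rwa [hFm (hEF hp), lvlE hp, Function.update_idem] at this
  have step : ∀ {p}, p ∈ E → ReachIn (insert m s) (U c)
      (Function.update p m (l p + c)) (Function.update (σ p) m (l (σ p) + c)) :=
    fun {p} hp => (next hp (hEF hp)).trans (hat (hσE hp) _)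
  have cycle : ∀ {p}, p ∈ E → ∀ {q}, q ∈ E → ReachIn (insert m s) (U c)
      (Function.update p m (l p + c)) (Function.update q m (l q + c)) := by
    intro p hp q hq
    obtain ⟨t, -, ht⟩ := hσ.exists_pow_eq hp hq
    have : ∀ t : ℕ, (σ ^ t) p ∈ E ∧ ReachIn (insert m s) (U c)
      (Function.update p m (l p + c))
      (Function.update ((σ ^ t) p) m (l ((σ ^ t) p) + c)) := by
      intro t
      induction t with
      | zero => exact ⟨hp, ReachIn.refl _⟩
      | succ t ih =>
        rw [pow_succ', Equiv.Perm.mul_apply]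
        exact ⟨hσE ih.1, ih.2.trans (step ih.1)⟩
    have h2 := (this t).2
    rwa [ht] at h2
  have hy₀E : y₀ ∈ E := hDE hyD
  have hzE : z = Function.update y₀ m (l y₀ + c) := by rw [hl0, zero_add]
  have fromZ : ∀ {p}, p ∈ E → ∀ {y}, ReachIn s (W (σ p)) (σ p) y →
      ReachIn (insert m s) (U c) z (Function.update y m (l p + c)) := by
    intro p hp y hy
    rw [hzE]
    exact ((cycle hy₀E hp).trans (next hp (hEF hp))).trans (lift hp (hEF (hσE hp)) hy)
  have fromZ_hat : ∀ {y}, y ∈ F →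
      ReachIn (insert m s) (U c) z (Function.update y m (lvl y + c)) := by
    intro y hy
    obtain ⟨p, hp, h1, h2⟩ := lvlF hy
    rw [h1]
    rcases h2 with rfl | h2
    · rw [hzE]; exact cycle hy₀E hp
    · exact fromZ hp h2
  intro x hx
  have hxF := base hx
  refine ⟨?_, ?_, ?_⟩
  · obtain ⟨p, hp, h1, -⟩ := lvlF hxF
    have h3 := toHat x
    rw [h1] at h3
    have h4 := next hp hxF
    rw [Function.update_idem] at h4
    rw [hzE]
    exact ((h3.trans h4).trans (hat (hσE hp) _)).trans (cycle (hσE hp) hy₀E)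
  · intro hzx
    -- ancestors of `x` lie in the slab of `x`
    have anc : ∀ w, ReachIn (insert m s) (U c) w x → w m = x m ∧ Function.update w m 0 ∈ F ∧
        ∀ p ∈ E, x m = l p + c →
          ReachIn s (W (σ p)) (Function.update w m 0) (Function.update x m 0) := by
      intro w hw
      induction hw using Relation.ReflTransGen.head_induction_on with
      | refl => exact ⟨rfl, hxF, fun _ _ _ => ReachIn.refl _⟩
      | @head a b hab hbx ih =>
        obtain ⟨ih1, ih2, ih3⟩ := ih
        obtain ⟨i, hi, hb, -⟩ := hab
        have haF : Function.update a m 0 ∈ F := by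
          refine base fun j hj => ?_
          have hjm : j ≠ m := fun h => hj (by simp [h])
          have hjs : j ∉ s := fun h => hj (by simp [h])
          have hji : j ≠ i := fun h => hj (h ▸ hi)
          rw [← winner_apply_of_ne (U c) a hji, ← hb, ← hF.1 ih2 j hjs, Function.update_of_ne hjm]
        -- Winners of `m`-lines are all reached from `z`, so a path to a vertex that `z` does not
        -- reach contains no `m`-step and stays in one slab.
        rcases Finset.mem_insert.1 hi with rfl | his
        · exfalso
          apply hzx
          refine ReachIn.trans ?_ hbx
          rw [hb, winner, hUm]
          have := fromZ_hat haF
          rwa [Function.update_idem] at this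
        · have him : m ≠ i := fun h => hm (h ▸ his)
          have ham : a m = x m := by rw [← ih1, hb, winner_apply_of_ne _ _ him]
          refine ⟨ham, haF, fun p hp hxp => ReachIn.trans ?_ (ih3 p hp hxp)⟩
          have : Function.update b m 0 = winner (W (σ p)) (Function.update a m 0) i := by
            rw [hb]
            unfold winner
            rw [Function.update_comm him.symm, hUs a i his, ham, hxp, add_sub_cancel_right, he hp]
          rw [this]
          exact reachIn_winner _ _ his
    have inj : ∀ a ∈ {w | ReachIn (insert m s) (U c) w x},
        ∀ b ∈ {w | ReachIn (insert m s) (U c) w x},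
        Function.update a m (0 : Fin (k m)) = Function.update b m 0 → a = b := by
      intro a ha b hb hab
      funext j
      by_cases hj : j = m
      · subst hj; rw [(anc a ha).1, (anc b hb).1]
      · have := congrFun hab j
        rwa [Function.update_of_ne hj, Function.update_of_ne hj] at this
    by_cases hp : ∃ p ∈ E, x m = l p + c
    · obtain ⟨p, hp, hxp⟩ := hp
      have hσF := hEF (hσE hp)
      refine le_trans ?_ ((hW (σ p) (Function.update x m 0)
        fun j hj => by rw [hF.1 hxF j hj, hF.1 hσF j hj]).2.1 fun h => hzx ?_)
      · exact Set.ncard_le_ncard_of_injOn (fun w => Function.update w m 0)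
          (fun w hw => (anc w hw).2.2 p hp hxp) inj (Set.toFinite _)
      · have := fromZ hp h
        rwa [Function.update_idem, ← hxp, Function.update_eq_self] at this
    -- A slab without a label forces `E = F` with fewer than `k m` elements, and then the slab as a
    -- whole is small enough.
    · have hcard : F.card ≤ K - 1 := by
        rcases hE with h | h
        · have h1 : F.card < k m := by
            rw [← h]
            by_contra hlt
            push Not at hlt
            have himg : E.image l = Finset.univ := by
              apply Finset.eq_univ_of_card
              rw [Finset.card_image_of_injOn hl]
              refine le_antisymm ?_ (by simpa using hlt)
              have := Finset.card_le_univ (E.image l)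
              rwa [Finset.card_image_of_injOn hl] at this
            have : x m - c ∈ E.image l := himg ▸ Finset.mem_univ _
            obtain ⟨p, hp1, hp2⟩ := Finset.mem_image.1 this
            exact hp ⟨p, hp1, by rw [hp2, sub_add_cancel]⟩
          have := hK m
          omega
        · exfalso
          have himg : E.image l = Finset.univ := by
            apply Finset.eq_univ_of_card
            rw [Finset.card_image_of_injOn hl, h, Fintype.card_fin]
          have : x m - c ∈ E.image l := himg ▸ Finset.mem_univ _
          obtain ⟨p, hp1, hp2⟩ := Finset.mem_image.1 this
          exact hp ⟨p, hp1, by rw [hp2, sub_add_cancel]⟩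
      refine le_trans ?_ hcard
      rw [← Set.ncard_coe_finset F]
      exact Set.ncard_le_ncard_of_injOn (fun w => Function.update w m 0)
          (fun w hw => (anc w hw).2.1) inj (Set.toFinite _)
  · intro h
    have := fromZ_hat hxF
    rwa [Function.update_idem, ← h, Function.update_eq_self] at this

/-- A single good configuration would not carry the induction: different slabs need different roots
`z`, and the roots on one `d`-line must together reach the whole fibre. Directions are added in
order of increasing `k`, so that this `d`-line fits into the labels available in the new direction.
The base case is one line won by `z`. -/
theorem exists_winners_family [∀ i, NeZero (k i)] {K : ℕ} (hK2 : 2 ≤ K) (hK : ∀ i, k i ≤ K)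
    (s : Finset (Fin n)) (hs : s.Nonempty) :
    ∃ d ∈ s, ∃ W : Vertex k → Winners k, ∀ z x : Vertex k, (∀ j, j ∉ s → x j = z j) →
      ReachIn s (W z) x z ∧
      (¬ ReachIn s (W z) z x → {y | ReachIn s (W z) y x}.ncard ≤ K - 1) ∧
      ∃ c, ReachIn s (W (Function.update z d c)) (Function.update z d c) x := by
  induction s using Finset.induction_on_max_value k with
  | empty => exact absurd hs (by simp)
  | insert m s hm hmax ih =>
    rcases s.eq_empty_or_nonempty with rfl | hne
    · refine ⟨m, by simp, ?_⟩
      have h : ∀ z : Vertex k, ∃ ω : Winners k, ∀ u i, lineWinner ω u i = z i :=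
        fun z => exists_winners (fun _ i => z i) fun _ _ _ => rfl
      choose W hW using h
      refine ⟨W, fun z x hx => ?_⟩
      have hxz : ∀ z' : Vertex k, (∀ j, j ∉ insert m (∅ : Finset (Fin n)) → x j = z' j) →
          winner (W z') x m = z' := by
        intro z' hz'
        rw [winner, hW]
        symm
        rw [Function.eq_update_iff]
        exact ⟨rfl, fun j hj => (hz' j (by simp [hj])).symm⟩
      refine ⟨?_, fun hzx => ?_, x m, ?_⟩
      · have := reachIn_winner (W z) x (Finset.mem_insert_self m ∅)
        rwa [hxz z hx] at this
      · have hsub : {y | ReachIn (insert m ∅) (W z) y x} ⊆ {x} := by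
          intro y hy
          rcases Relation.ReflTransGen.cases_tail hy with h | ⟨b, hb, i, hi, hbx, hne⟩
          · exact h.symm
          · exfalso
            have him : i = m := by simpa using hi
            subst him
            apply hzx
            have : x = z := by
              funext j
              by_cases hj : j = i
              · subst hj
                rw [hbx, winner_apply_self, hW]
              · exact hx j (by simp [hj])
            rw [this]; exact ReachIn.refl _
        have := Set.ncard_le_ncard hsub
        rw [Set.ncard_singleton] at this
        omega
      · have : Function.update z m (x m) = x := by
          rw [Function.update_eq_iff]
          exact ⟨rfl, fun j hj => (hx j (by simp [hj])).symm⟩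
        rw [this]; exact ReachIn.refl _
    · obtain ⟨d, hd, W, hW⟩ := ih hne
      refine ⟨m, Finset.mem_insert_self m s, ?_⟩
      have h := fun y₀ : Vertex k =>
        exists_winners_insert hK hm hd (hmax d hd) hW (Function.update y₀ m 0) (by simp)
      choose lvl U hU using h
      -- the data must only depend on the coordinates of `z` other than `m`
      refine ⟨fun z => U (Function.update z m 0) (z m), fun z x hx => ?_⟩
      have hx' : ∀ j, j ∉ insert m s → x j = Function.update (Function.update z m 0) m 0 j := by
        intro j hj
        have hjm : j ≠ m := fun h => hj (by simp [h])
        rw [Function.update_of_ne hjm, Function.update_of_ne hjm, hx j hj]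
      have h1 := hU (Function.update z m 0) (z m) x hx'
      simp only [Function.update_idem, Function.update_eq_self] at h1
      refine ⟨h1.1, h1.2.1, x m - lvl (Function.update z m 0) (Function.update x m 0), ?_⟩
      have h2 := (hU (Function.update z m 0)
        (x m - lvl (Function.update z m 0) (Function.update x m 0)) x hx').2.2
      simp only [Function.update_idem, Function.update_self, add_sub_cancel, true_implies] at h2 ⊢
      exact h2

/-- There is a choice of winners for which every vertex is reached from at most `K - 1` vertices
or from all vertices. -/
theorem exists_winners_good [∀ i, NeZero (k i)] {K : ℕ} (hK2 : 2 ≤ K) (hK : ∀ i, k i ≤ K)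
    (hn : 0 < n) : ∃ ω : Winners k, ∀ v : Vertex k,
      {u | CanReach ω u v}.ncard ≤ K - 1 ∨ ∀ u, CanReach ω u v := by
  obtain ⟨d, -, W, hW⟩ := exists_winners_family hK2 hK Finset.univ ⟨⟨0, hn⟩, Finset.mem_univ _⟩
  let z : Vertex k := fun _ => 0
  have h := fun x => hW z x (by simp)
  refine ⟨W z, fun v => ?_⟩
  simp only [canReach_iff_reachIn_univ]
  by_cases hv : ReachIn Finset.univ (W z) z v
  · exact Or.inr fun u => (h u).1.trans hv
  · exact Or.inl ((h v).2.1 hv)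

end Existence

/-! ### Edge isoperimetry for unequal side lengths. -/

section Isoperimetry

variable {n : ℕ} {k : Fin n → ℕ}

/-- With `X = ∑ x i`, the difference `∑ x i (log X - log (x i))` is at least `m ∑ (log X - log (x
i))`, as all brackets are nonnegative. If `m > 0`, the last sum is at least `N log N`, `N` the
number of terms, by the tangent line of `log` at the mean `X / N`. -/
theorem sum_mul_log_add_le {ι : Type*} [Fintype ι] [Nonempty ι] (x : ι → ℝ) (m : ℝ) (hm : 0 ≤ m)
    (hx : ∀ i, m ≤ x i) :
    ∑ i, x i * Real.log (x i) + Fintype.card ι * m * Real.log (Fintype.card ι)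
      ≤ (∑ i, x i) * Real.log (∑ i, x i) := by
  set X := ∑ i, x i with hX
  set N : ℝ := (Fintype.card ι : ℝ) with hN
  have hNpos : 0 < N := by rw [hN]; exact_mod_cast Fintype.card_pos
  have hx0 : ∀ i, 0 ≤ x i := fun i => hm.trans (hx i)
  have hxX : ∀ i, x i ≤ X := fun i =>
    Finset.single_le_sum (f := x) (fun j _ => hx0 j) (Finset.mem_univ i)
  have hlog : ∀ i, x i * Real.log (x i) ≤ x i * Real.log X - m * Real.log X + m * Real.log (x i) := by
    intro i
    rcases (hx0 i).eq_or_lt with h | h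
    · have hm0 : m = 0 := le_antisymm (h ▸ hx i) hm
      rw [← h, hm0]; simp
    · have := Real.log_le_log h (hxX i)
      nlinarith [hx i]
  have hsum : m * ∑ i, Real.log (x i) ≤ m * (N * Real.log X - N * Real.log N) := by
    rcases hm.eq_or_lt with h | h
    · rw [← h]; simp
    · refine mul_le_mul_of_nonneg_left ?_ hm
      have hxp : ∀ i, 0 < x i := fun i => h.trans_le (hx i)
      have hXp : 0 < X := (hxp (Classical.arbitrary ι)).trans_le (hxX _)
      have h1 : ∀ i, Real.log (x i) ≤ N * x i / X - 1 + Real.log X - Real.log N := by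
        intro i
        have h2 := Real.log_le_sub_one_of_pos (show 0 < N * x i / X by have := hxp i; positivity)
        rw [Real.log_div (by have := hxp i; positivity) hXp.ne',
          Real.log_mul hNpos.ne' (hxp i).ne'] at h2
        linarith
      calc ∑ i, Real.log (x i) ≤ ∑ i, (N * x i / X - 1 + Real.log X - Real.log N) :=
            Finset.sum_le_sum fun i _ => h1 i
        _ = N * (∑ i, x i) / X - N + N * Real.log X - N * Real.log N := by
            simp only [Finset.sum_sub_distrib, Finset.sum_add_distrib, Finset.sum_const,
              Finset.card_univ, nsmul_eq_mul, ← hN, mul_one]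
            rw [← Finset.sum_div, ← Finset.mul_sum]
        _ = N * Real.log X - N * Real.log N := by
            rw [← hX]; field_simp; ring
  calc ∑ i, x i * Real.log (x i) + N * m * Real.log N
      ≤ ∑ i, (x i * Real.log X - m * Real.log X + m * Real.log (x i)) + N * m * Real.log N := by
        gcongr with i; exact hlog i
    _ = X * Real.log X - N * (m * Real.log X) + m * ∑ i, Real.log (x i) + N * m * Real.log N := by
        simp only [Finset.sum_sub_distrib, Finset.sum_add_distrib, Finset.sum_const,
              Finset.card_univ, nsmul_eq_mul, ← hN]
        rw [← Finset.sum_mul, ← Finset.mul_sum]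
    _ ≤ X * Real.log X := by linarith

/-- Slice along a direction `m`. Full lines in other directions stay full inside their slice, and
full `m`-lines number at most the size of the smallest slice. The gain in `x log x` on merging the
slices, `sum_mul_log_add_le`, pays for the latter. -/
theorem sum_full_lines_le [∀ i, NeZero (k i)] (s : Finset (Fin n)) (S : Finset (Vertex k))
    (hS : ∀ u ∈ S, ∀ v ∈ S, ∀ j, j ∉ s → u j = v j) :
    ∑ u ∈ S, ∑ i ∈ s, (if ∀ c, Function.update u i c ∈ S then Real.log (k i) else 0)
      ≤ S.card * Real.log S.card := by
  classical
  induction s using Finset.induction_on generalizing S with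
  | empty =>
    simp only [Finset.sum_empty, Finset.sum_const_zero]
    exact mul_nonneg (Nat.cast_nonneg _) (Real.log_natCast_nonneg _)
  | insert m s hm ih =>
    have hlogm : 0 ≤ Real.log (k m) := Real.log_natCast_nonneg _
    let P : Fin (k m) → Finset (Vertex k) := fun a => S.filter fun u => u m = a
    have hsplit : ∀ f : Vertex k → ℝ, ∑ u ∈ S, f u = ∑ a, ∑ u ∈ P a, f u := fun f =>
      (Finset.sum_fiberwise S (fun u => u m) f).symm
    have hcard : ∑ a, ((P a).card : ℝ) = S.card := by
      have := hsplit fun _ => 1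
      simpa using this.symm
    obtain ⟨b, -, hb⟩ := Finset.exists_min_image Finset.univ (fun a => (P a).card)
      ⟨0, Finset.mem_univ _⟩
    have h1 : ∀ a, ∑ u ∈ P a, ∑ i ∈ s,
        (if ∀ c, Function.update u i c ∈ S then Real.log (k i) else 0)
        ≤ (P a).card * Real.log (P a).card := by
      intro a
      refine le_trans (Finset.sum_le_sum fun u hu => Finset.sum_le_sum fun i hi => ?_)
        (ih (P a) ?_)
      · have him : m ≠ i := fun h => hm (h ▸ hi)
        have hua : u m = a := (Finset.mem_filter.1 hu).2
        refine le_of_eq (if_congr ?_ rfl rfl)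
        refine forall_congr' fun c => ?_
        simp only [P, Finset.mem_filter]
        rw [Function.update_of_ne him]
        simp [hua]
      · intro u hu v hv j hj
        obtain ⟨hu1, hu2⟩ := Finset.mem_filter.1 hu
        obtain ⟨hv1, hv2⟩ := Finset.mem_filter.1 hv
        by_cases hjm : j = m
        · subst hjm; rw [hu2, hv2]
        · exact hS u hu1 v hv1 j (by simp [hjm, hj])
    have h2 : ∀ a, ∑ u ∈ P a, (if ∀ c, Function.update u m c ∈ S then Real.log (k m) else 0)
        ≤ (P b).card * Real.log (k m) := by
      intro a
      rw [← Finset.sum_filter, Finset.sum_const, nsmul_eq_mul]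
      refine mul_le_mul_of_nonneg_right ?_ hlogm
      norm_cast
      refine Finset.card_le_card_of_injOn (fun u => Function.update u m b) ?_ ?_
      · intro u hu
        have hu := (Finset.mem_filter.1 (Finset.mem_coe.1 hu)).2 b
        simp [P, hu]
      · intro u hu v hv huv
        have hu := (Finset.mem_filter.1 (Finset.mem_filter.1 (Finset.mem_coe.1 hu)).1).2
        have hv := (Finset.mem_filter.1 (Finset.mem_filter.1 (Finset.mem_coe.1 hv)).1).2
        funext j
        by_cases hj : j = m
        · subst hj; rw [hu, hv]
        · have := congrFun huv j
          simpa [Function.update_of_ne hj] using this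
    have h3 := sum_mul_log_add_le (fun a => ((P a).card : ℝ)) (P b).card (Nat.cast_nonneg _)
      fun a => by exact_mod_cast hb a (Finset.mem_univ a)
    rw [hcard, Fintype.card_fin] at h3
    refine le_trans ?_ h3
    simp only [Finset.sum_insert hm]
    rw [hsplit]
    calc _ ≤ ∑ a, (((P a).card : ℝ) * Real.log (P a).card + (P b).card * Real.log (k m)) := by
          refine Finset.sum_le_sum fun a _ => ?_
          rw [Finset.sum_add_distrib]
          linarith [h1 a, h2 a]
      _ = _ := by
          rw [Finset.sum_add_distrib, Finset.sum_const, Finset.card_univ, Fintype.card_fin,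
            nsmul_eq_mul, mul_assoc]

open Classical in
/-- The lines in directions belonging to `s` which meet `S` and are not contained in it. -/
noncomputable def boundaryLines (s : Finset (Fin n)) (S : Finset (Vertex k)) : Finset (Line k) :=
  ((S ×ˢ s).filter fun p => ∃ c, Function.update p.1 p.2 c ∉ S).image
    fun p => lineThrough p.1 p.2

theorem mem_boundaryLines {s : Finset (Fin n)} {S : Finset (Vertex k)} {ℓ : Line k} :
    ℓ ∈ boundaryLines s S ↔ ∃ u ∈ S, ∃ i ∈ s, (∃ c, Function.update u i c ∉ S) ∧
      lineThrough u i = ℓ := by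
  simp only [boundaryLines, Finset.mem_image, Finset.mem_filter, Finset.mem_product, Prod.exists]
  constructor
  · rintro ⟨u, i, ⟨⟨hu, hi⟩, hc⟩, h⟩; exact ⟨u, hu, i, hi, hc, h⟩
  · rintro ⟨u, hu, i, hi, hc, h⟩; exact ⟨u, i, ⟨⟨hu, hi⟩, hc⟩, h⟩

/-- Small sets have many boundary lines. -/
theorem card_boundaryLines_ge [∀ i, NeZero (k i)] {K : ℕ} (hK : ∀ i, k i ≤ K)
    (s : Finset (Fin n)) (S : Finset (Vertex k)) (θ : ℝ) 
    (hθ : ∀ x : Vertex k, ((S.filter fun u => ∀ j, j ∉ s → u j = x j).card : ℝ) ≤ θ) :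
    S.card * (∑ i ∈ s, Real.log (k i) - Real.log θ)
      ≤ K * Real.log K * (boundaryLines s S).card := by
  classical
  have hpairs : (((S ×ˢ s).filter fun p => ∃ c, Function.update p.1 p.2 c ∉ S).card : ℝ)
      ≤ K * (boundaryLines s S).card := by
    norm_cast
    unfold boundaryLines
    refine Finset.card_le_mul_card_image (f := fun p : Vertex k × Fin n => lineThrough p.1 p.2)
      _ K ?_
    · intro ℓ hℓ
      obtain ⟨i, y⟩ := ℓ
      refine le_trans ?_ (hK i)
      rw [← Fintype.card_fin (k i), ← Finset.card_univ]
      refine Finset.card_le_card_of_injOn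
        (fun p => p.1 i) (fun _ _ => Finset.mem_coe.2 (Finset.mem_univ _)) ?_
      intro p hp q hq hpq
      have hp := (Finset.mem_filter.1 (Finset.mem_coe.1 hp)).2
      have hq := (Finset.mem_filter.1 (Finset.mem_coe.1 hq)).2
      have hpi : p.2 = i := congrArg Sigma.fst hp
      have h := lineThrough_eq_iff.1 (hp.trans hq.symm)
      refine Prod.ext ?_ h.1
      funext j
      by_cases hj : j = i
      · subst hj; exact hpq
      · exact h.2 j (by rw [hpi]; exact hj)
  have hcount : ∑ u ∈ S, ∑ i ∈ s, (if ∀ c, Function.update u i c ∈ S then 0 else Real.log (k i))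
      ≤ ((S ×ˢ s).filter fun p => ∃ c, Function.update p.1 p.2 c ∉ S).card * Real.log K := by
    rw [← Finset.sum_product' S s
      (fun u i => if ∀ c, Function.update u i c ∈ S then 0 else Real.log (k i)),
      ← nsmul_eq_mul, ← Finset.sum_const, Finset.sum_filter]
    refine Finset.sum_le_sum fun p _ => ?_
    by_cases h : ∀ c, Function.update p.1 p.2 c ∈ S
    · have h' : ¬ ∃ c, Function.update p.1 p.2 c ∉ S := by push Not; exact h
      rw [if_pos h, if_neg h']
    · have h' : ∃ c, Function.update p.1 p.2 c ∉ S := by push Not at h; exact h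
      rw [if_neg h, if_pos h']
      refine Real.log_le_log ?_ (by exact_mod_cast hK p.2)
      exact_mod_cast Nat.pos_of_ne_zero (NeZero.ne (k p.2))
  -- The bound on full lines is applied to each section separately, so the logarithm involves only
  -- the section size `θ` and not the size of `S`.
  have hfull : ∑ u ∈ S, ∑ i ∈ s, (if ∀ c, Function.update u i c ∈ S then Real.log (k i) else 0)
      ≤ S.card * Real.log θ := by
    let g : Vertex k → ((j : {j : Fin n // j ∉ s}) → Fin (k j)) := fun u j => u j
    rw [← Finset.sum_fiberwise S g]
    have hc : (S.card : ℝ) = ∑ y, ((S.filter fun u => g u = y).card : ℝ) := by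
      have := (Finset.sum_fiberwise S g fun _ => (1 : ℝ)).symm
      simpa using this
    rw [hc, Finset.sum_mul]
    refine Finset.sum_le_sum fun y _ => ?_
    set R := S.filter fun u => g u = y with hR
    rcases R.eq_empty_or_nonempty with h | ⟨x, hx⟩
    · rw [h]; simp
    have hgx : g x = y := (Finset.mem_filter.1 hx).2
    have hRx : ∀ u, g u = y ↔ ∀ j, j ∉ s → u j = x j := by
      intro u
      rw [← hgx]
      exact ⟨fun h j hj => congrFun h ⟨j, hj⟩, fun h => funext fun j => h j j.2⟩
    have hRcard : (R.card : ℝ) ≤ θ := by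
      refine le_trans (le_of_eq ?_) (hθ x)
      rw [hR]; simp only [hRx]
    have hRpos : (0 : ℝ) < R.card := by exact_mod_cast Finset.card_pos.2 ⟨x, hx⟩
    refine le_trans ?_ (mul_le_mul_of_nonneg_left (Real.log_le_log hRpos hRcard) hRpos.le)
    refine le_trans (le_of_eq ?_) (sum_full_lines_le s R ?_)
    · refine Finset.sum_congr rfl fun u hu => Finset.sum_congr rfl fun i hi => ?_
      refine if_congr (forall_congr' fun c => ?_) rfl rfl
      rw [hR, Finset.mem_filter, hRx]
      refine ⟨fun h => ⟨h, fun j hj => ?_⟩, fun h => h.1⟩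
      have hji : j ≠ i := fun h => hj (h ▸ hi)
      rw [Function.update_of_ne hji]
      exact (hRx u).1 (Finset.mem_filter.1 hu).2 j hj
    · intro u hu v hv j hj
      rw [(hRx u).1 (Finset.mem_filter.1 hu).2 j hj, (hRx v).1 (Finset.mem_filter.1 hv).2 j hj]
  have htot : ∑ u ∈ S, ∑ i ∈ s, (if ∀ c, Function.update u i c ∈ S then Real.log (k i) else 0)
      + ∑ u ∈ S, ∑ i ∈ s, (if ∀ c, Function.update u i c ∈ S then 0 else Real.log (k i))
      = S.card * ∑ i ∈ s, Real.log (k i) := by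
    simp only [← Finset.sum_add_distrib]
    rw [← nsmul_eq_mul, ← Finset.sum_const]
    refine Finset.sum_congr rfl fun u _ => Finset.sum_congr rfl fun i _ => ?_
    split_ifs <;> simp
  have hlogK : 0 ≤ Real.log K := Real.log_natCast_nonneg _
  nlinarith [mul_le_mul_of_nonneg_right hpairs hlogK]

end Isoperimetry

/-! ### Hamming distance: close pairs in dense sets, and separated subsets. -/

section Distance

variable {n : ℕ} {k : Fin n → ℕ}

/-- Both maxima are at least the average `1`, hence both are at most `1 + η`. At an index with `p c
+ q c ≥ 2` both values are at least `1 - η`, and `p c * q c ≥ p c * (2 - p c) = 1 - (p c - 1)²`. -/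
theorem exists_mul_ge_of_max_mul_lt {ι : Type*} [Fintype ι] {η : ℝ}
    (hη1 : η < 1) (p q : ι → ℝ) (hp : ∑ c, p c = Fintype.card ι) (hq : ∑ c, q c = Fintype.card ι)
    (a b : ι) (ha : ∀ c, p c ≤ p a) (hb : ∀ c, q c ≤ q b) (hab : p a * q b < 1 + η) :
    ∃ c, 1 - η ^ 2 ≤ p c * q c ∧ 0 < p c ∧ 0 < q c := by
  have : Nonempty ι := ⟨a⟩
  have hone : ∀ f : ι → ℝ, ∑ c, f c = Fintype.card ι → ∀ a, (∀ c, f c ≤ f a) → 1 ≤ f a := by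
    intro f hf a ha
    have h : ∑ _c : ι, (1 : ℝ) ≤ ∑ c, f c := by rw [hf]; simp
    obtain ⟨c, -, hc⟩ := Finset.exists_le_of_sum_le Finset.univ_nonempty h
    exact hc.trans (ha c)
  have hpa := hone p hp a ha
  have hqb := hone q hq b hb
  have hp' : ∀ c, p c ≤ 1 + η := fun c => by nlinarith [ha c]
  have hq' : ∀ c, q c ≤ 1 + η := fun c => by nlinarith [hb c]
  have hsum : ∑ _c : ι, (2 : ℝ) ≤ ∑ c, (p c + q c) := by
    rw [Finset.sum_add_distrib, hp, hq]
    simp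
    linarith
  obtain ⟨c, -, hc⟩ := Finset.exists_le_of_sum_le Finset.univ_nonempty hsum
  have hpc : 1 - η ≤ p c := by linarith [hq' c]
  have hqc : 1 - η ≤ q c := by linarith [hp' c]
  refine ⟨c, ?_, by linarith, by linarith⟩
  have h1 : p c * (2 - p c) ≤ p c * q c :=
    mul_le_mul_of_nonneg_left (by linarith) (by linarith)
  nlinarith [hp' c]

/-- Two sets of large density contain vertices at small Hamming distance. -/
theorem exists_close_pair [∀ i, NeZero (k i)] {η : ℝ} (hη0 : 0 ≤ η) (hη1 : η < 1)
    (s : Finset (Fin n)) (S T : Finset (Vertex k)) (hSne : S.Nonempty) (hTne : T.Nonempty)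
    (hS : ∀ u ∈ S, ∀ v ∈ S, ∀ j, j ∉ s → u j = v j)
    (hT : ∀ u ∈ T, ∀ v ∈ T, ∀ j, j ∉ s → u j = v j) :
    ∃ u ∈ S, ∃ v ∈ T, (1 - η ^ 2) ^ s.card * (1 + η) ^ (s.filter fun i => u i ≠ v i).card
      * (S.card * T.card) ≤ (∏ i ∈ s, (k i : ℝ)) ^ 2 := by
  classical
  induction s using Finset.induction_on generalizing S T with
  | empty =>
    obtain ⟨u, hu⟩ := hSne
    obtain ⟨v, hv⟩ := hTne
    refine ⟨u, hu, v, hv, ?_⟩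
    have h1 : (S.card : ℝ) ≤ 1 := by
      exact_mod_cast Finset.card_le_one.2 fun a ha b hb => funext fun j => hS a ha b hb j (by simp)
    have h2 : (T.card : ℝ) ≤ 1 := by
      exact_mod_cast Finset.card_le_one.2 fun a ha b hb => funext fun j => hT a ha b hb j (by simp)
    simp only [Finset.card_empty, Finset.filter_empty, Finset.prod_empty, pow_zero, one_mul,
      one_pow]
    exact mul_le_one₀ h1 (Nat.cast_nonneg _) h2
  | insert m s hm ih =>
    have hη2 : 0 < 1 - η ^ 2 := by nlinarith
    let P : Finset (Vertex k) → Fin (k m) → Finset (Vertex k) :=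
      fun S a => S.filter fun u => u m = a
    have hP : ∀ S : Finset (Vertex k), (∀ u ∈ S, ∀ v ∈ S, ∀ j, j ∉ insert m s → u j = v j) →
        ∀ a, ∀ u ∈ P S a, ∀ v ∈ P S a, ∀ j, j ∉ s → u j = v j := by
      intro S hS a u hu v hv j hj
      obtain ⟨hu1, hu2⟩ := Finset.mem_filter.1 hu
      obtain ⟨hv1, hv2⟩ := Finset.mem_filter.1 hv
      by_cases hjm : j = m
      · subst hjm; rw [hu2, hv2]
      · exact hS u hu1 v hv1 j (by simp [hjm, hj])
    have hcard : ∀ S : Finset (Vertex k), ∑ a, ((P S a).card : ℝ) = S.card := by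
      intro S
      have := (Finset.sum_fiberwise S (fun u => u m) fun _ => (1 : ℝ))
      simpa using this
    have hmax : ∀ S : Finset (Vertex k), ∃ a, ∀ b, (P S b).card ≤ (P S a).card := by
      intro S
      obtain ⟨b, -, hb⟩ := Finset.exists_max_image Finset.univ (fun a => (P S a).card)
        ⟨0, Finset.mem_univ _⟩
      exact ⟨b, fun a => hb a (Finset.mem_univ a)⟩
    have hMpos : (0 : ℝ) < k m := by exact_mod_cast Nat.pos_of_ne_zero (NeZero.ne (k m))
    have hle : ∀ S : Finset (Vertex k), ∀ a, (∀ b, (P S b).card ≤ (P S a).card) →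
        (S.card : ℝ) ≤ k m * (P S a).card := by
      intro S a ha
      rw [← hcard S]
      refine (Finset.sum_le_sum fun b _ => (show ((P S b).card : ℝ) ≤ (P S a).card by
        exact_mod_cast ha b)).trans (le_of_eq ?_)
      simp
    obtain ⟨a, ha⟩ := hmax S
    obtain ⟨b, hb⟩ := hmax T
    have hSpos : (0 : ℝ) < S.card := by exact_mod_cast Finset.card_pos.2 hSne
    have hTpos : (0 : ℝ) < T.card := by exact_mod_cast Finset.card_pos.2 hTne
    have hSa := hle S a ha
    have hTb := hle T b hb
    have hprod : (∏ i ∈ insert m s, (k i : ℝ)) ^ 2 = (k m : ℝ) ^ 2 * (∏ i ∈ s, (k i : ℝ)) ^ 2 := by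
      rw [Finset.prod_insert hm, mul_pow]
    have hne : ∀ {R : Finset (Vertex k)}, (0 : ℝ) < R.card → R.Nonempty := fun {R} h =>
      Finset.card_pos.1 (by exact_mod_cast h)
    rw [hprod, Finset.card_insert_of_notMem hm]
    -- Either the densest slices gain a factor `1 + η` in the product of densities, at the price of
    -- at most one differing coordinate, or the slices are so even that some common slice loses at
    -- most a factor `1 - η ^ 2` at no price.
    by_cases hcase : (1 + η) * (S.card * T.card) ≤ (k m : ℝ) ^ 2 * ((P S a).card * (P T b).card)
    · have hapos : (0 : ℝ) < (P S a).card := by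
        by_contra h; push Not at h; nlinarith
      have hbpos : (0 : ℝ) < (P T b).card := by
        by_contra h; push Not at h; nlinarith
      obtain ⟨u, hu, v, hv, huv⟩ := ih _ _ (hne hapos) (hne hbpos) (hP S hS a) (hP T hT b)
      refine ⟨u, (Finset.mem_filter.1 hu).1, v, (Finset.mem_filter.1 hv).1, ?_⟩
      have hd : ((insert m s).filter fun i => u i ≠ v i).card
          ≤ (s.filter fun i => u i ≠ v i).card + 1 := by
        rw [Finset.filter_insert]
        split_ifs
        · exact Finset.card_insert_le _ _
        · exact Nat.le_succ _
      set D := (s.filter fun i => u i ≠ v i).card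
      calc (1 - η ^ 2) ^ (s.card + 1) * (1 + η) ^ ((insert m s).filter fun i => u i ≠ v i).card
            * (S.card * T.card)
          ≤ (1 - η ^ 2) ^ s.card * (1 + η) ^ (D + 1) * (S.card * T.card) := by
            gcongr ?_ * ?_ * _
            · exact pow_le_pow_of_le_one hη2.le (by nlinarith) (Nat.le_succ _)
            · exact pow_le_pow_right₀ (by linarith) hd
        _ = (1 - η ^ 2) ^ s.card * (1 + η) ^ D * ((1 + η) * (S.card * T.card)) := by ring
        _ ≤ (1 - η ^ 2) ^ s.card * (1 + η) ^ D *
              ((k m : ℝ) ^ 2 * ((P S a).card * (P T b).card)) := by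
            gcongr
        _ = (k m : ℝ) ^ 2 * ((1 - η ^ 2) ^ s.card * (1 + η) ^ D
              * ((P S a).card * (P T b).card)) := by ring
        _ ≤ (k m : ℝ) ^ 2 * (∏ i ∈ s, (k i : ℝ)) ^ 2 := by gcongr
    · push Not at hcase
      -- normalised densities of the slices
      set x : Fin (k m) → ℝ := fun c => ((P S c).card : ℝ) with hx
      set y : Fin (k m) → ℝ := fun c => ((P T c).card : ℝ) with hy
      have hprod' : ∀ c d, k m * x c / S.card * (k m * y d / T.card)
          = (k m : ℝ) ^ 2 * (x c * y d) / (S.card * T.card) := by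
        intro c d; rw [div_mul_div_comm]; ring
      obtain ⟨c, hc1, hc2, hc3⟩ := exists_mul_ge_of_max_mul_lt hη1
        (fun c => k m * x c / S.card) (fun c => k m * y c / T.card)
        (by
          rw [← Finset.sum_div, ← Finset.mul_sum, hcard, mul_div_assoc, div_self hSpos.ne',
            mul_one, Fintype.card_fin])
        (by
          rw [← Finset.sum_div, ← Finset.mul_sum, hcard, mul_div_assoc, div_self hTpos.ne',
            mul_one, Fintype.card_fin]) a b
        (fun c => div_le_div_of_nonneg_right
          (mul_le_mul_of_nonneg_left (Nat.cast_le.2 (ha c)) hMpos.le) hSpos.le)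
        (fun c => div_le_div_of_nonneg_right
          (mul_le_mul_of_nonneg_left (Nat.cast_le.2 (hb c)) hMpos.le) hTpos.le)
        (by
          rw [hprod', div_lt_iff₀ (mul_pos hSpos hTpos)]
          exact hcase)
      have hpqc' : (1 - η ^ 2) * (S.card * T.card)
          ≤ (k m : ℝ) ^ 2 * ((P S c).card * (P T c).card) := by
        rwa [hprod', le_div_iff₀ (mul_pos hSpos hTpos)] at hc1
      have hcpos : (0 : ℝ) < (P S c).card :=
        pos_of_mul_pos_right ((div_pos_iff_of_pos_right hSpos).1 hc2) hMpos.le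
      have hcpos' : (0 : ℝ) < (P T c).card :=
        pos_of_mul_pos_right ((div_pos_iff_of_pos_right hTpos).1 hc3) hMpos.le
      obtain ⟨u, hu, v, hv, huv⟩ := ih _ _ (hne hcpos) (hne hcpos') (hP S hS c) (hP T hT c)
      obtain ⟨hu1, hu2⟩ := Finset.mem_filter.1 hu
      obtain ⟨hv1, hv2⟩ := Finset.mem_filter.1 hv
      refine ⟨u, hu1, v, hv1, ?_⟩
      have hd : (insert m s).filter (fun i => u i ≠ v i) = s.filter fun i => u i ≠ v i := by
        rw [Finset.filter_insert, if_neg (by rw [hu2, hv2]; simp)]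
      rw [hd]
      set D := (s.filter fun i => u i ≠ v i).card
      calc (1 - η ^ 2) ^ (s.card + 1) * (1 + η) ^ D * (S.card * T.card)
          = (1 - η ^ 2) ^ s.card * (1 + η) ^ D * ((1 - η ^ 2) * (S.card * T.card)) := by ring
        _ ≤ (1 - η ^ 2) ^ s.card * (1 + η) ^ D *
              ((k m : ℝ) ^ 2 * ((P S c).card * (P T c).card)) := by
            gcongr
        _ = (k m : ℝ) ^ 2 * ((1 - η ^ 2) ^ s.card * (1 + η) ^ D
              * ((P S c).card * (P T c).card)) := by ring
        _ ≤ (k m : ℝ) ^ 2 * (∏ i ∈ s, (k i : ℝ)) ^ 2 := by gcongr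

/-- Exponential moment bound: the sum of `t ^ hammingDist r w` over all `w` factorises over the
coordinates. -/
theorem card_hammingBall_mul_le {K : ℕ} (hK : ∀ i, k i ≤ K) {t : ℝ} (ht0 : 0 < t) (ht1 : t ≤ 1)
    (r : Vertex k) (ρ : ℕ) :
    ((Finset.univ.filter fun w : Vertex k => hammingDist r w ≤ ρ).card : ℝ) * t ^ ρ
      ≤ (1 + K * t) ^ n := by
  classical
  have h1 : ∀ w : Vertex k, t ^ hammingDist r w = ∏ i, if r i ≠ w i then t else 1 := by
    intro w
    rw [Finset.prod_ite, Finset.prod_const_one, mul_one, Finset.prod_const]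
    rfl
  calc ((Finset.univ.filter fun w : Vertex k => hammingDist r w ≤ ρ).card : ℝ) * t ^ ρ
      = ∑ w : Vertex k with hammingDist r w ≤ ρ, t ^ ρ := by
        rw [Finset.sum_const, nsmul_eq_mul]
    _ ≤ ∑ w : Vertex k with hammingDist r w ≤ ρ, t ^ hammingDist r w := by
        refine Finset.sum_le_sum fun w hw => ?_
        exact pow_le_pow_of_le_one ht0.le ht1 (Finset.mem_filter.1 hw).2
    _ ≤ ∑ w : Vertex k, t ^ hammingDist r w :=
        Finset.sum_le_sum_of_subset_of_nonneg (Finset.filter_subset _ _)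
          fun _ _ _ => by positivity
    _ = ∏ i, ∑ c : Fin (k i), (if r i ≠ c then t else 1) := by
        simp only [h1]
        rw [Finset.prod_univ_sum, Fintype.piFinset_univ]
    _ ≤ ∏ _i : Fin n, (1 + K * t) := by
        refine Finset.prod_le_prod (fun i _ => Finset.sum_nonneg fun c _ => ?_) fun i _ => ?_
        · split_ifs <;> positivity
        · calc ∑ c : Fin (k i), (if r i ≠ c then t else 1)
              ≤ ∑ c : Fin (k i), (t + if r i = c then 1 else 0) := by
                refine Finset.sum_le_sum fun c _ => ?_
                by_cases h : r i = c
                · simp [h, ht0.le]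
                · simp [h]
            _ = k i * t + 1 := by
                rw [Finset.sum_add_distrib]
                simp
            _ ≤ 1 + K * t := by
                have : (k i : ℝ) ≤ K := by exact_mod_cast hK i
                nlinarith
    _ = (1 + K * t) ^ n := by simp

/-- A separated subset of maximal size has radius-`ρ` balls covering `G`. -/
theorem exists_separated_subset (G : Finset (Vertex k)) (ρ β : ℕ)
    (hβ : ∀ r : Vertex k, (Finset.univ.filter fun w : Vertex k => hammingDist r w ≤ ρ).card ≤ β) :
    ∃ M ⊆ G, (∀ r ∈ M, ∀ r' ∈ M, r ≠ r' → ρ < hammingDist r r') ∧ G.card ≤ M.card * β := by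
  classical
  let 𝒞 := G.powerset.filter fun M => ∀ r ∈ M, ∀ r' ∈ M, r ≠ r' → ρ < hammingDist r r'
  obtain ⟨M, hM, hmax⟩ := Finset.exists_max_image 𝒞 Finset.card ⟨∅, by simp [𝒞]⟩
  obtain ⟨hMG, hsep⟩ := Finset.mem_filter.1 hM
  rw [Finset.mem_powerset] at hMG
  refine ⟨M, hMG, hsep, ?_⟩
  have hcover : G ⊆ M.biUnion fun r => Finset.univ.filter fun w => hammingDist r w ≤ ρ := by
    intro g hg
    by_contra h
    have hfar : ∀ r ∈ M, ρ < hammingDist r g := by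
      intro r hr
      by_contra h'
      exact h (Finset.mem_biUnion.2 ⟨r, hr, by simpa using h'⟩)
    have hgM : g ∉ M := fun hgM => by simpa using hfar g hgM
    have : insert g M ∈ 𝒞 := by
      refine Finset.mem_filter.2 ⟨Finset.mem_powerset.2 (Finset.insert_subset hg hMG), ?_⟩
      intro r hr r' hr' hne
      rw [Finset.mem_insert] at hr hr'
      rcases hr with hr | hr <;> rcases hr' with hr' | hr'
      · exact absurd (hr.trans hr'.symm) hne
      · rw [hr, hammingDist_comm]; exact hfar r' hr'
      · rw [hr']; exact hfar r hr
      · exact hsep r hr r' hr' hne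
    have := hmax _ this
    rw [Finset.card_insert_of_notMem hgM] at this
    omega
  refine (Finset.card_le_card hcover).trans (Finset.card_biUnion_le.trans ?_)
  refine (Finset.sum_le_sum fun r _ => hβ r).trans (le_of_eq ?_)
  rw [Finset.sum_const, smul_eq_mul]

end Distance

/-! ### Connected sets encoded by walks; explorations and stuck sets. -/

section Walks

variable {n : ℕ} {k : Fin n → ℕ}

/-- The vertices visited by the walk which starts at `u` and changes coordinates as prescribed. -/
def visited (u : Vertex k) : List ((i : Fin n) × Fin (k i)) → Finset (Vertex k)
  | [] => {u}
  | p :: l => insert u (visited (Function.update u p.1 p.2) l)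

theorem mem_visited_self (u : Vertex k) (l : List ((i : Fin n) × Fin (k i))) :
    u ∈ visited u l := by
  cases l <;> simp [visited]

/-- When the walk is at `t`, insert a detour to the neighbour and straight back: two more steps, one
more vertex. -/
theorem exists_visited_insert (u t : Vertex k) (l : List ((i : Fin n) × Fin (k i)))
    (ht : t ∈ visited u l) (i : Fin n) (c : Fin (k i)) :
    ∃ l' : List ((i : Fin n) × Fin (k i)), l'.length = l.length + 2 ∧
      visited u l' = insert (Function.update t i c) (visited u l) := by
  induction l generalizing u with
  | nil =>
    have : t = u := by simpa [visited] using ht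
    subst this
    refine ⟨[⟨i, c⟩, ⟨i, t i⟩], rfl, ?_⟩
    simp only [visited, Function.update_idem, Function.update_eq_self]
    ext x; simp
  | cons p l ih =>
    rcases Finset.mem_insert.1 ht with rfl | h
    · refine ⟨⟨i, c⟩ :: ⟨i, t i⟩ :: p :: l, rfl, ?_⟩
      rw [visited, visited]
      simp only [Function.update_idem, Function.update_eq_self]
      rw [Finset.insert_comm, Finset.insert_eq_of_mem (mem_visited_self t _)]
    · obtain ⟨l', h1, h2⟩ := ih _ h
      refine ⟨p :: l', by simp [h1], ?_⟩
      rw [visited, h2, visited, Finset.insert_comm]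

/-- `S` is connected in the Hamming graph and contains `v`, expressed through exits. -/
def Spans (v : Vertex k) (S : Finset (Vertex k)) : Prop :=
  v ∈ S ∧ ∀ T : Finset (Vertex k), v ∈ T → ¬ S ⊆ T →
    ∃ t ∈ T, ∃ i c, Function.update t i c ∈ S ∧ Function.update t i c ∉ T

theorem spans_visited (v : Vertex k) (l : List ((i : Fin n) × Fin (k i))) :
    Spans v (visited v l) := by
  refine ⟨mem_visited_self v l, fun T hvT hT => ?_⟩
  induction l generalizing v with
  | nil => exact absurd (by simpa [visited] using hvT) hT
  | cons p l ih =>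
    by_cases h : Function.update v p.1 p.2 ∈ T
    · obtain ⟨t, ht, i, c, h1, h2⟩ := ih _ h fun h' => hT (Finset.insert_subset hvT h')
      exact ⟨t, ht, i, c, Finset.mem_insert_of_mem h1, h2⟩
    · exact ⟨v, hvT, p.1, p.2, Finset.mem_insert_of_mem (mem_visited_self _ l), h⟩

/-- The walk is grown by one detour at a time. Smaller values of `m` serve to cut a connected piece
of prescribed size out of a large exploration. -/
theorem Spans.exists_visited {v : Vertex k} {S : Finset (Vertex k)} (hS : Spans v S) (m : ℕ)
    (hm : m + 1 ≤ S.card) : ∃ l : List ((i : Fin n) × Fin (k i)), l.length = 2 * m ∧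
      visited v l ⊆ S ∧ (visited v l).card = m + 1 := by
  induction m with
  | zero => exact ⟨[], rfl, by simpa [visited] using hS.1, by simp [visited]⟩
  | succ m ih =>
    obtain ⟨l, h1, h2, h3⟩ := ih (by omega)
    have hne : ¬ S ⊆ visited v l := fun h => by
      have := Finset.card_le_card h
      omega
    obtain ⟨t, ht, i, c, h4, h5⟩ := hS.2 _ (mem_visited_self v l) hne
    obtain ⟨l', h6, h7⟩ := exists_visited_insert v t l ht i c
    refine ⟨l', by omega, ?_, ?_⟩
    · rw [h7]; exact Finset.insert_subset h4 h2
    · rw [h7, Finset.card_insert_of_notMem h5, h3]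

theorem Spans.exists_eq_visited {v : Vertex k} {S : Finset (Vertex k)} (hS : Spans v S) :
    ∃ l : List ((i : Fin n) × Fin (k i)), l.length = 2 * (S.card - 1) ∧ S = visited v l := by
  have hpos : 0 < S.card := Finset.card_pos.2 ⟨v, hS.1⟩
  obtain ⟨l, h1, h2, h3⟩ := hS.exists_visited (S.card - 1) (by omega)
  exact ⟨l, h1, (Finset.eq_of_subset_of_card_le h2 (by omega)).symm⟩

open Classical in
/-- The vertices reached from `u` (for `b = true`) or from which `u` is reached (for `b = false`),
in the directions belonging to `s`. -/
noncomputable def reachSet (b : Bool) (s : Finset (Fin n)) (ω : Winners k) (u : Vertex k) :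
    Finset (Vertex k) :=
  Finset.univ.filter fun w => if b then ReachIn s ω u w else ReachIn s ω w u

theorem mem_reachSet_true {s : Finset (Fin n)} {ω : Winners k} {u w : Vertex k} :
    w ∈ reachSet true s ω u ↔ ReachIn s ω u w := by
  simp [reachSet]

theorem mem_reachSet_false {s : Finset (Fin n)} {ω : Winners k} {u w : Vertex k} :
    w ∈ reachSet false s ω u ↔ ReachIn s ω w u := by
  simp [reachSet]

theorem self_mem_reachSet (b : Bool) (s : Finset (Fin n)) (ω : Winners k) (u : Vertex k) :
    u ∈ reachSet b s ω u := by
  cases b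
  · exact mem_reachSet_false.2 (ReachIn.refl u)
  · exact mem_reachSet_true.2 (ReachIn.refl u)

theorem reachSet_apply_eq {b : Bool} {s : Finset (Fin n)} {ω : Winners k} {u w : Vertex k}
    (h : w ∈ reachSet b s ω u) {j : Fin n} (hj : j ∉ s) : w j = u j := by
  cases b
  · exact ((mem_reachSet_false.1 h).apply_eq hj).symm
  · exact (mem_reachSet_true.1 h).apply_eq hj

theorem reachSet_exit {b : Bool} {s : Finset (Fin n)} {ω : Winners k} {u w : Vertex k}
    (h : w ∈ reachSet b s ω u) {T : Finset (Vertex k)} (hu : u ∈ T) (hw : w ∉ T) :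
    ∃ t ∈ T, ∃ i c, Function.update t i c ∈ reachSet b s ω u ∧ Function.update t i c ∉ T := by
  cases b
  · rw [mem_reachSet_false] at h
    induction h using Relation.ReflTransGen.head_induction_on with
    | refl => exact absurd hu hw
    | @head x y hxy hyu ih =>
      by_cases hy : y ∈ T
      · obtain ⟨i, hi, rfl, -⟩ := hxy
        refine ⟨_, hy, i, x i, ?_⟩
        have : Function.update (winner ω x i) i (x i) = x := by
          rw [winner, Function.update_idem, Function.update_eq_self]
        rw [this, mem_reachSet_false]
        exact ⟨(reachIn_winner ω x hi).trans hyu, hw⟩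
      · exact ih hy
  · rw [mem_reachSet_true] at h
    induction h with
    | refl => exact absurd hu hw
    | @tail x y hux hxy ih =>
      by_cases hx : x ∈ T
      · obtain ⟨i, hi, rfl, -⟩ := hxy
        refine ⟨x, hx, i, lineWinner ω x i, ?_⟩
        rw [mem_reachSet_true]
        exact ⟨ReachIn.trans hux (reachIn_winner ω x hi), hw⟩
      · exact ih hx

/-- Explorations in fewer directions, started from all vertices of a connected set, have a connected
union, so the count of connected sets applies to it. -/
theorem Spans.biUnion_reachSet {v : Vertex k} {S : Finset (Vertex k)} (hS : Spans v S) (b : Bool)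
    (s : Finset (Fin n)) (ω : Winners k) : Spans v (S.biUnion (reachSet b s ω)) := by
  have hsub : S ⊆ S.biUnion (reachSet b s ω) := fun u hu =>
    Finset.mem_biUnion.2 ⟨u, hu, self_mem_reachSet b s ω u⟩
  refine ⟨hsub hS.1, fun T hvT hT => ?_⟩
  by_cases h : S ⊆ T
  · obtain ⟨w, hw, hwT⟩ := Finset.not_subset.1 hT
    obtain ⟨u, hu, hwu⟩ := Finset.mem_biUnion.1 hw
    obtain ⟨t, ht, i, c, h1, h2⟩ := reachSet_exit hwu (h hu) hwT
    exact ⟨t, ht, i, c, Finset.mem_biUnion.2 ⟨u, hu, h1⟩, h2⟩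
  · obtain ⟨t, ht, i, c, h1, h2⟩ := hS.2 T hvT h
    exact ⟨t, ht, i, c, hsub h1, h2⟩

theorem spans_reachSet (b : Bool) (s : Finset (Fin n)) (ω : Winners k) (v : Vertex k) :
    Spans v (reachSet b s ω v) := by
  refine ⟨self_mem_reachSet b s ω v, fun T hvT hT => ?_⟩
  obtain ⟨w, hw, hwT⟩ := Finset.not_subset.1 hT
  exact reachSet_exit hw hvT hwT

/-- No edge in a direction of `s` leaves `S` (for `b = true`) or enters `S` (for `b = false`). -/
def Stuck (b : Bool) (s : Finset (Fin n)) (S : Finset (Vertex k)) (ω : Winners k) : Prop :=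
  ∀ u ∈ S, ∀ i ∈ s, (∃ c, Function.update u i c ∉ S) → (winner ω u i ∈ S ↔ b = true)

theorem stuck_biUnion_reachSet (b : Bool) (s : Finset (Fin n)) (ω : Winners k)
    (S : Finset (Vertex k)) : Stuck b s (S.biUnion (reachSet b s ω)) ω := by
  rintro u hu i hi ⟨c, hc⟩
  obtain ⟨v, hv, huv⟩ := Finset.mem_biUnion.1 hu
  cases b
  -- The point off the set lies on the same line and so has the same winner. Were that winner in the
  -- set, this point would be an ancestor too and belong to the set.
  · refine iff_of_false (fun h => hc ?_) (by simp)
    obtain ⟨v', hv', hw⟩ := Finset.mem_biUnion.1 h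
    refine Finset.mem_biUnion.2 ⟨v', hv', ?_⟩
    rw [mem_reachSet_false] at hw ⊢
    have : winner ω u i = winner ω (Function.update u i c) i := by
      rw [winner, winner, lineWinner_update, Function.update_idem]
    rw [this] at hw
    exact (reachIn_winner ω _ hi).trans hw
  · refine iff_of_true (Finset.mem_biUnion.2 ⟨v, hv, ?_⟩) rfl
    rw [mem_reachSet_true] at huv ⊢
    exact huv.trans (reachIn_winner ω u hi)

theorem stuck_reachSet (b : Bool) (s : Finset (Fin n)) (ω : Winners k)
    (v : Vertex k) : Stuck b s (reachSet b s ω v) ω := by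
  have := stuck_biUnion_reachSet b s ω {v}
  rwa [Finset.singleton_biUnion] at this

end Walks

/-! ### Probability of being stuck, and the union bound over connected sets. -/

section UnionBounds

variable {n : ℕ} {k : Fin n → ℕ} [∀ i, NeZero (k i)]

/-- Union bound over starting vertices and sequences of `2 * (m - 1)` steps, with `∑ k i ≤ n * K`
choices per step. The number of starting vertices is kept exact, since for small sets it must be
cancelled direction by direction. -/
theorem prob_exists_spans_le {K : ℕ} (hK : ∀ i, k i ≤ K) (m : ℕ)
    (E : Finset (Vertex k) → Set (Winners k)) (p : ℝ) (hp0 : 0 ≤ p)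
    (hp : ∀ v S, Spans v S → S.card = m → (winnerLaw k).real (E S) ≤ p) :
    (winnerLaw k).real {ω | ∃ v S, Spans v S ∧ S.card = m ∧ ω ∈ E S}
      ≤ (n * K : ℝ) ^ (2 * (m - 1)) * ((∏ i, (k i : ℝ)) * p) := by
  classical
  let Step := (i : Fin n) × Fin (k i)
  let X := Vertex k × (Fin (2 * (m - 1)) → Step)
  let A : X → Set (Winners k) := fun x =>
    if (visited x.1 (List.ofFn x.2)).card = m then E (visited x.1 (List.ofFn x.2)) else ∅
  have hsub : {ω | ∃ v S, Spans v S ∧ S.card = m ∧ ω ∈ E S} ⊆ ⋃ x, A x := by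
    rintro ω ⟨v, S, hS, hm, hω⟩
    obtain ⟨l, hl, hSl⟩ := hS.exists_eq_visited
    rw [hm] at hl
    refine Set.mem_iUnion.2 ⟨⟨v, fun j => l.get (Fin.cast hl.symm j)⟩, ?_⟩
    have : List.ofFn (fun j => l.get (Fin.cast hl.symm j)) = l := by
      apply List.ext_get
      · simp [hl]
      · intro j h1 h2; simp
    simp only [A]
    rw [this, ← hSl, if_pos hm]
    exact hω
  have hA : ∀ x, (winnerLaw k).real (A x) ≤ p := by
    intro x
    simp only [A]
    split_ifs with h
    · exact hp x.1 _ (spans_visited _ _) h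
    · simpa using hp0
  have hcard : (Fintype.card X : ℝ) ≤ (∏ i, (k i : ℝ)) * (n * K : ℝ) ^ (2 * (m - 1)) := by
    have h1 : Fintype.card X = (∏ i, k i) * (∑ i, k i) ^ (2 * (m - 1)) := by
      simp [X, Step, Fintype.card_prod]
    have h2 : ∑ i, k i ≤ n * K := by
      calc ∑ i, k i ≤ ∑ _i : Fin n, K := Finset.sum_le_sum fun i _ => hK i
        _ = n * K := by simp
    rw [h1]
    push_cast
    have h3 : (∑ i, (k i : ℝ)) ≤ n * K := by exact_mod_cast h2
    gcongr
  calc _ ≤ (winnerLaw k).real (⋃ x, A x) := measureReal_mono hsub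
    _ ≤ ∑ x, (winnerLaw k).real (A x) := measureReal_iUnion_fintype_le _
    _ ≤ ∑ _x : X, p := Finset.sum_le_sum fun x _ => hA x
    _ = Fintype.card X * p := by simp
    _ ≤ ((∏ i, (k i : ℝ)) * (n * K : ℝ) ^ (2 * (m - 1))) * p := by gcongr
    _ = _ := by ring

open Classical in
/-- The winners of `ℓ` compatible with `S` being stuck. -/
noncomputable def allowed (b : Bool) (S : Finset (Vertex k)) (ℓ : Line k) : Finset (Fin (k ℓ.1)) :=
  Finset.univ.filter fun c => (pointOn ℓ c ∈ S ↔ b = true)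

omit [∀ i, NeZero (k i)] in
theorem card_allowed_lineThrough (b : Bool) (S : Finset (Vertex k)) (u : Vertex k) (i : Fin n)
    [DecidablePred fun c : Fin (k i) => (Function.update u i c ∈ S ↔ b = true)] :
    (allowed b S (lineThrough u i)).card
      = (Finset.univ.filter fun c : Fin (k i) => (Function.update u i c ∈ S ↔ b = true)).card := by
  have h : ∀ c : Fin (k i), (Function.update u i c ∈ S ↔ b = true) ↔
      (pointOn (lineThrough u i) c ∈ S ↔ b = true) := fun c => by rw [pointOn_lineThrough]
  refine Finset.card_bij (fun c _ => c) (fun c hc => ?_) (fun _ _ _ _ h => h)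
    fun c hc => ⟨c, ?_, rfl⟩
  · have hc' := (Finset.mem_filter.1 hc).2
    exact Finset.mem_filter.2 ⟨Finset.mem_univ _, (h c).2 hc'⟩
  · have hc' := (Finset.mem_filter.1 hc).2
    exact Finset.mem_filter.2 ⟨Finset.mem_univ _, (h c).1 hc'⟩

/-- Being stuck constrains the winner of each boundary line separately, and winners of distinct
lines are independent. -/
theorem prob_stuck_le_prod (b : Bool) (s : Finset (Fin n)) (S : Finset (Vertex k))
    (Λ : Finset (Line k)) (hΛ : Λ ⊆ boundaryLines s S) :
    (winnerLaw k).real {ω | Stuck b s S ω}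
      ≤ ∏ ℓ ∈ Λ, ((allowed b S ℓ).card : ℝ) / k ℓ.1 := by
  rw [← winnerLaw_real_cylinder]
  refine measureReal_mono fun ω hω ℓ hℓ => ?_
  obtain ⟨u, hu, i, hi, hc, rfl⟩ := mem_boundaryLines.1 (hΛ hℓ)
  refine Finset.mem_filter.2 ⟨Finset.mem_univ _, ?_⟩
  have := hω u hu i hi hc
  rw [← this]
  have h2 : pointOn (lineThrough u i) (ω (lineThrough u i)) = winner ω u i :=
    pointOn_lineThrough u i _
  rw [h2]

omit [∀ i, NeZero (k i)] in
theorem card_allowed_lt {b : Bool} {s : Finset (Fin n)} {S : Finset (Vertex k)} {ℓ : Line k}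
    (hℓ : ℓ ∈ boundaryLines s S) : (allowed b S ℓ).card < k ℓ.1 := by
  obtain ⟨u, hu, i, hi, ⟨c, hc⟩, rfl⟩ := mem_boundaryLines.1 hℓ
  classical
  rw [card_allowed_lineThrough]
  refine lt_of_lt_of_eq (Finset.card_lt_univ_of_notMem (x := if b then c else u i) fun h => ?_)
    (Fintype.card_fin (k i))
  have h := (Finset.mem_filter.1 h).2
  cases b
  · simp [hu] at h
  · simp [hc] at h

/-- A boundary line contains points both inside and outside `S`, so at least one of its at most `K`
possible winners is forbidden. -/
theorem prob_stuck_le {K : ℕ} (hK : ∀ i, k i ≤ K) (b : Bool) (s : Finset (Fin n))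
    (S : Finset (Vertex k)) :
    (winnerLaw k).real {ω | Stuck b s S ω} ≤ (1 - 1 / K : ℝ) ^ (boundaryLines s S).card := by
  refine (prob_stuck_le_prod b s S _ subset_rfl).trans ?_
  rw [← Finset.prod_const]
  refine Finset.prod_le_prod (fun ℓ _ => by positivity) fun ℓ hℓ => ?_
  have h1 : ((allowed b S ℓ).card : ℝ) + 1 ≤ k ℓ.1 := by exact_mod_cast card_allowed_lt hℓ
  have h2 : (k ℓ.1 : ℝ) ≤ K := by exact_mod_cast hK ℓ.1
  have h3 : (0 : ℝ) < k ℓ.1 := by exact_mod_cast Nat.pos_of_ne_zero (NeZero.ne (k ℓ.1))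
  calc ((allowed b S ℓ).card : ℝ) / k ℓ.1 ≤ (k ℓ.1 - 1) / k ℓ.1 := by gcongr; linarith
    _ = 1 - 1 / k ℓ.1 := by field_simp
    _ ≤ 1 - 1 / K := by gcongr

/-- The chance that a line meeting `S` in a single point is compatible with `S` being stuck. -/
noncomputable def singleChance (b : Bool) (m : ℕ) : ℝ := if b then 1 / m else 1 - 1 / m

theorem singleChance_nonneg (b : Bool) {m : ℕ} (hm : 1 ≤ m) : 0 ≤ singleChance b m := by
  have h1 : (1 : ℝ) ≤ m := by exact_mod_cast hm
  cases b
  · simp only [singleChance, Bool.false_eq_true, if_false, sub_nonneg]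
    exact (div_le_one (by linarith)).2 h1
  · simp only [singleChance, if_true]
    positivity

theorem card_allowed_of_single (b : Bool) {S : Finset (Vertex k)} {u : Vertex k} (hu : u ∈ S)
    {i : Fin n} (h : ∀ c, Function.update u i c ∈ S → c = u i) :
    ((allowed b S (lineThrough u i)).card : ℝ) / k i = singleChance b (k i) := by
  have hk : (0 : ℝ) < k i := by exact_mod_cast Nat.pos_of_ne_zero (NeZero.ne (k i))
  have hk1 : 1 ≤ k i := Nat.one_le_iff_ne_zero.2 (NeZero.ne (k i))
  classical
  have hmem : ∀ c : Fin (k i), (Function.update u i c ∈ S ↔ c = u i) := by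
    intro c
    refine ⟨h c, ?_⟩
    rintro rfl
    rwa [Function.update_eq_self]
  rw [card_allowed_lineThrough]
  simp only [hmem]
  cases b
  · have h2 : (Finset.univ.filter fun c : Fin (k i) => (c = u i ↔ false = true))
        = Finset.univ.erase (u i) := by
      ext c; simp
    rw [h2, Finset.card_erase_of_mem (Finset.mem_univ _), Finset.card_univ, Fintype.card_fin,
      Nat.cast_sub hk1]
    simp only [singleChance, Bool.false_eq_true, if_false]
    field_simp
    simp
  · have h2 : (Finset.univ.filter fun c : Fin (k i) => (c = u i ↔ true = true)) = {u i} := by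
      ext c; simp
    rw [h2, Finset.card_singleton]
    simp [singleChance]

/-- Small sets are unlikely to be stuck, even after multiplication by the number of vertices. -/
theorem prob_stuck_small_le {K : ℕ} (hK : ∀ i, 2 ≤ k i ∧ k i ≤ K) (b : Bool)
    (S : Finset (Vertex k)) {ρ : ℝ} (hρ0 : 0 < ρ) (hρ1 : ρ ≤ 1)
    (hρ : ∀ i, k i * singleChance b (k i) ^ S.card ≤ ρ) (hn : S.card ^ 2 ≤ n) :
    (∏ i, (k i : ℝ)) * (winnerLaw k).real {ω | Stuck b Finset.univ S ω}
      ≤ K ^ S.card ^ 2 * ρ ^ (n - S.card ^ 2) := by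
  classical
  -- Directions with a line containing two points of `S`. Such a pair of points determines its
  -- direction, hence at most `S.card ^ 2` directions are bad.
  let bad : Finset (Fin n) := Finset.univ.filter fun i =>
    ∃ u ∈ S, ∃ c, Function.update u i c ∈ S ∧ c ≠ u i
  have hbad : bad.card ≤ S.card ^ 2 := by
    have h1 : ∀ i ∈ bad, ∃ p ∈ S ×ˢ S, p.2 i ≠ p.1 i ∧ ∀ j, j ≠ i → p.2 j = p.1 j := by
      intro i hi
      obtain ⟨u, hu, c, hc, hcu⟩ := (Finset.mem_filter.1 hi).2
      refine ⟨(u, Function.update u i c), Finset.mem_product.2 ⟨hu, hc⟩, by simpa using hcu, ?_⟩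
      intro j hj; simp [hj]
    choose! f hf1 hf2 hf3 using h1
    rw [sq, ← Finset.card_product]
    refine Finset.card_le_card_of_injOn f (fun i hi => hf1 i hi) ?_
    intro i hi j hj hij
    by_contra hne
    have := hf3 j hj i hne
    rw [← hij] at this
    exact hf2 i hi this
  let I := badᶜ
  have hI : n - S.card ^ 2 ≤ I.card := by
    have : bad.card + I.card = n := by
      rw [Finset.card_add_card_compl, Fintype.card_fin]
    omega
  have hgood : ∀ i ∈ I, ∀ u ∈ S, ∀ c, Function.update u i c ∈ S → c = u i := by
    intro i hi u hu c hc
    by_contra h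
    exact (Finset.mem_compl.1 hi) (Finset.mem_filter.2 ⟨Finset.mem_univ _, u, hu, c, hc, h⟩)
  let Λ := (I ×ˢ S).image fun p => lineThrough p.2 p.1
  have hinj : Set.InjOn (fun p : Fin n × Vertex k => lineThrough p.2 p.1) (I ×ˢ S : Finset _) := by
    rintro ⟨i, u⟩ hp ⟨j, v⟩ hq h
    obtain ⟨hi, hu⟩ := Finset.mem_product.1 (Finset.mem_coe.1 hp)
    obtain ⟨hj, hv⟩ := Finset.mem_product.1 (Finset.mem_coe.1 hq)
    obtain ⟨hij, h'⟩ := lineThrough_eq_iff.1 h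
    simp only at hi hu hj hv hij h'
    subst hij
    have huv : Function.update u i (v i) = v := by
      rw [Function.update_eq_iff]
      exact ⟨rfl, fun l hl => h' l hl⟩
    have := hgood i hi u hu (v i) (by rw [huv]; exact hv)
    rw [this, Function.update_eq_self] at huv
    rw [huv]
  have hΛ : Λ ⊆ boundaryLines Finset.univ S := by
    intro ℓ hℓ
    obtain ⟨⟨i, u⟩, hp, rfl⟩ := Finset.mem_image.1 hℓ
    obtain ⟨hi, hu⟩ := Finset.mem_product.1 hp
    refine mem_boundaryLines.2 ⟨u, hu, i, Finset.mem_univ _, ?_, rfl⟩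
    have : Nontrivial (Fin (k i)) := Fin.nontrivial_iff_two_le.2 (hK i).1
    obtain ⟨c, hc⟩ := exists_ne (u i)
    exact ⟨c, fun h => hc (hgood i hi u hu c h)⟩
  have hP : (winnerLaw k).real {ω | Stuck b Finset.univ S ω}
      ≤ ∏ i ∈ I, singleChance b (k i) ^ S.card := by
    refine (prob_stuck_le_prod b _ S Λ hΛ).trans (le_of_eq ?_)
    rw [Finset.prod_image hinj, Finset.prod_product]
    refine Finset.prod_congr rfl fun i hi => ?_
    rw [← Finset.prod_const]
    refine Finset.prod_congr rfl fun u hu => ?_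
    exact card_allowed_of_single b hu (hgood i hi u hu)
  have hK1 : (1 : ℝ) ≤ K ∨ n = 0 := by
    rcases Nat.eq_zero_or_pos n with h | h
    · exact Or.inr h
    · left
      have := hK ⟨0, h⟩
      exact_mod_cast (by omega : 1 ≤ K)
  -- In a good direction the factor `k i` meets the `S.card` independent lines of that direction,
  -- giving at most `ρ`. Each bad direction costs at most `K`.
  have hsplit : ∏ i, (k i : ℝ) = (∏ i ∈ bad, (k i : ℝ)) * ∏ i ∈ I, (k i : ℝ) :=
    (Finset.prod_mul_prod_compl bad fun i => (k i : ℝ)).symm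
  have hb : ∏ i ∈ bad, (k i : ℝ) ≤ (K : ℝ) ^ S.card ^ 2 := by
    calc ∏ i ∈ bad, (k i : ℝ) ≤ ∏ _i ∈ bad, (K : ℝ) :=
          Finset.prod_le_prod (fun i _ => by positivity) fun i _ => by exact_mod_cast (hK i).2
      _ = (K : ℝ) ^ bad.card := by simp
      _ ≤ (K : ℝ) ^ S.card ^ 2 := by
          rcases hK1 with h | h
          · exact pow_le_pow_right₀ h hbad
          · have h0 : S.card ^ 2 = 0 := by omega
            have h1 : bad.card = 0 := by omega
            rw [h0, h1]
  have hg : (∏ i ∈ I, (k i : ℝ)) * ∏ i ∈ I, singleChance b (k i) ^ S.card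
      ≤ ρ ^ (n - S.card ^ 2) := by
    rw [← Finset.prod_mul_distrib]
    calc ∏ i ∈ I, ((k i : ℝ) * singleChance b (k i) ^ S.card) ≤ ∏ _i ∈ I, ρ := by
          refine Finset.prod_le_prod (fun i _ => ?_) fun i _ => hρ i
          have := singleChance_nonneg b (m := k i) (by have := (hK i).1; omega)
          positivity
      _ = ρ ^ I.card := by simp
      _ ≤ ρ ^ (n - S.card ^ 2) := pow_le_pow_of_le_one hρ0.le hρ1 hI
  calc _ ≤ ((∏ i ∈ bad, (k i : ℝ)) * ∏ i ∈ I, (k i : ℝ))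
          * ∏ i ∈ I, singleChance b (k i) ^ S.card := by
        rw [hsplit]; gcongr
    _ = (∏ i ∈ bad, (k i : ℝ)) *
          ((∏ i ∈ I, (k i : ℝ)) * ∏ i ∈ I, singleChance b (k i) ^ S.card) := by ring
    _ ≤ K ^ S.card ^ 2 * ρ ^ (n - S.card ^ 2) := by
        refine mul_le_mul hb hg ?_ (by positivity)
        refine mul_nonneg (Finset.prod_nonneg fun i _ => by positivity)
          (Finset.prod_nonneg fun i _ => ?_)
        have := singleChance_nonneg b (m := k i) (by have := (hK i).1; omega)
        positivity

end UnionBounds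

/-! ### Routes through two reserved directions. -/

section Routes

variable {n : ℕ} {k : Fin n → ℕ}

/-- The last vertex of the walk which starts at `p` and changes coordinates as prescribed. -/
def endpoint (p : Vertex k) : List ((i : Fin n) × Fin (k i)) → Vertex k
  | [] => p
  | a :: l => endpoint (Function.update p a.1 a.2) l

/-- The lines used by the walk which starts at `p` and changes coordinates as prescribed. -/
def linesOf (p : Vertex k) : List ((i : Fin n) × Fin (k i)) → List (Line k)
  | [] => []
  | a :: l => lineThrough p a.1 :: linesOf (Function.update p a.1 a.2) l

/-- All steps of the walk which starts at `p` lead to the winners of their lines. -/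
def Follows (ω : Winners k) (p : Vertex k) : List ((i : Fin n) × Fin (k i)) → Prop
  | [] => True
  | a :: l => ω (lineThrough p a.1) = a.2 ∧ Follows ω (Function.update p a.1 a.2) l

theorem Follows.reachIn {ω : Winners k} {p : Vertex k} {l : List ((i : Fin n) × Fin (k i))}
    (h : Follows ω p l) : ReachIn Finset.univ ω p (endpoint p l) := by
  induction l generalizing p with
  | nil => exact ReachIn.refl p
  | cons a l ih =>
    refine ReachIn.trans ?_ (ih h.2)
    have h1 : lineWinner ω p a.1 = a.2 := h.1
    rw [← h1]
    exact reachIn_winner ω p (Finset.mem_univ _)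

theorem Follows.congr {ω ω' : Winners k} {p : Vertex k} {l : List ((i : Fin n) × Fin (k i))}
    (hω : ∀ ℓ ∈ linesOf p l, ω ℓ = ω' ℓ) (h : Follows ω p l) : Follows ω' p l := by
  induction l generalizing p with
  | nil => trivial
  | cons a l ih =>
    refine ⟨?_, ih (fun ℓ hℓ => hω ℓ (List.mem_cons_of_mem _ hℓ)) h.2⟩
    rw [← hω _ List.mem_cons_self]
    exact h.1

theorem endpoint_append (p : Vertex k) (l l' : List ((i : Fin n) × Fin (k i))) :
    endpoint p (l ++ l') = endpoint (endpoint p l) l' := by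
  induction l generalizing p with
  | nil => rfl
  | cons a l ih => exact ih _

theorem linesOf_append (p : Vertex k) (l l' : List ((i : Fin n) × Fin (k i))) :
    linesOf p (l ++ l') = linesOf p l ++ linesOf (endpoint p l) l' := by
  induction l generalizing p with
  | nil => rfl
  | cons a l ih =>
    simp only [List.cons_append, linesOf, endpoint]
    rw [ih]

theorem map_fst_linesOf (p : Vertex k) (l : List ((i : Fin n) × Fin (k i))) :
    (linesOf p l).map Sigma.fst = l.map Sigma.fst := by
  induction l generalizing p with
  | nil => rfl
  | cons a l ih =>
    simp only [linesOf, List.map_cons, ih]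
    rfl

theorem hammingDist_update_le (p : Vertex k) (i : Fin n) (c : Fin (k i)) :
    hammingDist p (Function.update p i c) ≤ 1 := by
  refine le_trans (Finset.card_le_card (t := {i}) fun j hj => ?_) (by simp)
  by_contra h
  have hji : j ≠ i := by simpa using h
  simp [hji] at hj

theorem mem_linesOf {p : Vertex k} {l : List ((i : Fin n) × Fin (k i))} {ℓ : Line k}
    (h : ℓ ∈ linesOf p l) : ∃ (w : Vertex k) (i : Fin n), ℓ = lineThrough w i ∧
      i ∈ l.map Sigma.fst ∧ (∀ j, j ∉ l.map Sigma.fst → w j = p j) ∧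
      hammingDist p w ≤ l.length := by
  induction l generalizing p with
  | nil => simp [linesOf] at h
  | cons a l ih =>
    rcases List.mem_cons.1 h with h | h
    · exact ⟨p, a.1, h, by simp, fun _ _ => rfl, by simp⟩
    · obtain ⟨w, i, h1, h2, h3, h4⟩ := ih h
      refine ⟨w, i, h1, List.mem_cons_of_mem _ h2, fun j hj => ?_, ?_⟩
      · have hj1 : j ≠ a.1 := fun h => hj (by simp [h])
        have hj2 : j ∉ l.map Sigma.fst := fun h => hj (List.mem_cons_of_mem _ h)
        rw [h3 j hj2, Function.update_of_ne hj1]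
      · have := hammingDist_triangle p (Function.update p a.1 a.2) w
        have := hammingDist_update_le p a.1 a.2
        simp only [List.length_cons]
        omega

theorem endpoint_map (p q : Vertex k) (L : List (Fin n)) (j : Fin n) :
    endpoint p (L.map fun i => ⟨i, q i⟩) j = if j ∈ L then q j else p j := by
  induction L generalizing p with
  | nil => simp [endpoint]
  | cons a L ih =>
    simp only [List.map_cons, endpoint]
    rw [ih]
    by_cases h : j ∈ L
    · simp [h]
    · by_cases hja : j = a
      · subst hja; simp [h]
      · simp [h, hja]

/-- A walk from `r` to `q` with distinct lines, which avoids the lines in directions other than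
`i₀`, `i₁` lying in the fibres of `r` and `q`. -/
theorem exists_route (hk : ∀ i, 2 ≤ k i) {i₀ i₁ : Fin n} (h01 : i₀ ≠ i₁) (r q : Vertex k) (d : ℕ)
    (hd : (Finset.univ.filter fun i => i ≠ i₀ ∧ i ≠ i₁ ∧ r i ≠ q i).card ≤ d) :
    ∃ l : List ((i : Fin n) × Fin (k i)), l.length ≤ d + 4 ∧ endpoint r l = q ∧
      (linesOf r l).Nodup ∧ ∀ w : Vertex k, ∀ i, lineThrough w i ∈ linesOf r l → i ≠ i₀ → i ≠ i₁ →
        ¬ (w i₀ = r i₀ ∧ w i₁ = r i₁) ∧ ¬ (w i₀ = q i₀ ∧ w i₁ = q i₁) := by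
  classical
  by_cases hrq : ∀ i, i ≠ i₀ → i ≠ i₁ → r i = q i
  -- This case is separate because the general route needs a coordinate where `r` and `q` differ to
  -- tell its first two lines from its last two.
  · refine ⟨[⟨i₀, q i₀⟩, ⟨i₁, q i₁⟩], by simp, ?_, ?_, ?_⟩
    · simp only [endpoint]
      funext j
      by_cases hj1 : j = i₁
      · subst hj1; simp
      · rw [Function.update_of_ne hj1]
        by_cases hj0 : j = i₀
        · subst hj0; simp
        · rw [Function.update_of_ne hj0, hrq j hj0 hj1]
    · simp only [linesOf, List.nodup_cons, List.mem_singleton, lineThrough_eq_iff]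
      simp [h01]
    · intro w i hw h0 h1
      exfalso
      have := List.mem_map_of_mem (f := Sigma.fst) hw
      rw [map_fst_linesOf] at this
      have h3 : (lineThrough w i).1 = i := rfl
      rw [h3] at this
      simp [h0, h1] at this
  · push Not at hrq
    obtain ⟨m, hm0, hm1, hm⟩ := hrq
    have hnt : ∀ i, Nontrivial (Fin (k i)) := fun i => Fin.nontrivial_iff_two_le.2 (hk i)
    -- Setting coordinate `i₀` to `a` leaves the fibre of `r`, and setting `i₁` to `b` stays off the
    -- fibre of `q`. All steps in other directions are made between these changes and the final
    -- ones.
    obtain ⟨a, ha⟩ := exists_ne (r i₀)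
    obtain ⟨b, hb⟩ := exists_ne (q i₁)
    let D := Finset.univ.filter fun i => i ≠ i₀ ∧ i ≠ i₁ ∧ r i ≠ q i
    have hD : ∀ i, i ∈ D.toList ↔ i ≠ i₀ ∧ i ≠ i₁ ∧ r i ≠ q i := by simp [D]
    let l₁ : List ((i : Fin n) × Fin (k i)) := [⟨i₀, a⟩, ⟨i₁, b⟩]
    let l₂ : List ((i : Fin n) × Fin (k i)) := D.toList.map fun i => ⟨i, q i⟩
    let l₃ : List ((i : Fin n) × Fin (k i)) := [⟨i₀, q i₀⟩, ⟨i₁, q i₁⟩]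
    have hf₁ : l₁.map Sigma.fst = [i₀, i₁] := rfl
    have hf₃ : l₃.map Sigma.fst = [i₀, i₁] := rfl
    have hf₂ : l₂.map Sigma.fst = D.toList := by
      simp only [l₂, List.map_map]
      exact List.map_id _
    set p₁ := endpoint r l₁ with hp₁
    set p₂ := endpoint p₁ l₂ with hp₂
    have hp₁0 : p₁ i₀ = a := by simp [hp₁, l₁, endpoint, h01]
    have hp₁1 : p₁ i₁ = b := by simp [hp₁, l₁, endpoint]
    have hp₁j : ∀ j, j ≠ i₀ → j ≠ i₁ → p₁ j = r j := fun j h0 h1 => by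
      simp [hp₁, l₁, endpoint, h0, h1]
    have hp₂j : ∀ j, j ≠ i₀ → j ≠ i₁ → p₂ j = q j := fun j h0 h1 => by
      rw [hp₂, endpoint_map, hp₁j j h0 h1]
      by_cases h : r j = q j
      · simp [h]
      · rw [if_pos ((hD j).2 ⟨h0, h1, h⟩)]
    have hdir₁ : ∀ w i, lineThrough w i ∈ linesOf r l₁ → i = i₀ ∨ i = i₁ := by
      intro w i hw
      have := List.mem_map_of_mem (f := Sigma.fst) hw
      rw [map_fst_linesOf, hf₁] at this
      have h3 : (lineThrough w i).1 = i := rfl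
      rw [h3] at this
      simpa using this
    have hdir₃ : ∀ w i, lineThrough w i ∈ linesOf p₂ l₃ → i = i₀ ∨ i = i₁ := by
      intro w i hw
      have := List.mem_map_of_mem (f := Sigma.fst) hw
      rw [map_fst_linesOf, hf₃] at this
      have h3 : (lineThrough w i).1 = i := rfl
      rw [h3] at this
      simpa using this
    have hdir₂ : ∀ w i, lineThrough w i ∈ linesOf p₁ l₂ → i ≠ i₀ ∧ i ≠ i₁ := by
      intro w i hw
      have := List.mem_map_of_mem (f := Sigma.fst) hw
      rw [map_fst_linesOf, hf₂] at this
      have h3 : (lineThrough w i).1 = i := rfl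
      rw [h3] at this
      have := (hD i).1 this
      exact ⟨this.1, this.2.1⟩
    have hl : linesOf r (l₁ ++ l₂ ++ l₃) = linesOf r l₁ ++ linesOf p₁ l₂ ++ linesOf p₂ l₃ := by
      rw [linesOf_append, linesOf_append, endpoint_append]
    refine ⟨l₁ ++ l₂ ++ l₃, ?_, ?_, ?_, ?_⟩
    · have : l₂.length = D.card := by simp [l₂]
      have h2 : D.card ≤ d := hd
      simp only [List.length_append, this, l₁, l₃, List.length_cons, List.length_nil]
      omega
    · rw [endpoint_append, endpoint_append]
      change endpoint p₂ l₃ = q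
      simp only [l₃, endpoint]
      funext j
      by_cases hj1 : j = i₁
      · subst hj1; simp
      · rw [Function.update_of_ne hj1]
        by_cases hj0 : j = i₀
        · subst hj0; simp
        · rw [Function.update_of_ne hj0, hp₂j j hj0 hj1]
    · have hnd : ∀ p l, (l.map Sigma.fst).Nodup →
          (linesOf (k := k) p l).Nodup := by
        intro p l h
        rw [← map_fst_linesOf p l] at h
        exact h.of_map _
      have h01' : [i₀, i₁].Nodup := by simp [h01]
      rw [hl, List.nodup_append', List.nodup_append']
      refine ⟨⟨hnd _ _ (by rw [hf₁]; exact h01'), hnd _ _ (by rw [hf₂]; exact D.nodup_toList), ?_⟩,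
        hnd _ _ (by rw [hf₃]; exact h01'), ?_⟩
      · intro ℓ h1 h2
        obtain ⟨w, i, rfl, -⟩ := mem_linesOf h1
        rcases hdir₁ w i h1 with h | h
        · exact (hdir₂ w i h2).1 h
        · exact (hdir₂ w i h2).2 h
      · intro ℓ h1 h3
        rcases List.mem_append.1 h1 with h1 | h2
        · obtain ⟨w, i, rfl, hi, hw, -⟩ := mem_linesOf h1
          obtain ⟨w', i', heq, -, hw', -⟩ := mem_linesOf h3
          rw [hf₁] at hw hi
          rw [hf₃] at hw'
          have hmi : m ≠ i := by
            rintro rfl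
            simp [hm0, hm1] at hi
          have h4 := (lineThrough_eq_iff.1 heq).2 m hmi
          rw [hw m (by simp [hm0, hm1]), hw' m (by simp [hm0, hm1]), hp₂j m hm0 hm1] at h4
          exact hm h4
        · obtain ⟨w, i, rfl, -⟩ := mem_linesOf h2
          rcases hdir₃ w i h3 with h | h
          · exact (hdir₂ w i h2).1 h
          · exact (hdir₂ w i h2).2 h
    · intro w i hw h0 h1
      rw [hl] at hw
      rcases List.mem_append.1 hw with hw | hw
      · rcases List.mem_append.1 hw with hw | hw
        · rcases hdir₁ w i hw with h | h
          · exact absurd h h0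
          · exact absurd h h1
        · obtain ⟨w', i', heq, -, hw', -⟩ := mem_linesOf hw
          rw [hf₂] at hw'
          have h4 := lineThrough_eq_iff.1 heq
          have h5 : w i₀ = a := by
            rw [h4.2 i₀ h0.symm, hw' i₀ (fun h => ((hD i₀).1 h).1 rfl), hp₁0]
          have h6 : w i₁ = b := by
            rw [h4.2 i₁ h1.symm, hw' i₁ (fun h => ((hD i₁).1 h).2.1 rfl), hp₁1]
          rw [h5, h6]
          exact ⟨fun h => ha h.1, fun h => hb h.2⟩
      · rcases hdir₃ w i hw with h | h
        · exact absurd h h0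
        · exact absurd h h1

end Routes

/-! ### Joining two explorations by independent attempts. -/

section Connecting

variable {n : ℕ} {k : Fin n → ℕ} [∀ i, NeZero (k i)]

/-- Each step concerns a line that neither `F` nor the earlier steps involve, so it succeeds with
conditional probability `1 / k i ≥ 1 / K`. -/
theorem le_prob_and_follows {K : ℕ} (hK : ∀ i, k i ≤ K) (p : Vertex k)
    (l : List ((i : Fin n) × Fin (k i))) (hl : (linesOf p l).Nodup) (F : Set (Winners k))
    (hF : ∀ ℓ ∈ linesOf p l, ∀ ω c, ω ∈ F → Function.update ω ℓ c ∈ F) :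
    (winnerLaw k).real F * (1 / K : ℝ) ^ l.length
      ≤ (winnerLaw k).real {ω | ω ∈ F ∧ Follows ω p l} := by
  induction l generalizing p F with
  | nil => simp [Follows]
  | cons a l ih =>
    obtain ⟨h1, h2⟩ := List.nodup_cons.1 hl
    have hF' := winnerLaw_real_inter_eq F (lineThrough p a.1) a.2 (hF _ List.mem_cons_self)
    have h3 := ih (Function.update p a.1 a.2) h2 {ω | ω ∈ F ∧ ω (lineThrough p a.1) = a.2} (by
      rintro ℓ hℓ ω c ⟨hω1, hω2⟩
      refine ⟨hF ℓ (List.mem_cons_of_mem _ hℓ) ω c hω1, ?_⟩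
      have hne : lineThrough p a.1 ≠ ℓ := fun h => h1 (by rw [h]; exact hℓ)
      exact (Function.update_of_ne hne c ω).trans hω2)
    rw [hF'] at h3
    have hk : (0 : ℝ) < k a.1 := by exact_mod_cast Nat.pos_of_ne_zero (NeZero.ne (k a.1))
    have hkK : (k a.1 : ℝ) ≤ K := by exact_mod_cast hK a.1
    have hset : {ω | ω ∈ F ∧ Follows ω p (a :: l)} = {ω | ω ∈ {ω | ω ∈ F ∧
        ω (lineThrough p a.1) = a.2} ∧ Follows ω (Function.update p a.1 a.2) l} := by
      ext ω; simp [Follows, and_assoc]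
    rw [hset]
    refine le_trans ?_ h3
    rw [List.length_cons, pow_succ', ← mul_assoc]
    have : (winnerLaw k).real F * (1 / K : ℝ) ≤ (winnerLaw k).real F / k a.1 := by
      rw [mul_one_div]
      gcongr
    exact mul_le_mul_of_nonneg_right this (by positivity)

/-- Add one route at a time: by disjointness, the failure of the earlier routes does not depend on
the lines of the new one. -/
theorem prob_and_forall_not_follows_le {K : ℕ} (hK : ∀ i, k i ≤ K) (hK1 : 1 ≤ K) (L : ℕ)
    (M : Finset (Vertex k)) (l : Vertex k → List ((i : Fin n) × Fin (k i)))
    (hlen : ∀ r ∈ M, (l r).length ≤ L) (hnd : ∀ r ∈ M, (linesOf r (l r)).Nodup)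
    (hdisj : ∀ r ∈ M, ∀ r' ∈ M, r ≠ r' → (linesOf r (l r)).Disjoint (linesOf r' (l r')))
    (F : Set (Winners k))
    (hF : ∀ r ∈ M, ∀ ℓ ∈ linesOf r (l r), ∀ ω c, ω ∈ F → Function.update ω ℓ c ∈ F) :
    (winnerLaw k).real {ω | ω ∈ F ∧ ∀ r ∈ M, ¬ Follows ω r (l r)}
      ≤ (winnerLaw k).real F * (1 - (1 / K : ℝ) ^ L) ^ M.card := by
  classical
  have hK1' : (1 : ℝ) ≤ K := by exact_mod_cast hK1
  have hKinv : (1 / K : ℝ) ≤ 1 := (div_le_one (by linarith)).2 hK1'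
  have hq0 : 0 ≤ 1 - (1 / K : ℝ) ^ L := by
    have := pow_le_one₀ (n := L) (by positivity) hKinv
    linarith
  induction M using Finset.induction_on with
  | empty => simp
  | insert r₀ M hr ih =>
    have ih' := ih (fun r hr => hlen r (Finset.mem_insert_of_mem hr))
      (fun r hr => hnd r (Finset.mem_insert_of_mem hr))
      (fun r hr r' hr' => hdisj r (Finset.mem_insert_of_mem hr) r' (Finset.mem_insert_of_mem hr'))
      (fun r hr => hF r (Finset.mem_insert_of_mem hr))
    set G : Set (Winners k) := {ω | ω ∈ F ∧ ∀ r ∈ M, ¬ Follows ω r (l r)} with hG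
    have hr₀ := Finset.mem_insert_self r₀ M
    have h1 := le_prob_and_follows hK r₀ (l r₀) (hnd r₀ hr₀) G (by
      rintro ℓ hℓ ω c ⟨hω1, hω2⟩
      refine ⟨hF r₀ hr₀ ℓ hℓ ω c hω1, fun r hrM hf => hω2 r hrM (hf.congr ?_)⟩
      intro ℓ' hℓ'
      have hne : r₀ ≠ r := fun h => hr (h ▸ hrM)
      have := hdisj r₀ hr₀ r (Finset.mem_insert_of_mem hrM) hne
      have hne' : ℓ' ≠ ℓ := fun h => this hℓ (by rw [← h]; exact hℓ')
      exact Function.update_of_ne hne' c ω)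
    have hlenr : (1 / K : ℝ) ^ L ≤ (1 / K : ℝ) ^ (l r₀).length :=
      pow_le_pow_of_le_one (by positivity) hKinv (hlen r₀ hr₀)
    have h2 : (winnerLaw k).real {ω | ω ∈ F ∧ ∀ r ∈ insert r₀ M, ¬ Follows ω r (l r)}
        + (winnerLaw k).real {ω | ω ∈ G ∧ Follows ω r₀ (l r₀)} = (winnerLaw k).real G := by
      rw [← measureReal_union]
      · congr 1
        ext ω
        simp only [hG, Finset.forall_mem_insert, Set.mem_union, Set.mem_ofPred_eq]
        tauto
      · rw [Set.disjoint_left]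
        rintro ω ⟨-, h⟩ ⟨-, h'⟩
        exact h r₀ hr₀ h'
      · exact (Set.toFinite _).measurableSet
    have hGnn : 0 ≤ (winnerLaw k).real G := measureReal_nonneg
    rw [Finset.card_insert_of_notMem hr, pow_succ]
    calc _ = (winnerLaw k).real G - (winnerLaw k).real {ω | ω ∈ G ∧ Follows ω r₀ (l r₀)} := by
          linarith
      _ ≤ (winnerLaw k).real G - (winnerLaw k).real G * (1 / K : ℝ) ^ L := by
          have := mul_le_mul_of_nonneg_left hlenr hGnn
          linarith
      _ = (winnerLaw k).real G * (1 - (1 / K : ℝ) ^ L) := by ring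
      _ ≤ ((winnerLaw k).real F * (1 - (1 / K : ℝ) ^ L) ^ M.card) * (1 - (1 / K : ℝ) ^ L) :=
          mul_le_mul_of_nonneg_right ih' hq0
      _ = _ := by ring

/-- A uniform bound on conditional probabilities given the winners on `Λ` bounds the probability. -/
theorem prob_le_of_forall_cylinder (Λ : Finset (Line k)) (E : Set (Winners k)) (q : ℝ)
    (h : ∀ η : Winners k, (winnerLaw k).real {ω | (∀ ℓ ∈ Λ, ω ℓ = η ℓ) ∧ ω ∈ E}
      ≤ (winnerLaw k).real {ω | ∀ ℓ ∈ Λ, ω ℓ = η ℓ} * q) :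
    (winnerLaw k).real E ≤ q := by
  classical
  let ext : ((ℓ : Λ) → Fin (k ℓ.1.1)) → Winners k := fun η ℓ =>
    if hℓ : ℓ ∈ Λ then η ⟨ℓ, hℓ⟩ else 0
  have hext : ∀ η : (ℓ : Λ) → Fin (k ℓ.1.1), ∀ ℓ (hℓ : ℓ ∈ Λ), ext η ℓ = η ⟨ℓ, hℓ⟩ :=
    fun η ℓ hℓ => dif_pos hℓ
  have hself : ∀ ω : Winners k, ∀ ℓ ∈ Λ, ω ℓ = ext (fun ℓ => ω ℓ) ℓ := fun ω ℓ hℓ =>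
    (hext (fun ℓ => ω ℓ) ℓ hℓ).symm
  have htotal : ∑ η, (winnerLaw k).real {ω | ∀ ℓ ∈ Λ, ω ℓ = ext η ℓ} = 1 := by
    rw [← measureReal_iUnion_fintype]
    · have : ⋃ η, {ω : Winners k | ∀ ℓ ∈ Λ, ω ℓ = ext η ℓ} = Set.univ := by
        refine Set.eq_univ_of_forall fun ω => Set.mem_iUnion.2 ⟨fun ℓ => ω ℓ, hself ω⟩
      rw [this, probReal_univ]
    · intro η η' hne
      refine Set.disjoint_left.2 fun ω h1 h2 => hne ?_
      funext ℓ
      rw [← hext η ℓ.1 ℓ.2, ← hext η' ℓ.1 ℓ.2, ← h1 ℓ ℓ.2, ← h2 ℓ ℓ.2]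
    · exact fun η => (Set.toFinite _).measurableSet
  calc (winnerLaw k).real E
      ≤ (winnerLaw k).real (⋃ η, {ω | (∀ ℓ ∈ Λ, ω ℓ = ext η ℓ) ∧ ω ∈ E}) :=
        measureReal_mono fun ω hω => Set.mem_iUnion.2 ⟨fun ℓ => ω ℓ, hself ω, hω⟩
    _ ≤ ∑ η, (winnerLaw k).real {ω | (∀ ℓ ∈ Λ, ω ℓ = ext η ℓ) ∧ ω ∈ E} :=
        measureReal_iUnion_fintype_le _
    _ ≤ ∑ η, (winnerLaw k).real {ω | ∀ ℓ ∈ Λ, ω ℓ = ext η ℓ} * q :=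
        Finset.sum_le_sum fun η _ => h (ext η)
    _ = q := by rw [← Finset.sum_mul, htotal, one_mul]

omit [∀ i, NeZero (k i)] in
theorem reachSet_congr {b : Bool} {s : Finset (Fin n)} {ω ω' : Winners k} {u : Vertex k}
    (h : ∀ w : Vertex k, (∀ j, j ∉ s → w j = u j) → ∀ i ∈ s,
      lineWinner ω w i = lineWinner ω' w i) : reachSet b s ω u = reachSet b s ω' u := by
  ext w
  cases b
  · rw [mem_reachSet_false, mem_reachSet_false]
    constructor
    · intro hw
      refine hw.congr fun x hx => h x fun j hj => ?_
      rw [hx j hj, ← hw.apply_eq hj]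
    · intro hw
      refine hw.congr fun x hx i hi => (h x (fun j hj => ?_) i hi).symm
      rw [hx j hj, ← hw.apply_eq hj]
  · rw [mem_reachSet_true, mem_reachSet_true]
    exact ⟨fun hw => hw.congr h, fun hw => hw.congr fun x hx i hi => (h x hx i hi).symm⟩

/-- The directions other than `i₀` and `i₁`. -/
def others (i₀ i₁ : Fin n) : Finset (Fin n) := Finset.univ.filter fun i => i ≠ i₀ ∧ i ≠ i₁

omit [∀ i, NeZero (k i)] in
theorem mem_others {i₀ i₁ i : Fin n} : i ∈ others i₀ i₁ ↔ i ≠ i₀ ∧ i ≠ i₁ := by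
  simp [others]

/-- If `u` reaches many vertices and `v` is reached from many vertices in directions other than
`i₀` and `i₁`, then `u` reaches `v` unless many independent attempts fail. -/
theorem prob_not_reachIn_le {K : ℕ} (hK : ∀ i, 2 ≤ k i ∧ k i ≤ K) {i₀ i₁ : Fin n} (h01 : i₀ ≠ i₁)
    (u v : Vertex k) (θ : ℝ) (J d : ℕ)
    (hpairs : ∀ R Q : Finset (Vertex k), (∀ r ∈ R, ∀ j, j ∉ others i₀ i₁ → r j = u j) →
      (∀ q ∈ Q, ∀ j, j ∉ others i₀ i₁ → q j = v j) → θ ≤ R.card → θ ≤ Q.card →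
      ∃ M ⊆ R, J ≤ M.card ∧
        (∀ r ∈ M, ∃ q ∈ Q, ((others i₀ i₁).filter fun i => r i ≠ q i).card ≤ d) ∧
        ∀ r ∈ M, ∀ r' ∈ M, r ≠ r' → 2 * (d + 4) + 1 < hammingDist r r') :
    (winnerLaw k).real {ω | θ ≤ (reachSet true (others i₀ i₁) ω u).card ∧
      θ ≤ (reachSet false (others i₀ i₁) ω v).card ∧ ¬ ReachIn Finset.univ ω u v}
      ≤ (1 - (1 / K : ℝ) ^ (d + 4)) ^ J := by
  classical
  set B := others i₀ i₁ with hB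
  have hK1 : 1 ≤ K := by have := hK i₀; omega
  have hK1' : (1 : ℝ) ≤ K := by exact_mod_cast hK1
  have hKinv : (1 / K : ℝ) ≤ 1 := (div_le_one (by linarith)).2 hK1'
  have hpow : (1 / K : ℝ) ^ (d + 4) ≤ 1 := pow_le_one₀ (by positivity) hKinv
  have hpow0 : 0 < (1 / K : ℝ) ^ (d + 4) := by positivity
  -- The winners on `Λ` determine both explorations. Given them, `R` and `Q` are fixed and every
  -- line off `Λ` is still fresh.
  let Λ : Finset (Line k) := Finset.univ.filter fun ℓ => ∃ w : Vertex k, ∃ i ∈ B,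
    ℓ = lineThrough w i ∧ ((∀ j, j ∉ B → w j = u j) ∨ (∀ j, j ∉ B → w j = v j))
  have hΛ : ∀ {ℓ}, ℓ ∈ Λ ↔ ∃ w : Vertex k, ∃ i ∈ B,
    ℓ = lineThrough w i ∧ ((∀ j, j ∉ B → w j = u j) ∨ (∀ j, j ∉ B → w j = v j)) := fun {ℓ} => by
      simp [Λ]
  refine prob_le_of_forall_cylinder Λ _ _ fun η => ?_
  set R := reachSet true B η u with hR
  set Q := reachSet false B η v with hQ
  have hR' : ∀ ω : Winners k, (∀ ℓ ∈ Λ, ω ℓ = η ℓ) → reachSet true B ω u = R := fun ω hω =>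
    reachSet_congr fun w hw i hi => hω _ (hΛ.2 ⟨w, i, hi, rfl, Or.inl hw⟩)
  have hQ' : ∀ ω : Winners k, (∀ ℓ ∈ Λ, ω ℓ = η ℓ) → reachSet false B ω v = Q := fun ω hω =>
    reachSet_congr fun w hw i hi => hω _ (hΛ.2 ⟨w, i, hi, rfl, Or.inr hw⟩)
  have hq0 : 0 ≤ 1 - (1 / K : ℝ) ^ (d + 4) := by linarith
  by_cases hbig : θ ≤ R.card ∧ θ ≤ Q.card
  swap
  · have : {ω : Winners k | (∀ ℓ ∈ Λ, ω ℓ = η ℓ) ∧ ω ∈ {ω | θ ≤ (reachSet true B ω u).card ∧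
      θ ≤ (reachSet false B ω v).card ∧ ¬ ReachIn Finset.univ ω u v}} = ∅ := by
      rw [Set.eq_empty_iff_forall_notMem]
      rintro ω ⟨h1, h2, h3, -⟩
      rw [hR' ω h1] at h2
      rw [hQ' ω h1] at h3
      exact hbig ⟨h2, h3⟩
    rw [this, measureReal_empty]
    exact mul_nonneg measureReal_nonneg (pow_nonneg hq0 _)
  have hRu : ∀ r ∈ R, ∀ j, j ∉ B → r j = u j := fun r hr j hj => reachSet_apply_eq hr hj
  have hQv : ∀ q ∈ Q, ∀ j, j ∉ B → q j = v j := fun q hq j hj => reachSet_apply_eq hq hj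
  obtain ⟨M, hMR, hMJ, hMQ, hsep⟩ := hpairs R Q hRu hQv hbig.1 hbig.2
  have hroute : ∀ r ∈ M, ∃ l : List ((i : Fin n) × Fin (k i)), l.length ≤ d + 4 ∧
      endpoint r l ∈ Q ∧ (linesOf r l).Nodup ∧ ∀ ℓ ∈ linesOf r l, ℓ ∉ Λ := by
    intro r hr
    obtain ⟨q, hq, hd⟩ := hMQ r hr
    obtain ⟨l, h1, h2, h3, h4⟩ := exists_route (fun i => (hK i).1) h01 r q d (by
      refine le_trans (le_of_eq (congrArg Finset.card ?_)) hd
      ext i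
      simp [hB, mem_others, and_assoc])
    refine ⟨l, h1, h2 ▸ hq, h3, fun ℓ hℓ hℓΛ => ?_⟩
    obtain ⟨w, i, hi, rfl, hw⟩ := hΛ.1 hℓΛ
    rw [hB, mem_others] at hi
    have h5 := h4 w i hℓ hi.1 hi.2
    have h0B : i₀ ∉ B := by simp [hB, mem_others]
    have h1B : i₁ ∉ B := by simp [hB, mem_others]
    rcases hw with hw | hw
    · refine h5.1 ⟨?_, ?_⟩
      · rw [hw i₀ h0B, hRu r (hMR hr) i₀ h0B]
      · rw [hw i₁ h1B, hRu r (hMR hr) i₁ h1B]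
    · refine h5.2 ⟨?_, ?_⟩
      · rw [hw i₀ h0B, hQv q hq i₀ h0B]
      · rw [hw i₁ h1B, hQv q hq i₁ h1B]
  choose! l hl1 hl2 hl3 hl4 using hroute
  -- A route stays within `d + 4` of its start, and points giving the same line differ in at most
  -- one coordinate. Separation beyond `2 * (d + 4) + 1` therefore excludes a shared line.
  have hdisj : ∀ r ∈ M, ∀ r' ∈ M, r ≠ r' →
      (linesOf r (l r)).Disjoint (linesOf r' (l r')) := by
    intro r hr r' hr' hne ℓ h1 h2
    obtain ⟨w, i, rfl, -, -, hw⟩ := mem_linesOf h1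
    obtain ⟨w', i', heq, -, -, hw'⟩ := mem_linesOf h2
    have h3 := lineThrough_eq_iff.1 heq
    have h4 : hammingDist w w' ≤ 1 := by
      have : Function.update w i (w' i) = w' := by
        rw [Function.update_eq_iff]
        exact ⟨rfl, h3.2⟩
      rw [← this]
      exact hammingDist_update_le w i (w' i)
    have h5 := hsep r hr r' hr' hne
    have h6 := hammingDist_triangle r w r'
    have h7 := hammingDist_triangle w w' r'
    rw [hammingDist_comm w' r'] at h7
    have h8 := hl1 r hr
    have h9 := hl1 r' hr'
    omega
  have key := prob_and_forall_not_follows_le (fun i => (hK i).2) hK1 (d + 4) M l hl1 hl3 hdisj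
    {ω | ∀ ℓ ∈ Λ, ω ℓ = η ℓ} (by
      intro r hr ℓ hℓ ω c hω ℓ' hℓ'
      have hne : ℓ' ≠ ℓ := fun h => hl4 r hr ℓ hℓ (h ▸ hℓ')
      rw [Function.update_of_ne hne]
      exact hω ℓ' hℓ')
  calc _ ≤ (winnerLaw k).real {ω | ω ∈ {ω : Winners k | ∀ ℓ ∈ Λ, ω ℓ = η ℓ} ∧
          ∀ r ∈ M, ¬ Follows ω r (l r)} := by
        refine measureReal_mono ?_
        rintro ω ⟨h1, -, -, h4⟩
        refine ⟨h1, fun r hr hf => h4 ?_⟩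
        have h5 : r ∈ reachSet true B ω u := by rw [hR' ω h1]; exact hMR hr
        have h6 : endpoint r (l r) ∈ reachSet false B ω v := by rw [hQ' ω h1]; exact hl2 r hr
        rw [mem_reachSet_true] at h5
        rw [mem_reachSet_false] at h6
        exact ((h5.mono (Finset.subset_univ _)).trans hf.reachIn).trans
          (h6.mono (Finset.subset_univ _))
    _ ≤ (winnerLaw k).real {ω : Winners k | ∀ ℓ ∈ Λ, ω ℓ = η ℓ} *
          (1 - (1 / K : ℝ) ^ (d + 4)) ^ M.card := key
    _ ≤ _ := by
        refine mul_le_mul_of_nonneg_left ?_ measureReal_nonneg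
        exact pow_le_pow_of_le_one hq0 (by linarith) hMJ

end Connecting

/-! ### The threshold, and stuck sets for large dimension. -/

section Asymptotics

open Filter

theorem neZero_of_two_le {n : ℕ} {k : Fin n → ℕ} {K : ℕ} (hk : ∀ i, 2 ≤ k i ∧ k i ≤ K) :
    ∀ i, NeZero (k i) :=
  fun i => ⟨by have := (hk i).1; omega⟩

theorem prod_le_pow {n : ℕ} {k : Fin n → ℕ} {K : ℕ} (hk : ∀ i, 2 ≤ k i ∧ k i ≤ K) :
    ∏ i, (k i : ℝ) ≤ (K : ℝ) ^ n := by
  calc ∏ i, (k i : ℝ) ≤ ∏ _i : Fin n, (K : ℝ) :=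
        Finset.prod_le_prod (fun i _ => by positivity) fun i _ => by exact_mod_cast (hk i).2
    _ = (K : ℝ) ^ n := by simp

theorem eventually_mul_pow_mul_pow_le (C : ℝ) (a : ℕ) {r : ℝ} (hr0 : 0 ≤ r) (hr1 : r < 1) :
    ∀ᶠ n : ℕ in atTop, C * (n : ℝ) ^ a * r ^ n ≤ 1 := by
  have h := (tendsto_pow_const_mul_const_pow_of_abs_lt_one a
    (by rwa [abs_of_nonneg hr0] : |r| < 1)).const_mul C
  rw [mul_zero] at h
  filter_upwards [h.eventually_le_const (show (0 : ℝ) < 1 by norm_num)] with n hn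
  rw [mul_assoc]
  exact hn

/-- The threshold of the main theorem. -/
noncomputable def threshold (K : ℕ) : ℝ := Real.log K / (Real.log K - Real.log ((K : ℝ) - 1))

theorem log_sub_log_pos {K : ℕ} (hK : 2 ≤ K) : 0 < Real.log K - Real.log ((K : ℝ) - 1) := by
  have h2 : (2 : ℝ) ≤ K := by exact_mod_cast hK
  have := Real.log_lt_log (by linarith : (0 : ℝ) < K - 1) (by linarith : (K : ℝ) - 1 < K)
  linarith

/-- Equality at `K = 2`. For `K ≥ 3`, `log (K / (K - 1)) ≤ 1 / (K - 1)` and `log K ≥ 1`. This makes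
the bound `K - 1` of the deterministic construction sufficient. -/
theorem sub_one_le_threshold {K : ℕ} (hK : 2 ≤ K) : (K : ℝ) - 1 ≤ threshold K := by
  rw [threshold, le_div_iff₀ (log_sub_log_pos hK)]
  rcases hK.eq_or_lt with rfl | h3
  · norm_num
  · have h3' : (3 : ℝ) ≤ K := by exact_mod_cast h3
    have h1 : Real.log K - Real.log ((K : ℝ) - 1) ≤ 1 / ((K : ℝ) - 1) := by
      rw [← Real.log_div (by linarith) (by linarith)]
      refine (Real.log_le_sub_one_of_pos (by apply div_pos <;> linarith)).trans (le_of_eq ?_)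
      have : (K : ℝ) - 1 ≠ 0 := by linarith
      field_simp
      ring
    have h4 : 1 ≤ Real.log K := by
      rw [Real.le_log_iff_exp_le (by linarith)]
      linarith [Real.exp_one_lt_d9]
    calc ((K : ℝ) - 1) * (Real.log K - Real.log ((K : ℝ) - 1))
        ≤ ((K : ℝ) - 1) * (1 / ((K : ℝ) - 1)) :=
          mul_le_mul_of_nonneg_left h1 (by linarith)
      _ = 1 := by
          have : (K : ℝ) - 1 ≠ 0 := by linarith
          field_simp
      _ ≤ Real.log K := h4

/-- The sizes of sets which, with high probability, do not occur as sizes of stuck sets. -/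
def Excluded (K : ℕ) (b : Bool) (m : ℕ) : Prop :=
  if b then 2 ≤ m else threshold K < m

/-- Both `a` and `1 - 1 / a` increase with `a`, so the worst case is `a = K`, and the threshold is
the exponent at which `K * (1 - 1 / K) ^ m` equals `1`. -/
theorem mul_singleChance_pow_lt_one {K : ℕ} (hK : 2 ≤ K) {m : ℕ} (hm : threshold K < m) {a : ℕ}
    (ha2 : 2 ≤ a) (haK : a ≤ K) : a * (1 - 1 / a : ℝ) ^ m < 1 := by
  have ha : (2 : ℝ) ≤ a := by exact_mod_cast ha2
  have haK' : (a : ℝ) ≤ K := by exact_mod_cast haK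
  have h0 : 0 < 1 - 1 / (a : ℝ) := by
    have : 1 / (a : ℝ) ≤ 1 / 2 := by gcongr
    linarith
  rw [← Real.log_neg_iff (by positivity), Real.log_mul (by positivity) (by positivity),
    Real.log_pow]
  have h1 : Real.log (1 - 1 / (a : ℝ)) ≤ Real.log (1 - 1 / (K : ℝ)) := by
    refine Real.log_le_log h0 ?_
    gcongr
  have h2 : Real.log (1 - 1 / (K : ℝ)) = -(Real.log K - Real.log ((K : ℝ) - 1)) := by
    have : (1 - 1 / (K : ℝ)) = (K - 1) / K := by field_simp
    rw [this, Real.log_div (by linarith) (by linarith)]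
    ring
  have h3 : Real.log K < m * (Real.log K - Real.log ((K : ℝ) - 1)) := by
    rwa [threshold, div_lt_iff₀ (log_sub_log_pos hK)] at hm
  have h4 : Real.log a ≤ Real.log K := Real.log_le_log (by linarith) haK'
  have h5 : (m : ℝ) * Real.log (1 - 1 / (a : ℝ)) ≤ m * Real.log (1 - 1 / (K : ℝ)) :=
    mul_le_mul_of_nonneg_left h1 (Nat.cast_nonneg _)
  rw [h2] at h5
  linarith

/-- Uniformity over infinitely many sizes: the expression decreases in `m`, so only the smallest
excluded size counts, `⌊threshold K⌋₊ + 1` backward and `2` forward, with finitely many `a`. -/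
theorem exists_ratio {K : ℕ} (hK : 2 ≤ K) (b : Bool) :
    ∃ ρ : ℝ, 0 < ρ ∧ ρ < 1 ∧ ∀ m, Excluded K b m → ∀ a : ℕ, 2 ≤ a → a ≤ K →
      a * singleChance b a ^ m ≤ ρ := by
  cases b
  · obtain ⟨a₀, ha₀, hmax⟩ := Finset.exists_max_image (Finset.Icc 2 K)
      (fun a : ℕ => (a : ℝ) * (1 - 1 / a : ℝ) ^ (⌊threshold K⌋₊ + 1))
      ⟨2, Finset.mem_Icc.2 ⟨le_rfl, hK⟩⟩
    obtain ⟨h1, h2⟩ := Finset.mem_Icc.1 ha₀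
    have hpos : ∀ a : ℕ, 2 ≤ a → 0 < 1 - 1 / (a : ℝ) := by
      intro a ha
      have ha' : (2 : ℝ) ≤ a := by exact_mod_cast ha
      have : 1 / (a : ℝ) ≤ 1 / 2 := by gcongr
      linarith
    have := hpos a₀ h1
    refine ⟨(a₀ : ℝ) * (1 - 1 / a₀ : ℝ) ^ (⌊threshold K⌋₊ + 1), by positivity, ?_, ?_⟩
    · refine mul_singleChance_pow_lt_one hK ?_ h1 h2
      push_cast
      exact Nat.lt_floor_add_one _
    · intro m hm a ha2 haK
      have hm' : threshold K < m := by simpa [Excluded] using hm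
      refine le_trans ?_ (hmax a (Finset.mem_Icc.2 ⟨ha2, haK⟩))
      simp only [singleChance, Bool.false_eq_true, if_false]
      refine mul_le_mul_of_nonneg_left ?_ (Nat.cast_nonneg _)
      refine pow_le_pow_of_le_one (hpos a ha2).le ?_ ?_
      · have : 0 ≤ 1 / (a : ℝ) := by positivity
        linarith
      · have hm0 : m ≠ 0 := by
          rintro rfl
          have h2 : (2 : ℝ) ≤ K := by exact_mod_cast hK
          have := sub_one_le_threshold hK
          norm_num at hm'
          linarith
        exact (Nat.floor_lt' hm0).2 hm'
  · refine ⟨1 / 2, by norm_num, by norm_num, fun m hm a ha2 _ => ?_⟩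
    have hm' : 2 ≤ m := by simpa [Excluded] using hm
    have ha' : (2 : ℝ) ≤ a := by exact_mod_cast ha2
    simp only [singleChance, if_true]
    have h1 : (1 / (a : ℝ)) ≤ 1 / 2 := by gcongr
    calc (a : ℝ) * (1 / a) ^ m ≤ a * (1 / a) ^ 2 := by
          refine mul_le_mul_of_nonneg_left ?_ (by linarith)
          exact pow_le_pow_of_le_one (by positivity) (by linarith) hm'
      _ = 1 / a := by field_simp
      _ ≤ 1 / 2 := h1

/-- With high probability no small connected set of excluded size is stuck. -/
theorem eventually_prob_small_stuck_le {K : ℕ} (hK : 2 ≤ K) (b : Bool) (s₁ : ℕ) :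
    ∃ c : ℝ, 0 < c ∧ ∀ᶠ n : ℕ in atTop, ∀ k : Fin n → ℕ, (∀ i, 2 ≤ k i ∧ k i ≤ K) →
      (winnerLaw k).real {ω | ∃ v S, Spans v S ∧ Excluded K b S.card ∧ S.card ≤ s₁ ∧
        Stuck b Finset.univ S ω} ≤ Real.exp (-(c * n)) := by
  obtain ⟨ρ, hρ0, hρ1, hρ⟩ := exists_ratio hK b
  have hK' : (2 : ℝ) ≤ K := by exact_mod_cast hK
  have hr0 : 0 < √ρ := Real.sqrt_pos.2 hρ0
  have hr1 : √ρ < 1 := by rw [Real.sqrt_lt' one_pos]; simpa using hρ1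
  -- One factor `√ρ ^ n` of `ρ ^ n` absorbs the polynomial and constant factors, the other is the
  -- bound.
  refine ⟨-Real.log √ρ, by linarith [Real.log_neg hr0 hr1], ?_⟩
  filter_upwards [eventually_ge_atTop (s₁ ^ 2), eventually_ge_atTop 1,
    eventually_mul_pow_mul_pow_le ((s₁ + 1) * K ^ (2 * s₁) * (K / ρ) ^ s₁ ^ 2) (2 * s₁) hr0.le hr1]
    with n hn hn1 hlim k hk
  have := neZero_of_two_le hk
  have hn1' : (1 : ℝ) ≤ n := by exact_mod_cast hn1
  have hnK : (1 : ℝ) ≤ n * K := by nlinarith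
  have hterm : ∀ m ∈ Finset.range (s₁ + 1), Excluded K b m →
      (winnerLaw k).real {ω | ∃ v S, Spans v S ∧ S.card = m ∧ ω ∈ {ω | Stuck b Finset.univ S ω}}
      ≤ (n * K : ℝ) ^ (2 * s₁) * ((K / ρ) ^ s₁ ^ 2 * ρ ^ n) := by
    intro m hm hex
    have hms : m ≤ s₁ := Nat.lt_succ_iff.1 (Finset.mem_range.1 hm)
    have hm2 : m ^ 2 ≤ s₁ ^ 2 := Nat.pow_le_pow_left hms 2
    have hNpos : (0 : ℝ) < ∏ i, (k i : ℝ) := Finset.prod_pos fun i _ => by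
      exact_mod_cast (by have := (hk i).1; omega : 0 < k i)
    have hsmall : ∀ v S, Spans v S → S.card = m →
        (winnerLaw k).real {ω | Stuck b Finset.univ S ω}
          ≤ (K / ρ) ^ s₁ ^ 2 * ρ ^ n / ∏ i, (k i : ℝ) := by
      intro v S _ hS
      rw [le_div_iff₀ hNpos, mul_comm]
      refine (prob_stuck_small_le hk b S hρ0 hρ1.le
        (fun i => hρ _ (by rw [hS]; exact hex) _ (hk i).1 (hk i).2)
        (by rw [hS]; omega)).trans ?_
      rw [hS]
      calc (K : ℝ) ^ m ^ 2 * ρ ^ (n - m ^ 2)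
          ≤ (K : ℝ) ^ s₁ ^ 2 * ρ ^ (n - s₁ ^ 2) := by
            refine mul_le_mul (pow_le_pow_right₀ (by linarith) hm2)
              (pow_le_pow_of_le_one hρ0.le hρ1.le (by omega)) (by positivity) (by positivity)
        _ = (K / ρ) ^ s₁ ^ 2 * ρ ^ n := by
            rw [div_pow, pow_sub₀ _ hρ0.ne' hn]
            field_simp
    refine (prob_exists_spans_le (fun i => (hk i).2) m (fun S => {ω | Stuck b Finset.univ S ω}) _
      (by positivity) hsmall).trans ?_
    rw [mul_div_cancel₀ _ hNpos.ne']
    refine mul_le_mul_of_nonneg_right (pow_le_pow_right₀ hnK (by omega)) (by positivity)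
  classical
  have hbound : (0 : ℝ) ≤ (n * K : ℝ) ^ (2 * s₁) * ((K / ρ) ^ s₁ ^ 2 * ρ ^ n) := by positivity
  calc _ ≤ (winnerLaw k).real (⋃ m ∈ (Finset.range (s₁ + 1)).filter (Excluded K b),
          {ω | ∃ v S, Spans v S ∧ S.card = m ∧ ω ∈ {ω | Stuck b Finset.univ S ω}}) := by
        refine measureReal_mono ?_ (measure_ne_top _ _)
        rintro ω ⟨v, S, h1, h2, h3, h4⟩
        exact Set.mem_biUnion (x := S.card) (by simpa using ⟨by omega, h2⟩) ⟨v, S, h1, rfl, h4⟩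
    _ ≤ ∑ m ∈ (Finset.range (s₁ + 1)).filter (Excluded K b), _ :=
        measureReal_biUnion_finset_le _ _
    _ ≤ ∑ m ∈ (Finset.range (s₁ + 1)).filter (Excluded K b),
          (n * K : ℝ) ^ (2 * s₁) * ((K / ρ) ^ s₁ ^ 2 * ρ ^ n) :=
        Finset.sum_le_sum fun m hm => hterm m (Finset.mem_filter.1 hm).1 (Finset.mem_filter.1 hm).2
    _ ≤ ∑ m ∈ Finset.range (s₁ + 1), (n * K : ℝ) ^ (2 * s₁) * ((K / ρ) ^ s₁ ^ 2 * ρ ^ n) :=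
        Finset.sum_le_sum_of_subset_of_nonneg (Finset.filter_subset _ _) fun _ _ _ => hbound
    _ = ((s₁ + 1) * K ^ (2 * s₁) * (K / ρ) ^ s₁ ^ 2 * (n : ℝ) ^ (2 * s₁) * √ρ ^ n) * √ρ ^ n := by
        have : ρ ^ n = √ρ ^ n * √ρ ^ n := by rw [← mul_pow, Real.mul_self_sqrt hρ0.le]
        rw [this, mul_pow, Finset.sum_const, Finset.card_range, nsmul_eq_mul]
        push_cast
        ring
    _ ≤ 1 * √ρ ^ n := by gcongr
    _ = Real.exp (-(-Real.log √ρ * n)) := by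
        rw [one_mul, neg_mul, neg_neg, mul_comm, Real.exp_nat_mul, Real.exp_log hr0]

/-- With high probability no large connected set with small sections is stuck in the directions
other than `i₀` and `i₁`. -/
theorem eventually_prob_large_stuck_le {K : ℕ} (hK : 2 ≤ K) {ε : ℝ} (hε : 0 < ε) :
    ∃ s₀ : ℕ, ∀ s₁ ≥ s₀, ∀ᶠ n : ℕ in atTop, ∀ k : Fin n → ℕ, (∀ i, 2 ≤ k i ∧ k i ≤ K) →
      ∀ b : Bool, ∀ B : Finset (Fin n),
      (winnerLaw k).real {ω | ∃ v S, Spans v S ∧ s₁ ≤ S.card ∧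
        (∀ x : Vertex k, ((S.filter fun u => ∀ j, j ∉ B → u j = x j).card : ℝ)
          ≤ (∏ i ∈ B, (k i : ℝ)) * Real.exp (-(ε * n))) ∧
        Stuck b B S ω} ≤ Real.exp (-n) := by
  have hK' : (2 : ℝ) ≤ K := by exact_mod_cast hK
  have hlogK : 0 < Real.log K := Real.log_pos (by linarith)
  have hq0 : 0 < 1 - 1 / (K : ℝ) := by
    have : 1 / (K : ℝ) ≤ 1 / 2 := by gcongr
    linarith
  have hq1 : 1 - 1 / (K : ℝ) < 1 := by
    have : 0 < 1 / (K : ℝ) := by positivity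
    linarith
  have hlogq : 0 < -Real.log (1 - 1 / (K : ℝ)) := by linarith [Real.log_neg hq0 hq1]
  -- By isoperimetry a set of `m` vertices with small sections is stuck with probability at most
  -- `exp (-(κ * n * m))`. Half of this exponent kills `(n * K) ^ (2 * m)`. The other half must beat
  -- `K ^ n` starting points and `K ^ n` sizes, whence the choice of `s₀`.
  set κ : ℝ := ε * -Real.log (1 - 1 / (K : ℝ)) / (K * Real.log K) with hκ
  have hκ0 : 0 < κ := by positivity
  refine ⟨⌈(2 * Real.log K + 1) * 2 / κ⌉₊ + 1, fun s₁ hs₁ => ?_⟩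
  have hs₁' : (2 * Real.log K + 1) * 2 / κ ≤ s₁ :=
    (Nat.le_ceil _).trans (by exact_mod_cast (by omega : ⌈(2 * Real.log K + 1) * 2 / κ⌉₊ ≤ s₁))
  have hs₁1 : 1 ≤ s₁ := by omega
  rw [div_le_iff₀ hκ0] at hs₁'
  have hexp1 : Real.exp (-(κ / 2)) < 1 := by rw [Real.exp_lt_one_iff]; linarith
  filter_upwards [eventually_ge_atTop 1,
    eventually_mul_pow_mul_pow_le (K ^ 2) 2 (Real.exp_pos (-(κ / 2))).le hexp1]
    with n hn1 hlim k hk b B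
  have := neZero_of_two_le hk
  have hn1' : (1 : ℝ) ≤ n := by exact_mod_cast hn1
  have hnK : (1 : ℝ) ≤ n * K := by nlinarith
  have hlim' : (n * K : ℝ) ^ 2 * Real.exp (-(κ / 2 * n)) ≤ 1 := by
    rw [← Real.exp_nat_mul] at hlim
    refine le_trans (le_of_eq ?_) hlim
    rw [show -(κ / 2 * n) = n * -(κ / 2) by ring]
    ring
  set NB : ℝ := ∏ i ∈ B, (k i : ℝ) with hNB
  have hkpos : ∀ i, (0 : ℝ) < k i := fun i => by
    exact_mod_cast (by have := (hk i).1; omega : 0 < k i)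
  have hNBpos : 0 < NB := Finset.prod_pos fun i _ => hkpos i
  have hterm : ∀ m, s₁ ≤ m →
      (winnerLaw k).real {ω | ∃ v S, Spans v S ∧ S.card = m ∧ ω ∈ {ω |
        (∀ x : Vertex k, ((S.filter fun u => ∀ j, j ∉ B → u j = x j).card : ℝ)
          ≤ NB * Real.exp (-(ε * n))) ∧ Stuck b B S ω}}
      ≤ (K : ℝ) ^ n * Real.exp (-(κ / 2 * n)) ^ s₁ := by
    intro m hm
    have h1 : ∀ v S, Spans v S → S.card = m →
        (winnerLaw k).real {ω | (∀ x : Vertex k,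
          ((S.filter fun u => ∀ j, j ∉ B → u j = x j).card : ℝ)
          ≤ NB * Real.exp (-(ε * n))) ∧ Stuck b B S ω} ≤ Real.exp (-(κ * n)) ^ m := by
      intro v S _ hS
      by_cases hsec : ∀ x : Vertex k, ((S.filter fun u => ∀ j, j ∉ B → u j = x j).card : ℝ)
          ≤ NB * Real.exp (-(ε * n))
      swap
      · have : {ω : Winners k | (∀ x : Vertex k,
            ((S.filter fun u => ∀ j, j ∉ B → u j = x j).card : ℝ)
            ≤ NB * Real.exp (-(ε * n))) ∧ Stuck b B S ω} = ∅ := by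
          rw [Set.eq_empty_iff_forall_notMem]
          exact fun ω h => hsec h.1
        rw [this, measureReal_empty]
        positivity
      have h2 := card_boundaryLines_ge (fun i => (hk i).2) B S _ hsec
      rw [Real.log_mul hNBpos.ne' (Real.exp_ne_zero _), Real.log_exp, hNB,
        Real.log_prod (fun i _ => (hkpos i).ne'), hS] at h2
      refine (measureReal_mono fun ω hω => hω.2).trans
        ((prob_stuck_le (fun i => (hk i).2) b B S).trans ?_)
      rw [← Real.exp_nat_mul, ← Real.exp_log (pow_pos hq0 _), Real.log_pow]
      refine Real.exp_le_exp.2 ?_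
      have h3 : (m : ℝ) * (ε * n) / (K * Real.log K) ≤ (boundaryLines B S).card := by
        rw [div_le_iff₀ (by positivity)]
        linarith
      have h4 := mul_le_mul_of_nonneg_right h3 hlogq.le
      have h5 : (m : ℝ) * (ε * n) / (K * Real.log K) * -Real.log (1 - 1 / (K : ℝ))
          = m * (κ * n) := by
        rw [hκ]; ring
      rw [h5] at h4
      linarith
    refine (prob_exists_spans_le (fun i => (hk i).2) m (fun S => {ω |
        (∀ x : Vertex k, ((S.filter fun u => ∀ j, j ∉ B → u j = x j).card : ℝ)
          ≤ NB * Real.exp (-(ε * n))) ∧ Stuck b B S ω}) _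
      (by positivity) h1).trans ?_
    have h2 : Real.exp (-(κ * n)) ^ m = Real.exp (-(κ / 2 * n)) ^ m * Real.exp (-(κ / 2 * n)) ^ m := by
      rw [← mul_pow, ← Real.exp_add]
      congr 2
      ring
    calc (n * K : ℝ) ^ (2 * (m - 1)) * ((∏ i, (k i : ℝ)) * Real.exp (-(κ * n)) ^ m)
        ≤ (n * K : ℝ) ^ (2 * m) * ((K : ℝ) ^ n * Real.exp (-(κ * n)) ^ m) := by
          refine mul_le_mul (pow_le_pow_right₀ hnK (by omega)) ?_
            (mul_nonneg (Finset.prod_nonneg fun i _ => (hkpos i).le) (by positivity)) (by positivity)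
          exact mul_le_mul_of_nonneg_right (prod_le_pow hk) (by positivity)
      _ = (K : ℝ) ^ n * (((n * K : ℝ) ^ 2 * Real.exp (-(κ / 2 * n))) ^ m
            * Real.exp (-(κ / 2 * n)) ^ m) := by
          rw [h2, pow_mul, mul_pow _ (Real.exp (-(κ / 2 * n))) m]; ring
      _ ≤ (K : ℝ) ^ n * (1 * Real.exp (-(κ / 2 * n)) ^ s₁) := by
          refine mul_le_mul_of_nonneg_left ?_ (by positivity)
          refine mul_le_mul (pow_le_one₀ (by positivity) hlim') ?_ (by positivity) zero_le_one
          refine pow_le_pow_of_le_one (Real.exp_pos _).le ?_ hm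
          rw [Real.exp_le_one_iff]
          have : 0 ≤ κ / 2 * n := by positivity
          linarith
      _ = _ := by rw [one_mul]
  set N := ∏ i, k i with hN
  have hNK : (N : ℝ) ≤ (K : ℝ) ^ n := by rw [hN]; push_cast; exact prod_le_pow hk
  calc _ ≤ (winnerLaw k).real (⋃ m ∈ Finset.Icc s₁ N, {ω | ∃ v S, Spans v S ∧ S.card = m ∧ ω ∈ {ω |
        (∀ x : Vertex k, ((S.filter fun u => ∀ j, j ∉ B → u j = x j).card : ℝ)
          ≤ NB * Real.exp (-(ε * n))) ∧ Stuck b B S ω}}) := by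
        refine measureReal_mono ?_ (measure_ne_top _ _)
        rintro ω ⟨v, S, h1, h2, h3, h4⟩
        refine Set.mem_biUnion (x := S.card) ?_ ⟨v, S, h1, rfl, h3, h4⟩
        refine Finset.mem_coe.2 (Finset.mem_Icc.2 ⟨h2, ?_⟩)
        refine (Finset.card_le_univ S).trans (le_of_eq ?_)
        simp [hN]
    _ ≤ ∑ m ∈ Finset.Icc s₁ N, _ := measureReal_biUnion_finset_le _ _
    _ ≤ ∑ m ∈ Finset.Icc s₁ N, (K : ℝ) ^ n * Real.exp (-(κ / 2 * n)) ^ s₁ :=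
        Finset.sum_le_sum fun m hm => hterm m (Finset.mem_Icc.1 hm).1
    _ = (Finset.Icc s₁ N).card * ((K : ℝ) ^ n * Real.exp (-(κ / 2 * n)) ^ s₁) := by
        rw [Finset.sum_const, nsmul_eq_mul]
    _ ≤ (K : ℝ) ^ n * ((K : ℝ) ^ n * Real.exp (-(κ / 2 * n)) ^ s₁) := by
        refine mul_le_mul_of_nonneg_right (le_trans ?_ hNK) (by positivity)
        rw [Nat.card_Icc]
        exact_mod_cast (by omega : N + 1 - s₁ ≤ N)
    _ = Real.exp (n * (2 * Real.log K - κ / 2 * s₁)) := by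
        have : (K : ℝ) ^ n = Real.exp (n * Real.log K) := by
          rw [Real.exp_nat_mul, Real.exp_log (by linarith)]
        rw [this, ← Real.exp_nat_mul, ← Real.exp_add, ← Real.exp_add]
        congr 1
        ring
    _ ≤ Real.exp (-n) := by
        refine Real.exp_le_exp.2 ?_
        have : 2 * Real.log K - κ / 2 * s₁ ≤ -1 := by linarith
        nlinarith

end Asymptotics

/-! ### Choice of constants for the connecting step. -/

section Connection

open Filter

/-- If more than `θ / 2` points of `R` were farther than `d` from `Q`, `exists_close_pair` applied
to them would contradict `h₁`. A separated set is then chosen among the rest, whose size is at least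
`θ / 2`; `h₂` makes it large. -/
theorem exists_separated_close {n : ℕ} {k : Fin n → ℕ} [∀ i, NeZero (k i)] {K : ℕ}
    (hK : ∀ i, k i ≤ K) (B : Finset (Fin n)) {η t θ : ℝ} (hη0 : 0 ≤ η) (hη1 : η < 1)
    (ht0 : 0 < t) (ht1 : t ≤ 1) (hθ : 0 < θ) (d J ρ : ℕ)
    (h₁ : (∏ i ∈ B, (k i : ℝ)) ^ 2 < (1 - η ^ 2) ^ B.card * (1 + η) ^ (d + 1) * (θ / 2 * θ))
    (h₂ : J * ((1 + K * t) ^ n / t ^ ρ) ≤ θ / 2)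
    (u v : Vertex k) (R Q : Finset (Vertex k)) (hR : ∀ r ∈ R, ∀ j, j ∉ B → r j = u j)
    (hQ : ∀ q ∈ Q, ∀ j, j ∉ B → q j = v j) (hRθ : θ ≤ R.card) (hQθ : θ ≤ Q.card) :
    ∃ M ⊆ R, J ≤ M.card ∧ (∀ r ∈ M, ∃ q ∈ Q, (B.filter fun i => r i ≠ q i).card ≤ d) ∧
      ∀ r ∈ M, ∀ r' ∈ M, r ≠ r' → ρ < hammingDist r r' := by
  classical
  have hη2 : 0 < 1 - η ^ 2 := by nlinarith
  let G := R.filter fun r => ∃ q ∈ Q, (B.filter fun i => r i ≠ q i).card ≤ d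
  have hfar : ((R \ G).card : ℝ) ≤ θ / 2 := by
    by_contra hlt
    push Not at hlt
    have hne : (R \ G).Nonempty := by
      rw [← Finset.card_pos]
      have : (0 : ℝ) < (R \ G).card := by linarith
      exact_mod_cast this
    have hQne : Q.Nonempty := by
      rw [← Finset.card_pos]
      have : (0 : ℝ) < Q.card := by linarith
      exact_mod_cast this
    obtain ⟨r, hr, q, hq, hrq⟩ := exists_close_pair hη0 hη1 B (R \ G) Q hne hQne
      (fun a ha b hb j hj => by
        rw [hR a (Finset.mem_sdiff.1 ha).1 j hj, hR b (Finset.mem_sdiff.1 hb).1 j hj])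
      (fun a ha b hb j hj => by rw [hQ a ha j hj, hQ b hb j hj])
    have hd : d + 1 ≤ (B.filter fun i => r i ≠ q i).card := by
      by_contra h
      exact (Finset.mem_sdiff.1 hr).2
        (Finset.mem_filter.2 ⟨(Finset.mem_sdiff.1 hr).1, q, hq, by omega⟩)
    have h3 : (1 - η ^ 2) ^ B.card * (1 + η) ^ (d + 1) * (θ / 2 * θ)
        ≤ (1 - η ^ 2) ^ B.card * (1 + η) ^ (B.filter fun i => r i ≠ q i).card
          * ((R \ G).card * Q.card) := by
      have h4 : (1 + η) ^ (d + 1) ≤ (1 + η) ^ (B.filter fun i => r i ≠ q i).card :=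
        pow_le_pow_right₀ (by linarith) hd
      have h5 : θ / 2 * θ ≤ (R \ G).card * Q.card :=
        mul_le_mul hlt.le hQθ hθ.le (by positivity)
      refine mul_le_mul (mul_le_mul_of_nonneg_left h4 (by positivity)) h5 ?_ ?_ <;> positivity
    linarith
  have hG : θ / 2 ≤ G.card := by
    have h3 : ((R \ G).card : ℝ) + G.card = R.card := by
      exact_mod_cast Finset.card_sdiff_add_card_eq_card (Finset.filter_subset _ R)
    linarith
  set β : ℝ := (1 + K * t) ^ n / t ^ ρ with hβ
  have hβ0 : 0 < β := by positivity
  obtain ⟨M, hMG, hsep, hM⟩ := exists_separated_subset G ρ ⌊β⌋₊ (fun r => by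
    refine Nat.le_floor ?_
    rw [hβ, le_div_iff₀ (by positivity)]
    exact card_hammingBall_mul_le hK ht0 ht1 r ρ)
  refine ⟨M, hMG.trans (Finset.filter_subset _ R), ?_,
    fun r hr => (Finset.mem_filter.1 (hMG hr)).2, hsep⟩
  have h3 : (G.card : ℝ) ≤ M.card * β := by
    calc (G.card : ℝ) ≤ M.card * (⌊β⌋₊ : ℝ) := by exact_mod_cast hM
      _ ≤ M.card * β := mul_le_mul_of_nonneg_left (Nat.floor_le hβ0.le) (Nat.cast_nonneg _)
  have h4 : (J : ℝ) * β ≤ M.card * β := by linarith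
  exact_mod_cast le_of_mul_le_mul_right h4 hβ0

theorem exp_neg_two_mul_le {x : ℝ} (hx0 : 0 ≤ x) (hx1 : x ≤ 1 / 2) : Real.exp (-(2 * x)) ≤ 1 - x := by
  have h1 := Real.add_one_le_exp (2 * x)
  have h2 : 0 < Real.exp (2 * x) := Real.exp_pos _
  rw [Real.exp_neg, inv_le_iff_one_le_mul₀ h2]
  nlinarith

theorem exp_half_le {x : ℝ} (hx0 : 0 ≤ x) (hx1 : x ≤ 1) : Real.exp (x / 2) ≤ 1 + x := by
  have h1 := Real.add_one_le_exp (-(x / 2))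
  have h2 : 0 < Real.exp (x / 2) := Real.exp_pos _
  rw [Real.exp_neg] at h1
  have h3 : (-(x / 2) + 1) * Real.exp (x / 2) ≤ 1 := by
    calc _ ≤ (Real.exp (x / 2))⁻¹ * Real.exp (x / 2) := mul_le_mul_of_nonneg_right h1 h2.le
      _ = 1 := inv_mul_cancel₀ h2.ne'
  have h4 : 1 ≤ (1 + x) * (1 - x / 2) := by nlinarith
  have h5 : (1 + x) * (-(x / 2) + 1) * Real.exp (x / 2) ≤ (1 + x) * 1 := by
    rw [mul_assoc]; exact mul_le_mul_of_nonneg_left h3 (by linarith)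
  nlinarith

theorem card_others {n : ℕ} {i₀ i₁ : Fin n} (h : i₀ ≠ i₁) : (others i₀ i₁).card = n - 2 := by
  have : others i₀ i₁ = ({i₀, i₁} : Finset (Fin n))ᶜ := by
    ext i; simp [mem_others]
  rw [this, Finset.card_compl, Finset.card_pair h, Fintype.card_fin]

/-- Per dimension the distance factor gains `η * δ / 2 = δ² / 32` in the exponent. The slicing loss
and the density loss are `2 * η²` each, together `δ² / 64`. A surplus of `δ² / 64` remains. -/
theorem sq_lt_of_exp_small {η δ N s : ℝ} {n m d : ℕ} (hδ0 : 0 < δ) (hη : η = δ / 16)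
    (hη1 : η ≤ 1 / 16) (hN : 0 < N) (hs : 0 < s) (hm : m ≤ n) (hd : δ * n < d + 1)
    (hlim : 4 * s ^ 2 ≤ Real.exp (δ ^ 2 / 64 * n)) :
    N ^ 2 < (1 - η ^ 2) ^ m * (1 + η) ^ (d + 1)
      * (N * Real.exp (-(η ^ 2 * n)) / s / 2 * (N * Real.exp (-(η ^ 2 * n)) / s)) := by
  have hη0 : 0 < η := by rw [hη]; positivity
  have e1 : Real.exp (-(2 * η ^ 2 * n)) ≤ (1 - η ^ 2) ^ m := by
    have h3 : Real.exp (-(2 * η ^ 2)) ≤ 1 - η ^ 2 :=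
      exp_neg_two_mul_le (by positivity) (by nlinarith)
    calc Real.exp (-(2 * η ^ 2 * n)) = Real.exp (-(2 * η ^ 2)) ^ n := by
          rw [← Real.exp_nat_mul]; congr 1; ring
      _ ≤ (1 - η ^ 2) ^ n := by gcongr
      _ ≤ (1 - η ^ 2) ^ m :=
          pow_le_pow_of_le_one ((Real.exp_pos _).le.trans h3) (by nlinarith) hm
  have e2 : Real.exp (η / 2 * (δ * n)) ≤ (1 + η) ^ (d + 1) := by
    calc Real.exp (η / 2 * (δ * n)) ≤ Real.exp (((d + 1 : ℕ) : ℝ) * (η / 2)) := by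
          refine Real.exp_le_exp.2 ?_
          rw [mul_comm]
          push_cast
          gcongr
      _ = Real.exp (η / 2) ^ (d + 1) := by rw [Real.exp_nat_mul]
      _ ≤ (1 + η) ^ (d + 1) := by
          gcongr
          exact exp_half_le hη0.le (by linarith)
  have e3 : N * Real.exp (-(η ^ 2 * n)) / s / 2 * (N * Real.exp (-(η ^ 2 * n)) / s)
      = N ^ 2 * Real.exp (-(2 * η ^ 2 * n)) / (2 * s ^ 2) := by
    have : Real.exp (-(2 * η ^ 2 * n)) = Real.exp (-(η ^ 2 * n)) * Real.exp (-(η ^ 2 * n)) := by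
      rw [← Real.exp_add]; congr 1; ring
    rw [this]
    field_simp
  have e5 : Real.exp (-(2 * η ^ 2 * n)) * Real.exp (η / 2 * (δ * n)) * Real.exp (-(2 * η ^ 2 * n))
      = Real.exp (δ ^ 2 / 64 * n) := by
    rw [← Real.exp_add, ← Real.exp_add]
    congr 1
    rw [hη]
    ring
  have e6 : Real.exp (-(2 * η ^ 2 * n)) * Real.exp (η / 2 * (δ * n))
      ≤ (1 - η ^ 2) ^ m * (1 + η) ^ (d + 1) :=
    mul_le_mul e1 e2 (Real.exp_pos _).le ((Real.exp_pos _).le.trans e1)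
  have e7 : N ^ 2 * (4 * s ^ 2) / (2 * s ^ 2) = 2 * N ^ 2 := by field_simp; norm_num
  have e8 : 0 < N ^ 2 := by positivity
  calc N ^ 2 < N ^ 2 * (4 * s ^ 2) / (2 * s ^ 2) := by rw [e7]; linarith
    _ ≤ N ^ 2 * Real.exp (δ ^ 2 / 64 * n) / (2 * s ^ 2) := by gcongr
    _ = (Real.exp (-(2 * η ^ 2 * n)) * Real.exp (η / 2 * (δ * n)))
          * (N * Real.exp (-(η ^ 2 * n)) / s / 2 * (N * Real.exp (-(η ^ 2 * n)) / s)) := by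
        rw [e3, ← e5]; ring
    _ ≤ _ := mul_le_mul_of_nonneg_right e6 (by positivity)

/-- The `d`-dependent factors of `K ^ (d + 4)` and of the ball bound at `t = 1 / (8K)` combine to
`(64 * K ^ 3) ^ d ≤ exp (n / 16)`. With two factors `exp (n / 8)` and the density loss, the exponent
is at most `3 / 8 * n`, below `n * log 2`. -/
theorem mul_ball_bound_le {K n d : ℕ} {J X N s δ ε : ℝ} (hK : 1 ≤ K) (hs : 0 < s)
    (hN : (2 : ℝ) ^ (n - 2) ≤ N) (hn2 : 2 ≤ n) (hε1 : ε ≤ 1 / 16)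
    (hδΓ : Real.log (64 * (K : ℝ) ^ 3) * δ = 1 / 16) (hΓ0 : 0 ≤ Real.log (64 * (K : ℝ) ^ 3))
    (hd1 : (d : ℝ) ≤ δ * n) (hX : X = Real.exp (n / 8) * (K : ℝ) ^ (d + 4)) (hJ2 : J ≤ 2 * X)
    (e5 : 16 * s * (K : ℝ) ^ 4 * (8 * K) ^ 9 * Real.exp (3 / 8 * n) ≤ 2 ^ n) :
    J * ((1 + K * (1 / (8 * K : ℝ))) ^ n / (1 / (8 * K : ℝ)) ^ (2 * (d + 4) + 1))
      ≤ N * Real.exp (-(ε * n)) / s / 2 := by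
  have hK0 : (0 : ℝ) < K := by exact_mod_cast hK
  have e1 : (1 + K * (1 / (8 * K : ℝ))) ^ n ≤ Real.exp (n / 8) := by
    have : 1 + K * (1 / (8 * K : ℝ)) ≤ Real.exp (1 / 8) := by
      have h3 : K * (1 / (8 * K : ℝ)) = 1 / 8 := by field_simp
      rw [h3]
      linarith [Real.add_one_le_exp (1 / 8)]
    calc _ ≤ Real.exp (1 / 8) ^ n := by gcongr
      _ = Real.exp (n / 8) := by rw [← Real.exp_nat_mul]; congr 1; ring
  have e2 : (64 * (K : ℝ) ^ 3) ^ d ≤ Real.exp (n / 16) := by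
    calc (64 * (K : ℝ) ^ 3) ^ d = Real.exp (d * Real.log (64 * (K : ℝ) ^ 3)) := by
          rw [Real.exp_nat_mul, Real.exp_log (by positivity)]
      _ ≤ Real.exp (n / 16) := by
          refine Real.exp_le_exp.2 ?_
          calc (d : ℝ) * Real.log (64 * (K : ℝ) ^ 3) ≤ δ * n * Real.log (64 * (K : ℝ) ^ 3) := by gcongr
            _ = n / 16 := by rw [show δ * n * Real.log (64 * (K : ℝ) ^ 3) = Real.log (64 * (K : ℝ) ^ 3) * δ * n by ring, hδΓ]; ring
  have e3 : (2 : ℝ) ^ n ≤ 4 * N := by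
    have h4 : (2 : ℝ) ^ n = 2 ^ (n - 2) * 2 ^ 2 := by rw [← pow_add]; congr 1; omega
    rw [h4]; linarith
  have e4 : Real.exp (-(n / 16)) ≤ Real.exp (-(ε * n)) := by
    refine Real.exp_le_exp.2 ?_
    have : ε * n ≤ 1 / 16 * n := by gcongr
    linarith
  have e6 : ((1 + K * (1 / (8 * K : ℝ))) ^ n / (1 / (8 * K : ℝ)) ^ (2 * (d + 4) + 1))
      ≤ Real.exp (n / 8) * (8 * K) ^ (2 * (d + 4) + 1) := by
    rw [one_div_pow, div_div_eq_mul_div, div_one]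
    gcongr
  have e7 : X * (8 * K : ℝ) ^ (2 * (d + 4) + 1)
      = Real.exp (n / 8) * (64 * (K : ℝ) ^ 3) ^ d * (K ^ 4 * (8 * K) ^ 9) := by
    have : (64 * (K : ℝ) ^ 3) ^ d = K ^ d * ((8 * K) ^ 2) ^ d := by
      rw [← mul_pow]; congr 1; ring
    rw [hX, this]
    generalize (8 * K : ℝ) = y
    ring
  have hX0 : 0 ≤ X := by rw [hX]; positivity
  have hN0 : 0 ≤ N := le_trans (by positivity) hN
  calc _ ≤ (2 * X) * (Real.exp (n / 8) * (8 * K) ^ (2 * (d + 4) + 1)) := by gcongr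
    _ = 2 * Real.exp (n / 8) * (Real.exp (n / 8) * (64 * (K : ℝ) ^ 3) ^ d
          * (K ^ 4 * (8 * K) ^ 9)) := by rw [← e7]; ring
    _ ≤ 2 * Real.exp (n / 8) * (Real.exp (n / 8) * Real.exp (n / 16)
          * (K ^ 4 * (8 * K) ^ 9)) := by gcongr
    _ = (16 * s * (K : ℝ) ^ 4 * (8 * K) ^ 9 * Real.exp (3 / 8 * n))
          * Real.exp (-(n / 16)) / (8 * s) := by
        have : Real.exp (3 / 8 * n) = Real.exp (n / 8) * Real.exp (n / 8) * Real.exp (n / 16)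
            * Real.exp (n / 16) := by
          rw [← Real.exp_add, ← Real.exp_add, ← Real.exp_add]; congr 1; ring
        rw [this, Real.exp_neg]
        have h0 := Real.exp_ne_zero ((n : ℝ) / 16)
        field_simp
        norm_num
    _ ≤ (4 * N) * Real.exp (-(ε * n)) / (8 * s) := by
        refine div_le_div_of_nonneg_right (mul_le_mul (e5.trans e3) e4 ?_ ?_) ?_ <;> positivity
    _ = _ := by field_simp; ring

/-- With high probability, `u` reaches `v` whenever `u` reaches many vertices and `v` is reached
from many vertices in the directions other than `i₀` and `i₁`. -/
theorem exists_eventually_prob_not_reachIn_le {K : ℕ} (hK : 2 ≤ K) :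
    ∃ ε : ℝ, 0 < ε ∧ ∀ s₁ : ℕ, 1 ≤ s₁ → ∀ᶠ n : ℕ in atTop, ∀ k : Fin n → ℕ,
      (∀ i, 2 ≤ k i ∧ k i ≤ K) → ∀ i₀ i₁ : Fin n, i₀ ≠ i₁ →
      (winnerLaw k).real {ω | ∃ u v : Vertex k,
        (∏ i ∈ others i₀ i₁, (k i : ℝ)) * Real.exp (-(ε * n)) / s₁
          ≤ (reachSet true (others i₀ i₁) ω u).card ∧
        (∏ i ∈ others i₀ i₁, (k i : ℝ)) * Real.exp (-(ε * n)) / s₁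
          ≤ (reachSet false (others i₀ i₁) ω v).card ∧
        ¬ ReachIn Finset.univ ω u v} ≤ Real.exp (-n) := by
  have hK' : (2 : ℝ) ≤ K := by exact_mod_cast hK
  set Γ : ℝ := Real.log (64 * (K : ℝ) ^ 3) with hΓ
  have hΓ1 : 1 ≤ Γ := by
    rw [hΓ, Real.le_log_iff_exp_le (by positivity)]
    have : (1 : ℝ) ≤ (K : ℝ) ^ 3 := one_le_pow₀ (by linarith)
    linarith [Real.exp_one_lt_d9]
  set δ : ℝ := 1 / (16 * Γ) with hδ
  have hδ0 : 0 < δ := by positivity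
  have hδ1 : δ ≤ 1 / 16 := by
    rw [hδ]
    gcongr
    linarith
  have hδΓ : Γ * δ = 1 / 16 := by rw [hδ]; field_simp
  set η : ℝ := δ / 16 with hη
  have hη0 : 0 < η := by positivity
  have hη1 : η ≤ 1 / 16 := by rw [hη]; linarith
  set ε : ℝ := η ^ 2 with hε
  have hε0 : 0 < ε := by positivity
  have hε1 : ε ≤ 1 / 16 := by rw [hε]; nlinarith
  refine ⟨ε, hε0, fun s₁ hs₁ => ?_⟩
  have hs₁' : (1 : ℝ) ≤ s₁ := by exact_mod_cast hs₁
  have hr : Real.exp (3 / 8) / 2 < 1 := by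
    rw [div_lt_one two_pos, ← Real.lt_log_iff_exp_lt two_pos]
    linarith [Real.log_two_gt_d9]
  have hexp : ∀ x : ℝ, 0 < x → Real.exp (-x) < 1 := fun x hx => by
    rw [Real.exp_lt_one_iff]; linarith
  filter_upwards [eventually_ge_atTop 2,
    eventually_mul_pow_mul_pow_le (4 * s₁ ^ 2) 0 (Real.exp_pos _).le
      (hexp (δ ^ 2 / 64) (by positivity)),
    eventually_mul_pow_mul_pow_le (16 * s₁ * K ^ 4 * (8 * K) ^ 9) 0
      (by positivity : 0 ≤ Real.exp (3 / 8) / 2) hr,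
    eventually_mul_pow_mul_pow_le (2 * Real.log K + 1) 1 (Real.exp_pos _).le
      (hexp (1 / 8) (by norm_num))]
    with n hn2 hlim1 hlim2 hlim3 k hk i₀ i₁ h01
  have := neZero_of_two_le hk
  set B := others i₀ i₁ with hB
  set NB : ℝ := ∏ i ∈ B, (k i : ℝ) with hNB
  have hkpos : ∀ i, (0 : ℝ) < k i := fun i => by
    exact_mod_cast (by have := (hk i).1; omega : 0 < k i)
  have hNBpos : 0 < NB := Finset.prod_pos fun i _ => hkpos i
  have hBcard : B.card = n - 2 := card_others h01
  set θ : ℝ := NB * Real.exp (-(ε * n)) / s₁ with hθ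
  have hθ0 : 0 < θ := by positivity
  set d := ⌊δ * n⌋₊ with hd
  have hd1 : (d : ℝ) ≤ δ * n := Nat.floor_le (by positivity)
  have hd2 : δ * n < d + 1 := Nat.lt_floor_add_one _
  -- Each attempt succeeds with probability at least `K ^ (-(d + 4))`. This many attempts make the
  -- failure probability at most `exp (-exp (n / 8))`, which beats the at most `K ^ (2 * n)` pairs
  -- of vertices.
  set X : ℝ := Real.exp (n / 8) * (K : ℝ) ^ (d + 4) with hX
  have hX1 : 1 ≤ X := one_le_mul_of_one_le_of_one_le
    (Real.one_le_exp (by positivity)) (one_le_pow₀ (by linarith))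
  set J := ⌈X⌉₊ with hJ
  have hJX : X ≤ J := Nat.le_ceil _
  have hJ2 : (J : ℝ) ≤ 2 * X := by
    have := (Nat.ceil_lt_add_one (by linarith : 0 ≤ X)).le
    linarith
  have hlim1' : 4 * (s₁ : ℝ) ^ 2 ≤ Real.exp (δ ^ 2 / 64 * n) := by
    rw [pow_zero, mul_one, ← Real.exp_nat_mul, mul_neg, Real.exp_neg,
      ← div_eq_mul_inv, div_le_one (Real.exp_pos _)] at hlim1
    rwa [mul_comm (δ ^ 2 / 64)]
  have h₁ : NB ^ 2 < (1 - η ^ 2) ^ B.card * (1 + η) ^ (d + 1) * (θ / 2 * θ) :=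
    sq_lt_of_exp_small hδ0 hη hη1 hNBpos (by linarith) (by omega) hd2 hlim1'
  have hNB2 : (2 : ℝ) ^ (n - 2) ≤ NB := by
    rw [← hBcard, ← Finset.prod_const]
    exact Finset.prod_le_prod (fun _ _ => by norm_num) fun i _ => by exact_mod_cast (hk i).1
  have hlim2' : 16 * s₁ * (K : ℝ) ^ 4 * (8 * K) ^ 9 * Real.exp (3 / 8 * n) ≤ 2 ^ n := by
    rw [pow_zero, mul_one, div_pow, ← Real.exp_nat_mul, ← mul_div_assoc,
      div_le_one (by positivity)] at hlim2
    rwa [mul_comm (3 / 8 : ℝ)]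
  have h₂ : J * ((1 + K * (1 / (8 * K : ℝ))) ^ n / (1 / (8 * K : ℝ)) ^ (2 * (d + 4) + 1))
      ≤ θ / 2 :=
    mul_ball_bound_le (by omega) (by linarith) hNB2 hn2 hε1 hδΓ (by linarith) hd1 hX hJ2 hlim2'
  have hpair := fun u v : Vertex k => prob_not_reachIn_le hk h01 u v θ J d
    (fun R Q hR hQ hRθ hQθ => exists_separated_close (fun i => (hk i).2) B hη0.le (by linarith)
      (by positivity : (0 : ℝ) < 1 / (8 * K)) (by
        rw [div_le_one (by positivity)]; linarith) hθ0 d J _ h₁ h₂ u v R Q hR hQ hRθ hQθ)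
  have hKinv : (1 / K : ℝ) ^ (d + 4) ≤ 1 :=
    pow_le_one₀ (by positivity) ((div_le_one (by linarith)).2 (by linarith))
  have hfail : (1 - (1 / K : ℝ) ^ (d + 4)) ^ J ≤ Real.exp (-Real.exp (n / 8)) := by
    calc (1 - (1 / K : ℝ) ^ (d + 4)) ^ J ≤ Real.exp (-(1 / K : ℝ) ^ (d + 4)) ^ J := by
          refine pow_le_pow_left₀ (by linarith) ?_ J
          linarith [Real.add_one_le_exp (-(1 / K : ℝ) ^ (d + 4))]
      _ = Real.exp (J * (-(1 / K : ℝ) ^ (d + 4))) := by rw [← Real.exp_nat_mul]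
      _ ≤ Real.exp (-Real.exp (n / 8)) := by
          refine Real.exp_le_exp.2 ?_
          have h3 : X * (1 / K : ℝ) ^ (d + 4) = Real.exp (n / 8) := by
            rw [hX, one_div_pow, mul_assoc, mul_one_div_cancel (by positivity), mul_one]
          have h4 : X * (1 / K : ℝ) ^ (d + 4) ≤ J * (1 / K : ℝ) ^ (d + 4) := by gcongr
          linarith
  have hcardV : (Fintype.card (Vertex k) : ℝ) ≤ Real.exp (n * Real.log K) := by
    have h3 : (Fintype.card (Vertex k) : ℝ) = ∏ i, (k i : ℝ) := by simp
    rw [h3, Real.exp_nat_mul, Real.exp_log (by linarith)]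
    exact prod_le_pow hk
  have hlim3' : (2 * Real.log K + 1) * n ≤ Real.exp (n / 8) := by
    rw [pow_one, ← Real.exp_nat_mul, mul_neg, Real.exp_neg, ← div_eq_mul_inv,
      div_le_one (Real.exp_pos _)] at hlim3
    rwa [show (n : ℝ) / 8 = n * (1 / 8) by ring]
  calc _ ≤ (winnerLaw k).real (⋃ p : Vertex k × Vertex k, {ω | θ ≤ (reachSet true B ω p.1).card ∧
          θ ≤ (reachSet false B ω p.2).card ∧ ¬ ReachIn Finset.univ ω p.1 p.2}) := by
        refine measureReal_mono ?_ (measure_ne_top _ _)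
        rintro ω ⟨u, v, h⟩
        exact Set.mem_iUnion.2 ⟨(u, v), h⟩
    _ ≤ ∑ p : Vertex k × Vertex k, _ := measureReal_iUnion_fintype_le _
    _ ≤ ∑ _p : Vertex k × Vertex k, Real.exp (-Real.exp (n / 8)) :=
        Finset.sum_le_sum fun p _ => (hpair p.1 p.2).trans hfail
    _ = Fintype.card (Vertex k) * Fintype.card (Vertex k) * Real.exp (-Real.exp (n / 8)) := by
        rw [Finset.sum_const, nsmul_eq_mul, Finset.card_univ, Fintype.card_prod]
        push_cast
        ring
    _ ≤ Real.exp (n * Real.log K) * Real.exp (n * Real.log K) * Real.exp (-Real.exp (n / 8)) := by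
        gcongr
    _ ≤ Real.exp (-n) := by
        rw [← Real.exp_add, ← Real.exp_add]
        refine Real.exp_le_exp.2 ?_
        linarith

end Connection

/-! ### Combining the estimates, and the small dimensions. -/

section Assembly

open Filter

variable {n : ℕ} {k : Fin n → ℕ}

/-- Take `s₁` connected vertices of the exploration and continue from each within `B`. The union is
connected and stuck in the directions of `B`, so by `hno` some section of it exceeds `θ`. By
pigeonhole one of the `s₁` vertices contributes at least `θ / s₁`. -/
theorem exists_large_reachSet {b : Bool} {B : Finset (Fin n)} {ω : Winners k} {u : Vertex k}
    {s₁ : ℕ} (hs₁ : 1 ≤ s₁) (hu : s₁ ≤ (reachSet b Finset.univ ω u).card) {θ : ℝ}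
    (hno : ¬ ∃ v S, Spans v S ∧ s₁ ≤ S.card ∧
      (∀ x : Vertex k, ((S.filter fun w => ∀ j, j ∉ B → w j = x j).card : ℝ) ≤ θ) ∧
      Stuck b B S ω) :
    ∃ u' ∈ reachSet b Finset.univ ω u, θ / s₁ ≤ (reachSet b B ω u').card := by
  classical
  obtain ⟨l, -, hl, hcard⟩ := (spans_reachSet b Finset.univ ω u).exists_visited (s₁ - 1) (by omega)
  have hcard' : (visited u l).card = s₁ := by omega
  set T := (visited u l).biUnion (reachSet b B ω) with hT
  have hsub : visited u l ⊆ T := fun w hw =>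
    Finset.mem_biUnion.2 ⟨w, hw, self_mem_reachSet b B ω w⟩
  have hsec : ¬ ∀ x : Vertex k, ((T.filter fun w => ∀ j, j ∉ B → w j = x j).card : ℝ) ≤ θ :=
    fun h => hno ⟨u, T, (spans_visited u l).biUnion_reachSet b B ω,
      by rw [← hcard']; exact Finset.card_le_card hsub, h, stuck_biUnion_reachSet b B ω _⟩
  push Not at hsec
  obtain ⟨x, hx⟩ := hsec
  by_contra hcon
  push Not at hcon
  have hs : (0 : ℝ) < s₁ := by exact_mod_cast hs₁
  have h1 : (T.card : ℝ) ≤ ∑ w ∈ visited u l, ((reachSet b B ω w).card : ℝ) := by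
    exact_mod_cast Finset.card_biUnion_le
  have h2 : ∑ w ∈ visited u l, ((reachSet b B ω w).card : ℝ) ≤ ∑ _w ∈ visited u l, θ / s₁ :=
    Finset.sum_le_sum fun w hw => (hcon w (hl hw)).le
  have h3 : ∑ _w ∈ visited u l, θ / (s₁ : ℝ) = θ := by
    rw [Finset.sum_const, hcard', nsmul_eq_mul]
    field_simp
  have h4 : ((T.filter fun w => ∀ j, j ∉ B → w j = x j).card : ℝ) ≤ T.card := by
    exact_mod_cast Finset.card_filter_le _ _
  linarith

/-- The event of the main theorem. -/
def Good (K : ℕ) (ω : Winners k) : Prop :=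
  ∀ v : Vertex k, ({u | CanReach ω u v}.ncard : ℝ) ≤ threshold K ∨
    ∀ u, ¬ IsSink ω u → CanReach ω u v

/-- An exploration is itself a connected stuck set. If its size is excluded, `hsmall` pushes it
beyond `s₁`, and `hlarge` leads to a vertex with a large exploration within `B`. A non-sink reaches
two vertices, which is already an excluded size. -/
theorem good_of_forall_not {K s₁ : ℕ} (hs₁ : 1 ≤ s₁) (B : Finset (Fin n)) (θ : ℝ) (ω : Winners k)
    (hsmall : ∀ b : Bool, ¬ ∃ v S, Spans v S ∧ Excluded K b S.card ∧ S.card ≤ s₁ ∧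
        Stuck b Finset.univ S ω)
    (hlarge : ∀ b : Bool, ¬ ∃ v S, Spans v S ∧ s₁ ≤ S.card ∧
      (∀ x : Vertex k, ((S.filter fun w => ∀ j, j ∉ B → w j = x j).card : ℝ) ≤ θ) ∧ Stuck b B S ω)
    (hconn : ¬ ∃ u v : Vertex k, θ / s₁ ≤ (reachSet true B ω u).card ∧
      θ / s₁ ≤ (reachSet false B ω v).card ∧ ¬ ReachIn Finset.univ ω u v) : Good K ω := by
  classical
  have hexc : ∀ b u, Excluded K b (reachSet b Finset.univ ω u).card →
      ∃ u' ∈ reachSet b Finset.univ ω u, θ / s₁ ≤ (reachSet b B ω u').card := by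
    intro b u h
    refine exists_large_reachSet hs₁ ?_ (hlarge b)
    by_contra hlt
    exact hsmall b ⟨u, _, spans_reachSet b _ ω u, h, by omega, stuck_reachSet b _ ω u⟩
  intro v
  by_cases hv : ({u | CanReach ω u v}.ncard : ℝ) ≤ threshold K
  · exact Or.inl hv
  refine Or.inr fun u hu => ?_
  have hset : {u | CanReach ω u v} = (reachSet false Finset.univ ω v : Set (Vertex k)) := by
    ext w
    simp [mem_reachSet_false, canReach_iff_reachIn_univ]
  rw [hset, Set.ncard_coe_finset] at hv
  obtain ⟨v', hv', hv'θ⟩ := hexc false v (by simpa [Excluded] using hv)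
  have hu2 : 2 ≤ (reachSet true Finset.univ ω u).card := by
    unfold IsSink at hu
    push Not at hu
    obtain ⟨w, hw⟩ := hu
    have hw' := edge_iff_edgeIn_univ.1 hw
    have hne : w ≠ u := by
      obtain ⟨-, -, -, h⟩ := hw'
      exact h
    rw [← Finset.card_pair hne]
    refine Finset.card_le_card fun x hx => ?_
    rcases Finset.mem_insert.1 hx with rfl | hx
    · exact mem_reachSet_true.2 (Relation.ReflTransGen.single hw')
    · rw [Finset.mem_singleton.1 hx]
      exact self_mem_reachSet true _ ω u
  obtain ⟨u', hu', hu'θ⟩ := hexc true u (by simpa [Excluded] using hu2)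
  have huv : ReachIn Finset.univ ω u' v' := by
    by_contra h
    exact hconn ⟨u', v', hu'θ, hv'θ, h⟩
  rw [canReach_iff_reachIn_univ]
  exact ((mem_reachSet_true.1 hu').trans huv).trans (mem_reachSet_false.1 hv')

theorem exists_eventually_prob_not_good_le {K : ℕ} (hK : 2 ≤ K) :
    ∃ c : ℝ, 0 < c ∧ ∀ᶠ n : ℕ in atTop, ∀ k : Fin n → ℕ, (∀ i, 2 ≤ k i ∧ k i ≤ K) →
      (winnerLaw k).real {ω | ¬ Good K ω} ≤ Real.exp (-(c * n)) := by
  obtain ⟨ε, hε, hconn⟩ := exists_eventually_prob_not_reachIn_le hK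
  obtain ⟨s₀, hlarge⟩ := eventually_prob_large_stuck_le hK hε
  have hs₁ : 1 ≤ s₀ + 1 := by omega
  obtain ⟨c₁, hc₁, h₁⟩ := eventually_prob_small_stuck_le hK true (s₀ + 1)
  obtain ⟨c₂, hc₂, h₂⟩ := eventually_prob_small_stuck_le hK false (s₀ + 1)
  set c := min (min c₁ c₂) 1 with hc
  have hc0 : 0 < c := by positivity
  have hr1 : Real.exp (-(c / 2)) < 1 := by rw [Real.exp_lt_one_iff]; linarith
  refine ⟨c / 2, by linarith, ?_⟩
  filter_upwards [eventually_ge_atTop 2, h₁, h₂, hconn (s₀ + 1) hs₁, hlarge (s₀ + 1) (by omega),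
    eventually_mul_pow_mul_pow_le 5 0 (Real.exp_pos (-(c / 2))).le hr1]
    with n hn h₁ h₂ hconn hlarge hlim k hk
  have := neZero_of_two_le hk
  let i₀ : Fin n := ⟨0, by omega⟩
  let i₁ : Fin n := ⟨1, by omega⟩
  have h01 : i₀ ≠ i₁ := by simp [i₀, i₁]
  set B := others i₀ i₁
  set θ : ℝ := (∏ i ∈ B, (k i : ℝ)) * Real.exp (-(ε * n)) with hθ
  let A : Bool → Set (Winners k) := fun b => {ω | ∃ v S, Spans v S ∧ Excluded K b S.card ∧
    S.card ≤ s₀ + 1 ∧ Stuck b Finset.univ S ω}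
  let D : Bool → Set (Winners k) := fun b => {ω | ∃ v S, Spans v S ∧ s₀ + 1 ≤ S.card ∧
    (∀ x : Vertex k, ((S.filter fun w => ∀ j, j ∉ B → w j = x j).card : ℝ) ≤ θ) ∧ Stuck b B S ω}
  let E : Set (Winners k) := {ω | ∃ u v : Vertex k,
    θ / (s₀ + 1 : ℕ) ≤ (reachSet true B ω u).card ∧
    θ / (s₀ + 1 : ℕ) ≤ (reachSet false B ω v).card ∧ ¬ ReachIn Finset.univ ω u v}
  have hsub : {ω | ¬ Good K ω} ⊆ A true ∪ A false ∪ (D true ∪ D false) ∪ E := by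
    intro ω hω
    by_contra hno
    simp only [Set.mem_union, not_or] at hno
    obtain ⟨⟨⟨hA1, hA2⟩, hD1, hD2⟩, hE⟩ := hno
    exact hω (good_of_forall_not hs₁ B θ ω (fun b => by cases b; exacts [hA2, hA1])
      (fun b => by cases b; exacts [hD2, hD1]) hE)
  have hexp : ∀ c' : ℝ, c ≤ c' → Real.exp (-(c' * n)) ≤ Real.exp (-(c * n)) := fun c' h => by
    refine Real.exp_le_exp.2 ?_
    have : c * n ≤ c' * n := by gcongr
    linarith
  have hA1 : (winnerLaw k).real (A true) ≤ Real.exp (-(c * n)) :=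
    (h₁ k hk).trans (hexp _ ((min_le_left _ _).trans (min_le_left _ _)))
  have hA2 : (winnerLaw k).real (A false) ≤ Real.exp (-(c * n)) :=
    (h₂ k hk).trans (hexp _ ((min_le_left _ _).trans (min_le_right _ _)))
  have hone : Real.exp (-(n : ℝ)) ≤ Real.exp (-(c * n)) := by
    have := hexp 1 (min_le_right _ _)
    rwa [one_mul] at this
  have hD : ∀ b, (winnerLaw k).real (D b) ≤ Real.exp (-(c * n)) :=
    fun b => (hlarge k hk b B).trans hone
  have hE : (winnerLaw k).real E ≤ Real.exp (-(c * n)) := (hconn k hk i₀ i₁ h01).trans hone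
  have hu1 := measureReal_union_le (μ := winnerLaw k) (A true ∪ A false ∪ (D true ∪ D false)) E
  have hu2 := measureReal_union_le (μ := winnerLaw k) (A true ∪ A false) (D true ∪ D false)
  have hu3 := measureReal_union_le (μ := winnerLaw k) (A true) (A false)
  have hu4 := measureReal_union_le (μ := winnerLaw k) (D true) (D false)
  have hD1 := hD true
  have hD2 := hD false
  calc (winnerLaw k).real {ω | ¬ Good K ω}
      ≤ (winnerLaw k).real (A true ∪ A false ∪ (D true ∪ D false) ∪ E) :=
        measureReal_mono hsub (measure_ne_top _ _)
    _ ≤ 5 * Real.exp (-(c * n)) := by linarith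
    _ = (5 * (n : ℝ) ^ 0 * Real.exp (-(c / 2)) ^ n) * Real.exp (-(c / 2 * n)) := by
        rw [pow_zero, mul_one, ← Real.exp_nat_mul, mul_assoc, ← Real.exp_add]
        congr 2
        ring
    _ ≤ 1 * Real.exp (-(c / 2 * n)) := by gcongr
    _ = _ := one_mul _

/-- One good outcome carries mass `1 / Nat.card (Winners k)`, and `1 - x ≤ exp (-x)`. -/
theorem prob_not_good_le_of_exists {K : ℕ} [∀ i, NeZero (k i)] (h : ∃ ω : Winners k, Good K ω) :
    (winnerLaw k).real {ω | ¬ Good K ω} ≤ Real.exp (-(1 / (Nat.card (Winners k) : ℝ))) := by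
  obtain ⟨ω₀, hω₀⟩ := h
  have hsub : {ω | ¬ Good K ω} ⊆ {ω₀}ᶜ := by
    rintro ω hω rfl
    exact hω hω₀
  refine (measureReal_mono hsub (measure_ne_top _ _)).trans ?_
  rw [probReal_compl_eq_one_sub (Set.toFinite _).measurableSet, winnerLaw_real_singleton,
    one_div]
  linarith [Real.add_one_le_exp (-(Nat.card (Winners k) : ℝ)⁻¹)]

theorem card_winners_le {K n₁ : ℕ} (hK : 2 ≤ K) (hk : ∀ i, 2 ≤ k i ∧ k i ≤ K) (hn : n ≤ n₁) :
    Nat.card (Winners k) ≤ K ^ (n₁ * K ^ n₁) := by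
  have hcard : Nat.card (Winners k) = ∏ ℓ : Line k, k ℓ.1 := by
    rw [Nat.card_eq_fintype_card]
    simp
  have hline : Fintype.card (Line k) ≤ n₁ * K ^ n₁ := by
    rw [Fintype.card_sigma]
    calc ∑ i : Fin n, Fintype.card ((j : {j : Fin n // j ≠ i}) → Fin (k j))
        ≤ ∑ _i : Fin n, K ^ n₁ := by
          refine Finset.sum_le_sum fun i _ => ?_
          rw [Fintype.card_pi]
          calc ∏ j : {j : Fin n // j ≠ i}, Fintype.card (Fin (k j))
              ≤ ∏ _j : {j : Fin n // j ≠ i}, K := by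
                refine Finset.prod_le_prod' fun j _ => ?_
                rw [Fintype.card_fin]; exact (hk j).2
            _ = K ^ Fintype.card {j : Fin n // j ≠ i} := by simp
            _ ≤ K ^ n₁ := by
                refine Nat.pow_le_pow_right (by omega) ?_
                refine (Fintype.card_subtype_le _).trans ?_
                rwa [Fintype.card_fin]
      _ = n * K ^ n₁ := by simp
      _ ≤ n₁ * K ^ n₁ := Nat.mul_le_mul_right _ hn
  rw [hcard]
  calc ∏ ℓ : Line k, k ℓ.1 ≤ ∏ _ℓ : Line k, K := Finset.prod_le_prod' fun ℓ _ => (hk ℓ.1).2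
    _ = K ^ Fintype.card (Line k) := by simp
    _ ≤ K ^ (n₁ * K ^ n₁) := Nat.pow_le_pow_right (by omega) hline

theorem exists_good {K : ℕ} (hK : 2 ≤ K) (hk : ∀ i, 2 ≤ k i ∧ k i ≤ K) (hn : 0 < n) :
    ∃ ω : Winners k, Good K ω := by
  have := neZero_of_two_le hk
  obtain ⟨ω, hω⟩ := exists_winners_good hK (fun i => (hk i).2) hn
  refine ⟨ω, fun v => ?_⟩
  rcases hω v with h | h
  · left
    have h1 : (({u | CanReach ω u v}.ncard : ℕ) : ℝ) ≤ ((K - 1 : ℕ) : ℝ) := by exact_mod_cast h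
    rw [Nat.cast_sub (by omega), Nat.cast_one] at h1
    exact h1.trans (sub_one_le_threshold hK)
  · exact Or.inr fun u _ => h u

end Assembly

end DirectedGrid

theorem mainTheorem6 (K : ℕ) (hK : 2 ≤ K) :
    ∃ c : ℝ, 0 < c ∧ ∀ n : ℕ, 2 ≤ n → ∀ k : Fin n → ℕ, (∀ i, 2 ≤ k i ∧ k i ≤ K) →
      (DirectedGrid.winnerLaw k).real
        {ω | ¬ ∀ v : DirectedGrid.Vertex k,
          (({u | DirectedGrid.CanReach ω u v}.ncard : ℝ)
              ≤ Real.log K / (Real.log K - Real.log ((K : ℝ) - 1))) ∨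
          ∀ u, ¬ DirectedGrid.IsSink ω u → DirectedGrid.CanReach ω u v}
        ≤ Real.exp (-(c * n)) := by
  obtain ⟨c, hc, hlarge⟩ := DirectedGrid.exists_eventually_prob_not_good_le hK
  obtain ⟨n₁, hn₁⟩ := Filter.eventually_atTop.1 hlarge
  set G : ℝ := (K : ℝ) ^ ((n₁ + 1) * K ^ (n₁ + 1)) with hG
  have hGpos : 0 < G := by
    have : (0 : ℝ) < K := by exact_mod_cast (by omega : 0 < K)
    positivity
  -- `G` bounds the number of outcomes for all `n ≤ n₁`, so there the second term of the minimum
  -- gives an exponent of at most `1 / G`. The `+ 1` keeps the denominator positive when `n₁ = 0`.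
  refine ⟨min c (1 / (G * (n₁ + 1))), by positivity, fun n hn k hk => ?_⟩
  change (DirectedGrid.winnerLaw k).real {ω | ¬ DirectedGrid.Good K ω} ≤ _
  rcases le_total n₁ n with h | h
  · refine (hn₁ n h k hk).trans (Real.exp_le_exp.2 ?_)
    have : min c (1 / (G * (n₁ + 1))) * n ≤ c * n :=
      mul_le_mul_of_nonneg_right (min_le_left _ _) (Nat.cast_nonneg _)
    linarith
  · have := DirectedGrid.neZero_of_two_le hk
    refine (DirectedGrid.prob_not_good_le_of_exists
      (DirectedGrid.exists_good hK hk (by omega))).trans (Real.exp_le_exp.2 ?_)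
    have hW : (Nat.card (DirectedGrid.Winners k) : ℝ) ≤ G := by
      rw [hG]
      exact_mod_cast DirectedGrid.card_winners_le hK hk (by omega : n ≤ n₁ + 1)
    have hWpos : (0 : ℝ) < Nat.card (DirectedGrid.Winners k) := by
      exact_mod_cast Nat.card_pos
    have h1 : min c (1 / (G * (n₁ + 1))) * n ≤ 1 / (G * (n₁ + 1)) * (n₁ + 1) := by
      refine mul_le_mul (min_le_right _ _) ?_ (Nat.cast_nonneg _) (by positivity)
      exact_mod_cast (by omega : n ≤ n₁ + 1)
    have h2 : 1 / (G * ((n₁ : ℝ) + 1)) * (n₁ + 1) = 1 / G := by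
      field_simp
    have h3 : 1 / G ≤ 1 / (Nat.card (DirectedGrid.Winners k) : ℝ) :=
      one_div_le_one_div_of_le hWpos hW
    linarith
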